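/- Let $\bar M$ be a smooth compact $3$-manifold with boundary, with interior $M$, and let $\rho:\bar M\to[0,\infty)$ be a smooth defining function: $\rho^{-1}(0)=\partial M$ and $d\rho\neq 0$ on $\partial M$. Let $g$ be a smoothly conformally compact asymptotically hyperbolic metric on $M$, i.e. $\bar g=\rho^2 g$ extends to a smooth Riemannian metric on $\bar M$ and $|d\rho|_{\bar g}=1$ along $\partial M$. **The operator.** Let $\mathcal P=\mathcal P[g]$ be a linear second-order elliptic operator on functions on $M$ which is formally self-adjoint with respect to the volume of $g$ and *geometric*: in every coordinate chart its coefficients are given by the same universal real polynomials in the components $g_{ij}$, their partial derivatives, and $(\det g_{ij})^{-1/2}$, the coefficient of a $j$-th derivative involving at most $2-j$ derivatives of the metric. For $s\in\mathbb C$ and $\bar u\in C^\infty(\bar M;\mathbb C)$ let $I_s(\mathcal P)\bar u=\rho^{-s}\mathcal P(\rho^s\bar u)|_{\rho=0}$ be the indicial map. Assume that $I_s(\mathcal P)=p(s)\Phi$, where $p$ is a polynomial all of whose complex roots are simple and are integers, and $\Phi$ is multiplication by a nowhere vanishing function on $\partial M$ that does not depend on $s$. The characteristic exponents are the $s\in\mathbb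 C$ for which $I_s(\mathcal P)$ has a nontrivial kernel at some point of $\partial M$; let $\mu$ be the largest one. **The function spaces.** A function belongs to $C^k_t(M)$ if it is $C^k$ on $M$ and its derivatives of order $j\le k$ in local coordinates of $\bar M$ are $O(\rho^{t-j})$ (equivalently, its covariant derivatives of order $\le k$, measured by $g$, are $O(\rho^t)$). Put $\mathcal B_\delta(M)=\bigcap_{k\ge0,\ t<\delta}C^k_t(M)$. A smooth function $u$ on $M$ is polyhomogeneous if there are $s_i\in\mathbb C$ with $\operatorname{Re}s_i$ nondecreasing and tending to $+\infty$, $p_i\in\mathbb N_0$, and $\bar u_{ip}\in C^\infty(\bar M;\mathbb C)$ (smooth extensions of coefficients on $\partial M$), such that for each $k\in\mathbb N_0$ there is an $N_k\in\mathbb N_0$ with $$u-\sum_{i=0}^{N_k}\sum_{p=0}^{p_i}\rho^{s_i}(\log\rho)^p\,\bar u_{ip}\in\mathcal B_k(M).$$ Let $\mathcal B^{\rm phg}_\delta(M)$ be the set of polyhomogeneous functions in $\mathcal B_\delta(M)$. **The nonlinearity.** Let $f$ be a smooth real function on $M\times I$, where $I$ is an open interval containing $0$. Assume that for some $r>0$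 with $(-r,r)\subseteq I$ one has, on $M\times(-r,r)$, an absolutely and uniformly convergent power series $$f(x,v)=\sum_{l=0}^\infty a_l(x)v^l,\qquad a_0,a_1\in\rho\,C^\infty(\bar M),\quad a_l\in C^\infty(\bar M)\ (l\ge2).$$ **Conclusion.** Let $u\in\mathcal B^{\rm phg}_\mu(M)$ be a real function with values in $I$ such that $\mathcal Pu=f(u)$ on $M$, where $f(u)(x)=f(x,u(x))$, and suppose that $f(u)\in\mathcal B_\delta(M)$ for some $\delta>\mu$. Then $u$ extends to a function in $C^\infty(\bar M)$. -/

import Mathlib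

open Set Filter Topology MeasureTheory
open scoped Manifold ContDiff

namespace AsympHyp

noncomputable section

/-- The model space of coordinates in dimension three. -/
abbrev E3 : Type := EuclideanSpace ℝ (Fin 3)

/-- The model half-space `{y | 0 ≤ y 0}` of a three-manifold with boundary. -/
abbrev H3 : Type := EuclideanHalfSpace 3

/-- The `i`-th standard basis vector. -/
abbrev stdVec (i : Fin 3) : E3 := EuclideanSpace.single i (1 : ℝ)

section Geometry

variable {Mbar : Type*} [TopologicalSpace Mbar] [ChartedSpace H3 Mbar]

variable (Mbar) in
/-- The open manifold `M`, the interior of `Mbar`. Functions on `M` are represented by functions on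
`Mbar`; only their values at points of `IntM Mbar` are ever used. -/
abbrev IntM : Set Mbar := (𝓡∂ 3).interior Mbar

variable (Mbar) in
/-- The boundary of `Mbar`. -/
abbrev Bdry : Set Mbar := (𝓡∂ 3).boundary Mbar

variable (Mbar) in
/-- Fields of bilinear forms on the tangent spaces. -/
abbrev BilinField : Type _ :=
  ∀ x : Mbar, TangentSpace (𝓡∂ 3) x →L[ℝ] TangentSpace (𝓡∂ 3) x →L[ℝ] ℝ

/-- A smooth (boundary) defining function. -/
structure IsDefiningFunction (ρ : Mbar → ℝ) : Prop where
  smooth : ContMDiff (𝓡∂ 3) 𝓘(ℝ, ℝ) ∞ ρ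
  nonneg : ∀ x, 0 ≤ ρ x
  zero_iff : ∀ x, ρ x = 0 ↔ x ∈ Bdry Mbar
  differential_ne_zero : ∀ x ∈ Bdry Mbar, mfderiv (𝓡∂ 3) 𝓘(ℝ, ℝ) ρ x ≠ 0

/-- `g`, a metric on the interior, is `C^n` conformally compact and asymptotically hyperbolic:
`ρ² g` extends to a `C^n` Riemannian metric `gbar` on `Mbar`, and `|dρ| = 1` along the boundary
with respect to `gbar`. The vector `N` below is the `gbar`-gradient of `ρ` at `x`. -/
def IsAsymptoticallyHyperbolic [IsManifold (𝓡∂ 3) ∞ Mbar] (n : WithTop ℕ∞)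
    (ρ : Mbar → ℝ) (g : BilinField Mbar) : Prop :=
  ∃ gbar : Bundle.ContMDiffRiemannianMetric (𝓡∂ 3) n E3
      (fun x : Mbar => TangentSpace (𝓡∂ 3) x),
    (∀ x ∈ IntM Mbar, ∀ v w : TangentSpace (𝓡∂ 3) x,
      gbar.inner x v w = ρ x ^ 2 * g x v w) ∧
    ∀ x ∈ Bdry Mbar, ∃ N : TangentSpace (𝓡∂ 3) x,
      (∀ v : TangentSpace (𝓡∂ 3) x, gbar.inner x N v = mfderiv (𝓡∂ 3) 𝓘(ℝ, ℝ) ρ x v) ∧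
      gbar.inner x N N = 1

/-! ### Geometric operators of order two on functions -/

/-- The variables of the universal polynomials: the components of the metric, their first and
second partial derivatives, and `(det g)^(-1/2)`. -/
inductive JetVar : Type
  | metric (i j : Fin 3)
  | deriv (k i j : Fin 3)
  | deriv₂ (k l i j : Fin 3)
  | invSqrtDet

/-- The number of derivatives of the metric that occur in a variable. -/
def JetVar.order : JetVar → ℕ
  | .metric _ _ => 0
  | .deriv _ _ _ => 1
  | .deriv₂ _ _ _ _ => 2
  | .invSqrtDet => 0

/-- The universal polynomials that are the coefficients of a geometric operator of order two on
functions; the coefficient of a `j`-th derivative involves at most `2 - j` derivatives of the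
metric. -/
structure GeometricCoeffs where
  /-- coefficients of the second derivatives -/
  a : Fin 3 → Fin 3 → MvPolynomial JetVar ℝ
  /-- coefficients of the first derivatives -/
  b : Fin 3 → MvPolynomial JetVar ℝ
  /-- coefficient of order zero -/
  c : MvPolynomial JetVar ℝ
  order_a : ∀ i j, ∀ v ∈ (a i j).vars, v.order = 0
  order_b : ∀ i, ∀ v ∈ (b i).vars, v.order ≤ 1
  order_c : ∀ v ∈ c.vars, v.order ≤ 2

/-- Partial derivative in coordinates. -/
def partialD (k : Fin 3) (F : E3 → ℝ) (y : E3) : ℝ := fderiv ℝ F y (stdVec k)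

/-- The components `g_ij` of `g` in the chart `φ`, as functions of the coordinates. -/
def metricComp (g : BilinField Mbar) (φ : OpenPartialHomeomorph Mbar H3) (i j : Fin 3)
    (y : E3) : ℝ :=
  g ((φ.extend (𝓡∂ 3)).symm y)
    (mfderiv 𝓘(ℝ, E3) (𝓡∂ 3) (φ.extend (𝓡∂ 3)).symm y (stdVec i))
    (mfderiv 𝓘(ℝ, E3) (𝓡∂ 3) (φ.extend (𝓡∂ 3)).symm y (stdVec j))

/-- The determinant of the matrix `(g_ij)` in the chart `φ`. -/
def metricDet (g : BilinField Mbar) (φ : OpenPartialHomeomorph Mbar H3) (y : E3) : ℝ :=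
  (Matrix.of fun i j => metricComp g φ i j y).det

/-- The values of the jet variables of `g` in the chart `φ` at the coordinates `y`. -/
def jetVal (g : BilinField Mbar) (φ : OpenPartialHomeomorph Mbar H3) (y : E3) : JetVar → ℝ
  | .metric i j => metricComp g φ i j y
  | .deriv k i j => partialD k (metricComp g φ i j) y
  | .deriv₂ k l i j => partialD k (partialD l (metricComp g φ i j)) y
  | .invSqrtDet => (Real.sqrt (metricDet g φ y))⁻¹

/-- `P u` is given, with the same polynomials `Q` in every coordinate chart, by the components of
the metric and their derivatives in that chart. -/
def Represents (g : BilinField Mbar) (P : (Mbar → ℝ) → Mbar → ℝ) (Q : GeometricCoeffs) : Prop :=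
  ∀ φ ∈ IsManifold.maximalAtlas (𝓡∂ 3) ∞ Mbar, ∀ u : Mbar → ℝ,
    ContMDiffOn (𝓡∂ 3) 𝓘(ℝ, ℝ) ∞ u (IntM Mbar) → ∀ x ∈ φ.source ∩ IntM Mbar,
      P u x =
        (∑ i, ∑ j, MvPolynomial.eval (jetVal g φ (φ.extend (𝓡∂ 3) x)) (Q.a i j) *
          partialD i (partialD j (u ∘ (φ.extend (𝓡∂ 3)).symm)) (φ.extend (𝓡∂ 3) x)) +
        (∑ i, MvPolynomial.eval (jetVal g φ (φ.extend (𝓡∂ 3) x)) (Q.b i) *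
          partialD i (u ∘ (φ.extend (𝓡∂ 3)).symm) (φ.extend (𝓡∂ 3) x)) +
        MvPolynomial.eval (jetVal g φ (φ.extend (𝓡∂ 3) x)) Q.c * u x

/-- The second-order operator with coefficients `Q` is elliptic on `M`: its principal symbol does
not vanish on nonzero covectors. -/
def IsElliptic (g : BilinField Mbar) (Q : GeometricCoeffs) : Prop :=
  ∀ φ ∈ IsManifold.maximalAtlas (𝓡∂ 3) ∞ Mbar, ∀ x ∈ φ.source ∩ IntM Mbar,
    ∀ ξ : Fin 3 → ℝ, ξ ≠ 0 →
      ∑ i, ∑ j, MvPolynomial.eval (jetVal g φ (φ.extend (𝓡∂ 3) x)) (Q.a i j) * (ξ i * ξ j) ≠ 0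

/-- The integral of `F` over the domain of the chart `φ` in `M`, with respect to the Riemannian
volume `√(det g) dy` of `g`. -/
def chartIntegral (g : BilinField Mbar) (φ : OpenPartialHomeomorph Mbar H3) (F : Mbar → ℝ) : ℝ :=
  ∫ y in φ.extend (𝓡∂ 3) '' (φ.source ∩ IntM Mbar),
    F ((φ.extend (𝓡∂ 3)).symm y) * Real.sqrt (metricDet g φ y)

/-- `P` is formally self-adjoint: `∫ u (P v) dV = ∫ (P u) v dV` for smooth test functions `u`, `v`
on `M`. By a partition of unity it is enough, for a differential operator on the compact `Mbar`,
to take test functions with support in the domain of a common chart. -/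
def IsFormallySelfAdjoint (g : BilinField Mbar) (P : (Mbar → ℝ) → Mbar → ℝ) : Prop :=
  ∀ φ ∈ IsManifold.maximalAtlas (𝓡∂ 3) ∞ Mbar, ∀ u v : Mbar → ℝ,
    ContMDiff (𝓡∂ 3) 𝓘(ℝ, ℝ) ∞ u → ContMDiff (𝓡∂ 3) 𝓘(ℝ, ℝ) ∞ v →
    HasCompactSupport u → HasCompactSupport v →
    tsupport u ⊆ φ.source ∩ IntM Mbar → tsupport v ⊆ φ.source ∩ IntM Mbar →
      chartIntegral g φ (fun x => u x * P v x) = chartIntegral g φ (fun x => P u x * v x)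

/-- `P` is a formally self-adjoint elliptic geometric operator of order two on functions. -/
def IsEllipticGeometricSelfAdjoint (g : BilinField Mbar) (P : (Mbar → ℝ) → Mbar → ℝ) : Prop :=
  (∃ Q : GeometricCoeffs, Represents g P Q ∧ IsElliptic g Q) ∧ IsFormallySelfAdjoint g P

/-! ### Indicial map and characteristic exponents -/

/-- The complex-linear extension of a real operator to complex-valued functions. -/
def complexify (P : (Mbar → ℝ) → Mbar → ℝ) (w : Mbar → ℂ) (x : Mbar) : ℂ :=
  (P (fun y => (w y).re) x : ℂ) + (P (fun y => (w y).im) x : ℂ) * Complex.I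

/-- `L` is the indicial map `I_s(P)` on the fibre `ℂ` over the boundary point `q`:
`ρ^(-s) P(ρ^s w)` tends to `L (w q)` at `q`, for every `w ∈ C^∞(Mbar; ℂ)`. -/
def IsIndicialMap (ρ : Mbar → ℝ) (P : (Mbar → ℝ) → Mbar → ℝ) (s : ℂ) (q : Mbar)
    (L : ℂ →ₗ[ℂ] ℂ) : Prop :=
  ∀ w : Mbar → ℂ, ContMDiff (𝓡∂ 3) 𝓘(ℝ, ℂ) ∞ w →
    Tendsto (fun x => (ρ x : ℂ) ^ (-s) * complexify P (fun y => (ρ y : ℂ) ^ s * w y) x)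
      (𝓝[IntM Mbar] q) (𝓝 (L (w q)))

/-- The characteristic exponents: the `s` for which the indicial map has a nontrivial kernel at
some boundary point. -/
def charExponents (ρ : Mbar → ℝ) (P : (Mbar → ℝ) → Mbar → ℝ) : Set ℂ :=
  {s | ∃ q ∈ Bdry Mbar, ∃ L : ℂ →ₗ[ℂ] ℂ, IsIndicialMap ρ P s q L ∧ LinearMap.ker L ≠ ⊥}

/-- The indicial map `I_s(P)` is the product of a polynomial `p(s)` with simple integer roots and
an isomorphism of the (trivial complex line) bundle over the boundary. -/
def HasSimpleIntegerIndicialRoots (ρ : Mbar → ℝ) (P : (Mbar → ℝ) → Mbar → ℝ) : Prop :=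
  ∃ (p : Polynomial ℂ) (Φ : Mbar → (ℂ ≃ₗ[ℂ] ℂ)),
    p ≠ 0 ∧ p.roots.Nodup ∧ (∀ s ∈ p.roots, ∃ n : ℤ, s = (n : ℂ)) ∧
    ∀ q ∈ Bdry Mbar, ∀ s : ℂ,
      IsIndicialMap ρ P s q (p.eval s • (Φ q : ℂ →ₗ[ℂ] ℂ))

/-- `μ` is the largest characteristic exponent of `P`. -/
def IsLargestCharExponent (ρ : Mbar → ℝ) (P : (Mbar → ℝ) → Mbar → ℝ) (μ : ℝ) : Prop :=
  (μ : ℂ) ∈ charExponents ρ P ∧ ∀ s ∈ charExponents ρ P, s.re ≤ μ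

/-! ### Weighted spaces and polyhomogeneous functions -/

/-- The weighted space `C^k_t(M)` of functions, for `Mbar` compact: `u` is `C^k` on `M` and, in
coordinates of `Mbar` near each point, `ρ^(j-t)` times the `j`-th derivatives of `u` is bounded
for `j ≤ k`. Equivalently the covariant derivatives of `u` up to order `k`, measured by an
asymptotically hyperbolic metric, are `O(ρ^t)`. -/
def MemWeightedCk {V : Type*} [NormedAddCommGroup V] [NormedSpace ℝ V]
    (ρ : Mbar → ℝ) (k : ℕ) (t : ℝ) (u : Mbar → V) : Prop :=
  ContMDiffOn (𝓡∂ 3) 𝓘(ℝ, V) k u (IntM Mbar) ∧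
  ∀ q : Mbar, ∃ C : ℝ, ∀ᶠ x in 𝓝[IntM Mbar] q, ∀ j ≤ k,
    ‖iteratedFDeriv ℝ j (u ∘ (extChartAt (𝓡∂ 3) q).symm) (extChartAt (𝓡∂ 3) q x)‖
      ≤ C * ρ x ^ (t - j)

/-- The class `B_δ(M)`, the intersection of all `C^k_t(M)` with `k ≥ 0` and `t < δ`. -/
def MemB {V : Type*} [NormedAddCommGroup V] [NormedSpace ℝ V]
    (ρ : Mbar → ℝ) (δ : ℝ) (u : Mbar → V) : Prop :=
  ∀ k : ℕ, ∀ t : ℝ, t < δ → MemWeightedCk ρ k t u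

/-- A smooth function on `M` is polyhomogeneous if it has an asymptotic expansion
`∑ᵢ ∑_{p ≤ pᵢ} ρ^(sᵢ) (log ρ)^p wᵢₚ` whose exponents have real parts nondecreasing and diverging to
infinity. The coefficients are given by smooth functions on `Mbar` extending the coefficients on
the boundary; any smooth extension is allowed (by Taylor's formula along a collar, another choice
of extensions only adds terms with exponents `sᵢ + n`). -/
def IsPolyhomogeneous (ρ : Mbar → ℝ) (u : Mbar → ℂ) : Prop :=
  ContMDiffOn (𝓡∂ 3) 𝓘(ℝ, ℂ) ∞ u (IntM Mbar) ∧
  ∃ (s : ℕ → ℂ) (p : ℕ → ℕ) (w : ℕ → ℕ → Mbar → ℂ),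
    Monotone (fun i => (s i).re) ∧ Tendsto (fun i => (s i).re) atTop atTop ∧
    (∀ i m, ContMDiff (𝓡∂ 3) 𝓘(ℝ, ℂ) ∞ (w i m)) ∧
    ∀ k : ℕ, ∃ N : ℕ,
      MemB ρ (k : ℝ) (fun x => u x - ∑ i ∈ Finset.range (N + 1), ∑ m ∈ Finset.range (p i + 1),
        (ρ x : ℂ) ^ (s i) * (Real.log (ρ x) : ℂ) ^ m * w i m x)

/-- The class of real polyhomogeneous functions in `B_δ(M)`; the expansion may have complex
exponents and coefficients. -/
def MemBphg (ρ : Mbar → ℝ) (δ : ℝ) (u : Mbar → ℝ) : Prop :=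
  IsPolyhomogeneous ρ (fun x => (u x : ℂ)) ∧ MemB ρ δ u

/-! ### The nonlinearity -/

/-- `f` is a smooth real function on `M × I`, with `I` an open interval containing `0`, and for
values of the second argument near zero it is the sum of an absolutely and uniformly convergent
power series with coefficients `a₀, a₁ ∈ ρ C^∞(Mbar)` and `a_l ∈ C^∞(Mbar)` for `l ≥ 2`. -/
def IsAdmissibleNonlinearity (ρ : Mbar → ℝ) (I : Set ℝ) (f : Mbar → ℝ → ℝ) : Prop :=
  IsOpen I ∧ I.OrdConnected ∧ (0 : ℝ) ∈ I ∧
  ContMDiffOn ((𝓡∂ 3).prod 𝓘(ℝ, ℝ)) 𝓘(ℝ, ℝ) ∞ (fun z : Mbar × ℝ => f z.1 z.2) (IntM Mbar ×ˢ I) ∧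
  ∃ a : ℕ → Mbar → ℝ,
    (∀ l, ContMDiff (𝓡∂ 3) 𝓘(ℝ, ℝ) ∞ (a l)) ∧
    (∀ l < 2, ∃ b : Mbar → ℝ, ContMDiff (𝓡∂ 3) 𝓘(ℝ, ℝ) ∞ b ∧ ∀ x, a l x = ρ x * b x) ∧
    ∃ r > 0, Ioo (-r) r ⊆ I ∧
      (∀ x ∈ IntM Mbar, ∀ v ∈ Ioo (-r) r, Summable fun l => |a l x * v ^ l|) ∧
      TendstoUniformlyOn
        (fun (n : ℕ) (z : Mbar × ℝ) => ∑ l ∈ Finset.range n, a l z.1 * z.2 ^ l)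
        (fun z => f z.1 z.2) atTop (IntM Mbar ×ˢ Ioo (-r) r)

end Geometry

end

end AsympHyp

/-! The argument is local at a boundary point, in a chart with normal coordinate `y₀`. The universal
polynomials are evaluated, point by point, in the chart dilated by the factor `1/ρ` at that point.
This turns the operator into `∑ Aᵢⱼ ρ² ∂ᵢ∂ⱼ + ∑ Bᵢ ρ ∂ᵢ + C` with coefficients smooth up to the
boundary (`Represents.eq_degOp`). The volume density is `ρ⁻³` times a smooth positive function, and
formal self-adjointness then forces `Bᵢ = -∑ Aᵢⱼ ∂ⱼρ` on the boundary, once `A` is symmetrized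
(`exists_chartCoeffs`). So the indicial polynomial is a multiple of `s (s - 2)` plus a constant. Its
roots are `μ` and `2 - μ`; being simple integers, they leave only integers `μ ≥ 2`
(`exists_exponent`). Up to terms whose coefficients vanish at the boundary, the operator is a
nonvanishing multiple of `(y₀∂₀ - μ)(y₀∂₀ + μ - 2)` (`AdaptedCoeffs.remainder`).

Polyhomogeneity serves to show that tangential derivatives of `u` cost no decay. The expansion makes
`u` conormal of some weight, and interpolation between its decay and its derivatives raises this
weight to `μ` (`Conormal.of_bo`, `MemBphg.conormal`).

Smoothness is then obtained by counting normal derivatives (`AdaptedCoeffs.smoothGerm`). Suppose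
that `u` has `k` good ones. Then the right side `r` of the model equation has `k + 1`: the remainder
and the term `a₁ u` gain one because their coefficients vanish at the boundary
(`NormalReg.vanishing_mul`), and the powers `uˡ`, `l ≥ 2`, gain one because `u` itself vanishes
there (`NormalReg.mul_gain`). Put `v = (y₀∂₀ + μ - 2) u`, so that `(y₀∂₀ - μ) v = r`. Applying
`∂₀^μ` removes the term of order zero and leaves `y₀ ∂₀^(μ+1) v = ∂₀^μ r`. This is the resonance at
which a logarithm could enter. It does not, since `f(u) = O(ρ^t)` for every `t < δ` and `δ > μ`, so
that `∂₀^μ r` vanishes at the boundary and may be divided by `y₀`. The other factor is solved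
without loss, and `u` has gained a normal derivative (`NormalReg.model_step`).

At the end all derivatives of `u` are `O(y₀^(-ε))`. Integration in the normal direction makes them
bounded, and `u` extends smoothly (`SmoothGerm.contDiffWithinAt_extendFrom`,
`contMDiff_extendFrom`). -/

namespace AsympHyp

noncomputable section

set_option linter.unusedSectionVars false

/-! ### Calculus of conormal and smooth germs at a boundary point of the half-space. -/

section Germs

variable {V : Type*} [NormedAddCommGroup V] [NormedSpace ℝ V]
  {W : Type*} [NormedAddCommGroup W] [NormedSpace ℝ W]
  {A : Type*} [NormedCommRing A] [NormedAlgebra ℝ A]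

/-- The open half-space. -/
def openHalf : Set E3 := {y | 0 < y 0}

lemma isOpen_openHalf : IsOpen openHalf :=
  isOpen_lt continuous_const (by fun_prop)

/-- The filter of neighbourhoods of `z` in the open half-space. -/
def L (z : E3) : Filter E3 := 𝓝[openHalf] z

/-- Partial derivatives of vector-valued functions. -/
def pd (i : Fin 3) (F : E3 → V) (y : E3) : V := fderiv ℝ F y (stdVec i)

lemma partialD_eq_pd (i : Fin 3) (F : E3 → ℝ) : partialD i F = pd i F := rfl

/-- The loss of weight by a partial derivative. -/
def wt (i : Fin 3) : ℝ := if i = 0 then 1 else 0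

@[simp] lemma wt_zero : wt 0 = 1 := rfl
lemma wt_of_ne {i : Fin 3} (h : i ≠ 0) : wt i = 0 := if_neg h
lemma wt_nonneg (i : Fin 3) : 0 ≤ wt i := by unfold wt; split_ifs <;> norm_num

/-- Smoothness in the open half-space near `z`. -/
def SmoothNear (z : E3) (F : E3 → V) : Prop := ∀ᶠ y in L z, ContDiffAt ℝ ∞ F y

/-- `F = O(y₀ ^ s)` near `z` for all `s < t`. -/
def BO (z : E3) (t : ℝ) (F : E3 → V) : Prop :=
  ∀ s < t, ∃ C : ℝ, ∀ᶠ y in L z, ‖F y‖ ≤ C * y 0 ^ s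

/-- Conormal of weight `t`, up to order `n`. -/
def Con (z : E3) : ℕ → ℝ → (E3 → V) → Prop
  | 0, t, F => SmoothNear z F ∧ BO z t F
  | n + 1, t, F => (SmoothNear z F ∧ BO z t F) ∧ ∀ i, Con z n (t - wt i) (pd i F)

/-- Conormal functions of weight `t`. -/
def Conormal (z : E3) (t : ℝ) (F : E3 → V) : Prop := ∀ n, Con z n t F

/-- Functions whose normal derivatives up to order `k` are conormal of weight zero. -/
def NormalReg (z : E3) : ℕ → (E3 → V) → Prop
  | 0, F => Conormal z 0 F
  | k + 1, F => Conormal z 0 F ∧ NormalReg z k (pd 0 F)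

/-- Functions all whose derivatives are `O(y₀ ^ (-ε))`. -/
def SmoothGerm (z : E3) (F : E3 → V) : Prop := ∀ k, NormalReg z k F

variable {z : E3} {t t' : ℝ} {n k : ℕ} {F G : E3 → V}

lemma eventually_pos : ∀ᶠ y in L z, 0 < y 0 := eventually_mem_nhdsWithin

lemma eventually_lt_of_zero (hz : z 0 = 0) {ε : ℝ} (hε : 0 < ε) : ∀ᶠ y in L z, y 0 < ε := by
  have : Tendsto (fun y : E3 => y 0) (𝓝 z) (𝓝 (z 0)) := Continuous.tendsto (by fun_prop) z
  exact nhdsWithin_le_nhds (this.eventually (gt_mem_nhds (by rw [hz]; exact hε)))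

/-- The half-space is open, so near each of its points a germ identity holds in a full neighbourhood
and may be differentiated. -/
lemma eventually_nhds_of_L {p : E3 → Prop} (h : ∀ᶠ y in L z, p y) :
    ∀ᶠ y in L z, ∀ᶠ x in 𝓝 y, p x := by
  have h' := eventually_eventually_nhdsWithin.2 h
  filter_upwards [h', eventually_pos] with y hy hy0
  rwa [isOpen_openHalf.nhdsWithin_eq hy0] at hy

lemma pd_congr {i : Fin 3} (h : F =ᶠ[L z] G) : pd i F =ᶠ[L z] pd i G := by
  filter_upwards [eventually_nhds_of_L h] with y hy
  simp only [pd, Filter.EventuallyEq.fderiv_eq hy]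

lemma SmoothNear.congr (hF : SmoothNear z F) (h : F =ᶠ[L z] G) : SmoothNear z G := by
  filter_upwards [eventually_nhds_of_L h, hF] with y hy h1
  exact h1.congr_of_eventuallyEq (EventuallyEq.symm hy)

lemma BO.congr (hF : BO z t F) (h : F =ᶠ[L z] G) : BO z t G := by
  intro s hs
  obtain ⟨C, hC⟩ := hF s hs
  refine ⟨C, ?_⟩
  filter_upwards [h, hC] with y hy h1
  rwa [← hy]

lemma Con.congr (hF : Con z n t F) (h : F =ᶠ[L z] G) : Con z n t G := by
  induction n generalizing t F G with
  | zero => exact ⟨hF.1.congr h, hF.2.congr h⟩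
  | succ n ih => exact ⟨⟨hF.1.1.congr h, hF.1.2.congr h⟩, fun i => ih (hF.2 i) (pd_congr h)⟩

lemma Conormal.congr (hF : Conormal z t F) (h : F =ᶠ[L z] G) : Conormal z t G :=
  fun n => (hF n).congr h

lemma NormalReg.congr (hF : NormalReg z k F) (h : F =ᶠ[L z] G) : NormalReg z k G := by
  induction k generalizing F G with
  | zero => exact Conormal.congr hF h
  | succ k ih => exact ⟨hF.1.congr h, ih hF.2 (pd_congr h)⟩

lemma SmoothGerm.congr (hF : SmoothGerm z F) (h : F =ᶠ[L z] G) : SmoothGerm z G :=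
  fun k => (hF k).congr h

lemma Con.smooth (h : Con z n t F) : SmoothNear z F := by cases n; exacts [h.1, h.1.1]
lemma Con.bo (h : Con z n t F) : BO z t F := by cases n; exacts [h.2, h.1.2]
lemma Conormal.smooth (h : Conormal z t F) : SmoothNear z F := (h 0).smooth
lemma Conormal.bo (h : Conormal z t F) : BO z t F := (h 0).bo
lemma Conormal.pderiv (h : Conormal z t F) (i : Fin 3) : Conormal z (t - wt i) (pd i F) :=
  fun n => (h (n + 1)).2 i
lemma Conormal.pd_zero (h : Conormal z t F) : Conormal z (t - 1) (pd 0 F) := h.pderiv 0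
lemma Conormal.pd_ne (h : Conormal z t F) {i : Fin 3} (hi : i ≠ 0) :
    Conormal z t (pd i F) := by simpa [wt_of_ne hi] using h.pderiv i

lemma NormalReg.conormal (h : NormalReg z k F) : Conormal z 0 F := by
  cases k; exacts [h, h.1]
lemma NormalReg.pred (h : NormalReg z (k + 1) F) : NormalReg z k F := by
  induction k generalizing F with
  | zero => exact h.1
  | succ k ih => exact ⟨h.1, ih h.2⟩
lemma NormalReg.mono {m : ℕ} (h : NormalReg z k F) (hm : m ≤ k) : NormalReg z m F := by
  induction hm with
  | refl => exact h
  | step _ ih => exact ih h.pred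
lemma SmoothGerm.conormal (h : SmoothGerm z F) : Conormal z 0 F := h 0
lemma SmoothGerm.pd_zero (h : SmoothGerm z F) : SmoothGerm z (pd 0 F) := fun k => (h (k + 1)).2

lemma BO.mono (h : BO z t F) (ht : t' ≤ t) : BO z t' F := fun s hs => h s (hs.trans_le ht)
lemma Con.mono (h : Con z n t F) (ht : t' ≤ t) : Con z n t' F := by
  induction n generalizing t t' F with
  | zero => exact ⟨h.1, h.2.mono ht⟩
  | succ n ih => exact ⟨⟨h.1.1, h.1.2.mono ht⟩, fun i => ih (h.2 i) (by linarith)⟩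
lemma Conormal.mono (h : Conormal z t F) (ht : t' ≤ t) : Conormal z t' F :=
  fun n => (h n).mono ht

lemma Con.pred (h : Con z (n + 1) t F) : Con z n t F := by
  induction n generalizing t F with
  | zero => exact h.1
  | succ n ih => exact ⟨h.1, fun i => ih (h.2 i)⟩

lemma SmoothNear.pderiv (h : SmoothNear z F) (i : Fin 3) : SmoothNear z (pd i F) := by
  filter_upwards [h] with y hy
  exact (hy.fderiv_right (m := ∞) (by simp)).clm_apply contDiffAt_const

lemma SmoothNear.differentiable (h : SmoothNear z F) : ∀ᶠ y in L z, DifferentiableAt ℝ F y :=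
  h.mono fun _ hy => hy.differentiableAt (by simp)

lemma pd_comm_at {y : E3} (hy : ContDiffAt ℝ ∞ F y) (i j : Fin 3) :
    pd i (pd j F) y = pd j (pd i F) y := by
  have h1 : DifferentiableAt ℝ (fderiv ℝ F) y :=
    (hy.fderiv_right (m := 1) (by norm_cast)).differentiableAt (by simp)
  have key : ∀ a b : Fin 3, pd a (pd b F) y
      = fderiv ℝ (fderiv ℝ F) y (stdVec a) (stdVec b) := by
    intro a b
    change fderiv ℝ (fun x => fderiv ℝ F x (stdVec b)) y (stdVec a) = _
    rw [fderiv_clm_apply h1 (differentiableAt_const _)]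
    simp
  rw [key, key]
  refine hy.isSymmSndFDerivAt ?_ _ _
  simp only [minSmoothness_of_isRCLikeNormedField]
  exact WithTop.coe_le_coe.2 le_top

lemma pd_comm (h : SmoothNear z F) (i j : Fin 3) : pd i (pd j F) =ᶠ[L z] pd j (pd i F) :=
  h.mono fun _ hy => pd_comm_at hy i j

/-! ### Sums -/

lemma pd_add (hF : SmoothNear z F) (hG : SmoothNear z G) (i : Fin 3) :
    pd i F + pd i G =ᶠ[L z] pd i (F + G) := by
  filter_upwards [hF.differentiable, hG.differentiable] with y h1 h2
  simp [pd, fderiv_add h1 h2]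

lemma SmoothNear.add (hF : SmoothNear z F) (hG : SmoothNear z G) : SmoothNear z (F + G) := by
  filter_upwards [hF, hG] with y h1 h2 using h1.add h2

lemma BO.add (hF : BO z t F) (hG : BO z t G) : BO z t (F + G) := by
  intro s hs
  obtain ⟨C, hC⟩ := hF s hs
  obtain ⟨C', hC'⟩ := hG s hs
  refine ⟨C + C', ?_⟩
  filter_upwards [hC, hC'] with y h1 h2
  rw [add_mul]
  exact (norm_add_le _ _).trans (add_le_add h1 h2)

lemma Con.add (hF : Con z n t F) (hG : Con z n t G) : Con z n t (F + G) := by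
  induction n generalizing t F G with
  | zero => exact ⟨hF.1.add hG.1, hF.2.add hG.2⟩
  | succ n ih => exact ⟨⟨hF.1.1.add hG.1.1, hF.1.2.add hG.1.2⟩,
      fun i => (ih (hF.2 i) (hG.2 i)).congr (pd_add hF.1.1 hG.1.1 i)⟩

lemma Conormal.add (hF : Conormal z t F) (hG : Conormal z t G) : Conormal z t (F + G) :=
  fun n => (hF n).add (hG n)

lemma NormalReg.add (hF : NormalReg z k F) (hG : NormalReg z k G) : NormalReg z k (F + G) := by
  induction k generalizing F G with
  | zero => exact Conormal.add hF hG
  | succ k ih => exact ⟨hF.1.add hG.1,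
      (ih hF.2 hG.2).congr (pd_add hF.1.smooth hG.1.smooth 0)⟩

lemma SmoothGerm.add (hF : SmoothGerm z F) (hG : SmoothGerm z G) : SmoothGerm z (F + G) :=
  fun k => (hF k).add (hG k)

/-! ### Linear maps -/

lemma pd_clm (T : V →L[ℝ] W) (hF : SmoothNear z F) (i : Fin 3) :
    (fun y => T (pd i F y)) =ᶠ[L z] pd i (fun y => T (F y)) := by
  filter_upwards [hF.differentiable] with y h1
  have := (T.hasFDerivAt.comp y h1.hasFDerivAt).fderiv
  simp only [pd]
  erw [this]
  simp

lemma SmoothNear.clm (T : V →L[ℝ] W) (hF : SmoothNear z F) : SmoothNear z (fun y => T (F y)) := by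
  filter_upwards [hF] with y h1 using T.contDiff.contDiffAt.comp y h1

lemma BO.clm (T : V →L[ℝ] W) (hF : BO z t F) : BO z t (fun y => T (F y)) := by
  intro s hs
  obtain ⟨C, hC⟩ := hF s hs
  refine ⟨‖T‖ * C, ?_⟩
  filter_upwards [hC] with y h1
  rw [mul_assoc]
  exact (T.le_opNorm _).trans (by gcongr)

lemma Con.clm (T : V →L[ℝ] W) (hF : Con z n t F) : Con z n t (fun y => T (F y)) := by
  induction n generalizing t F with
  | zero => exact ⟨hF.1.clm T, hF.2.clm T⟩
  | succ n ih => exact ⟨⟨hF.1.1.clm T, hF.1.2.clm T⟩,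
      fun i => (ih (hF.2 i)).congr (pd_clm T hF.1.1 i)⟩

lemma Conormal.clm (T : V →L[ℝ] W) (hF : Conormal z t F) : Conormal z t (fun y => T (F y)) :=
  fun n => (hF n).clm T

lemma NormalReg.clm (T : V →L[ℝ] W) (hF : NormalReg z k F) : NormalReg z k (fun y => T (F y)) := by
  induction k generalizing F with
  | zero => exact Conormal.clm T hF
  | succ k ih => exact ⟨hF.1.clm T, (ih hF.2).congr (pd_clm T hF.1.smooth 0)⟩

lemma SmoothGerm.clm (T : V →L[ℝ] W) (hF : SmoothGerm z F) : SmoothGerm z (fun y => T (F y)) :=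
  fun k => (hF k).clm T

lemma Conormal.const_smul (c : ℝ) (hF : Conormal z t F) : Conormal z t (c • F) :=
  hF.clm (c • ContinuousLinearMap.id ℝ V)
lemma NormalReg.const_smul (c : ℝ) (hF : NormalReg z k F) : NormalReg z k (c • F) :=
  hF.clm (c • ContinuousLinearMap.id ℝ V)
lemma SmoothGerm.const_smul (c : ℝ) (hF : SmoothGerm z F) : SmoothGerm z (c • F) :=
  hF.clm (c • ContinuousLinearMap.id ℝ V)
lemma BO.const_smul (c : ℝ) (hF : BO z t F) : BO z t (c • F) :=
  hF.clm (c • ContinuousLinearMap.id ℝ V)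
lemma Conormal.neg (hF : Conormal z t F) : Conormal z t (-F) :=
  hF.clm (-ContinuousLinearMap.id ℝ V)
lemma NormalReg.neg (hF : NormalReg z k F) : NormalReg z k (-F) :=
  hF.clm (-ContinuousLinearMap.id ℝ V)
lemma BO.neg (hF : BO z t F) : BO z t (-F) :=
  hF.clm (-ContinuousLinearMap.id ℝ V)
lemma Conormal.sub (hF : Conormal z t F) (hG : Conormal z t G) : Conormal z t (F - G) := by
  rw [sub_eq_add_neg]; exact hF.add hG.neg
lemma NormalReg.sub (hF : NormalReg z k F) (hG : NormalReg z k G) : NormalReg z k (F - G) := by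
  rw [sub_eq_add_neg]; exact hF.add hG.neg
lemma SmoothGerm.sub (hF : SmoothGerm z F) (hG : SmoothGerm z G) : SmoothGerm z (F - G) :=
  fun k => (hF k).sub (hG k)
lemma BO.sub (hF : BO z t F) (hG : BO z t G) : BO z t (F - G) := by
  rw [sub_eq_add_neg]; exact hF.add hG.neg

/-! ### Elementary functions -/

lemma BO.of_bounded (hz : z 0 = 0) {C : ℝ} (h : ∀ᶠ y in L z, ‖F y‖ ≤ C) : BO z 0 F := by
  intro s hs
  refine ⟨C, ?_⟩
  filter_upwards [h, eventually_pos, eventually_lt_of_zero hz one_pos] with y h1 h2 h3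
  have h4 : 1 ≤ y 0 ^ s := Real.one_le_rpow_of_pos_of_le_one_of_nonpos h2 h3.le hs.le
  have : 0 ≤ C := (norm_nonneg _).trans h1
  nlinarith

lemma Con.zero : Con z n t (0 : E3 → V) := by
  have h0 : SmoothNear z (0 : E3 → V) := Eventually.of_forall fun _ => contDiffAt_const
  have h1 : ∀ t, BO z t (0 : E3 → V) := fun t s _ => ⟨0, Eventually.of_forall fun _ => by simp⟩
  induction n generalizing t with
  | zero => exact ⟨h0, h1 t⟩
  | succ n ih =>
    refine ⟨⟨h0, h1 t⟩, fun i => ih.congr (Eventually.of_forall fun y => ?_)⟩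
    simp [pd]

lemma Conormal.zero : Conormal z t (0 : E3 → V) := fun _ => Con.zero

lemma pd_const (c : V) (i : Fin 3) : pd i (fun _ => c) = 0 := by ext y; simp [pd]

lemma Conormal.const (hz : z 0 = 0) (c : V) : Conormal z 0 (fun _ => c) := by
  have h0 : SmoothNear z (fun _ => c) := Eventually.of_forall fun _ => contDiffAt_const
  have h1 : BO z 0 (fun _ => c) := BO.of_bounded hz (C := ‖c‖) (Eventually.of_forall fun _ => le_rfl)
  rintro (_ | n)
  · exact ⟨h0, h1⟩
  · exact ⟨⟨h0, h1⟩, fun i => by rw [pd_const]; exact Con.zero⟩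

lemma NormalReg.zero : NormalReg z k (0 : E3 → V) := by
  induction k with
  | zero => exact Conormal.zero
  | succ k ih => exact ⟨Conormal.zero, ih.congr (Eventually.of_forall fun y => by simp [pd])⟩

lemma SmoothGerm.const (hz : z 0 = 0) (c : V) : SmoothGerm z (fun _ => c) := by
  rintro (_ | k)
  · exact Conormal.const hz c
  · exact ⟨Conormal.const hz c, by rw [pd_const]; exact NormalReg.zero⟩

/-! ### Products -/

variable {f g : E3 → A}

lemma pd_mul (hF : SmoothNear z f) (hG : SmoothNear z g) (i : Fin 3) :
    pd i f * g + f * pd i g =ᶠ[L z] pd i (f * g) := by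
  filter_upwards [hF.differentiable, hG.differentiable] with y h1 h2
  simp only [pd, fderiv_mul h1 h2, Pi.add_apply, Pi.mul_apply, add_apply,
    smul_apply, smul_eq_mul]
  ring

lemma SmoothNear.mul (hF : SmoothNear z f) (hG : SmoothNear z g) : SmoothNear z (f * g) := by
  filter_upwards [hF, hG] with y h1 h2 using h1.mul h2

lemma BO.mul (hF : BO z t f) (hG : BO z t' g) : BO z (t + t') (f * g) := by
  intro s hs
  -- The slack `t + t' - s` is shared equally between the two factors.
  obtain ⟨C, hC⟩ := hF (t - (t + t' - s) / 2) (by linarith)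
  obtain ⟨C', hC'⟩ := hG (t' - (t + t' - s) / 2) (by linarith)
  refine ⟨C * C', ?_⟩
  filter_upwards [hC, hC', eventually_pos] with y h1 h2 h3
  have : y 0 ^ s = y 0 ^ (t - (t + t' - s) / 2) * y 0 ^ (t' - (t + t' - s) / 2) := by
    rw [← Real.rpow_add h3]; ring_nf
  rw [this]
  calc ‖(f * g) y‖ ≤ ‖f y‖ * ‖g y‖ := norm_mul_le _ _
    _ ≤ (C * y 0 ^ (t - (t + t' - s) / 2)) * (C' * y 0 ^ (t' - (t + t' - s) / 2)) :=
        mul_le_mul h1 h2 (norm_nonneg _) ((norm_nonneg _).trans h1)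
    _ = _ := by ring

lemma Con.mul (hF : Con z n t f) (hG : Con z n t' g) : Con z n (t + t') (f * g) := by
  induction n generalizing t t' f g with
  | zero => exact ⟨hF.1.mul hG.1, hF.2.mul hG.2⟩
  | succ n ih =>
    refine ⟨⟨hF.1.1.mul hG.1.1, hF.1.2.mul hG.1.2⟩, fun i => ?_⟩
    refine Con.congr (Con.add ?_ ?_) (pd_mul hF.1.1 hG.1.1 i)
    · exact (ih (hF.2 i) hG.pred).mono (by linarith)
    · exact (ih hF.pred (hG.2 i)).mono (by linarith)

lemma Conormal.mul (hF : Conormal z t f) (hG : Conormal z t' g) : Conormal z (t + t') (f * g) :=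
  fun n => (hF n).mul (hG n)

lemma NormalReg.mul (hF : NormalReg z k f) (hG : NormalReg z k g) : NormalReg z k (f * g) := by
  induction k generalizing f g with
  | zero => exact (Conormal.mul hF hG).mono (by simp)
  | succ k ih =>
    refine ⟨by simpa using Conormal.mul hF.1 hG.1, ?_⟩
    exact ((ih hF.2 hG.pred).add (ih hF.pred hG.2)).congr (pd_mul hF.1.smooth hG.1.smooth 0)

lemma SmoothGerm.mul (hF : SmoothGerm z f) (hG : SmoothGerm z g) : SmoothGerm z (f * g) :=
  fun k => (hF k).mul (hG k)

lemma SmoothGerm.pow [NormOneClass A] (hz : z 0 = 0) (hF : SmoothGerm z f) (m : ℕ) :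
    SmoothGerm z (f ^ m) := by
  induction m with
  | zero => exact (SmoothGerm.const hz (1 : A)).congr (Eventually.of_forall fun _ => by simp)
  | succ m ih => rw [pow_succ]; exact ih.mul hF

/-! ### Logarithmic derivatives, inverses and square roots -/

/-- A function whose logarithmic derivatives are conormal inherits every order of regularity from
its size alone, by induction through the equation. This covers complex powers of `ρ`; the analogue
for smooth germs covers square roots. -/
lemma Con.of_pd_eq_mul {h : Fin 3 → E3 → A} (hs : SmoothNear z f) (hb : BO z t f)
    (hh : ∀ i, Conormal z (-wt i) (h i)) (he : ∀ i, pd i f =ᶠ[L z] h i * f) : Con z n t f := by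
  induction n with
  | zero => exact ⟨hs, hb⟩
  | succ n ih =>
    refine ⟨⟨hs, hb⟩, fun i => Con.congr ?_ (he i).symm⟩
    exact ((hh i n).mul ih).mono (by linarith)

lemma Conormal.of_pd_eq_mul {h : Fin 3 → E3 → A} (hs : SmoothNear z f) (hb : BO z t f)
    (hh : ∀ i, Conormal z (-wt i) (h i)) (he : ∀ i, pd i f =ᶠ[L z] h i * f) : Conormal z t f :=
  fun _ => Con.of_pd_eq_mul hs hb hh he

lemma SmoothGerm.of_pd_eq_mul {h : Fin 3 → E3 → A} (hs : SmoothNear z f) (hb : BO z 0 f)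
    (hh : ∀ i, Conormal z (-wt i) (h i)) (h0 : SmoothGerm z (h 0))
    (he : ∀ i, pd i f =ᶠ[L z] h i * f) : SmoothGerm z f := by
  have hc := Conormal.of_pd_eq_mul hs hb hh he
  intro k
  induction k with
  | zero => exact hc
  | succ k ih => exact ⟨hc, ((h0 k).mul ih).congr (he 0).symm⟩

lemma BO.of_le {F : E3 → V} {G : E3 → W} (hG : BO z t G) (h : ∀ᶠ y in L z, ‖F y‖ ≤ ‖G y‖) :
    BO z t F := by
  intro s hs
  obtain ⟨C, hC⟩ := hG s hs
  exact ⟨C, by filter_upwards [h, hC] with y h1 h2 using h1.trans h2⟩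

lemma Conormal.pd_weight {F : E3 → V} (h : Conormal z 0 F) (i : Fin 3) :
    Conormal z (-wt i) (pd i F) := by simpa using h.pderiv i

variable {φ : E3 → ℝ}

lemma pd_inv (hs : SmoothNear z φ) (h0 : ∀ᶠ y in L z, φ y ≠ 0) (i : Fin 3) :
    -(pd i φ * (φ⁻¹ * φ⁻¹)) =ᶠ[L z] pd i φ⁻¹ := by
  filter_upwards [hs.differentiable, h0] with y h1 h2
  have := ((hasFDerivAt_inv h2).comp y h1.hasFDerivAt).fderiv
  simp only [pd, Pi.neg_apply, Pi.mul_apply, Pi.inv_apply]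
  erw [this]
  simp only [ContinuousLinearMap.comp_apply, ContinuousLinearMap.toSpanSingleton_apply, smul_eq_mul]
  field_simp

lemma SmoothNear.inv (hs : SmoothNear z φ) (h0 : ∀ᶠ y in L z, φ y ≠ 0) : SmoothNear z φ⁻¹ := by
  filter_upwards [hs, h0] with y h1 h2 using h1.inv h2

lemma Conormal.inv (hz : z 0 = 0) (hs : Conormal z 0 φ) {c : ℝ} (hc : 0 < c)
    (h : ∀ᶠ y in L z, c ≤ |φ y|) : Conormal z 0 φ⁻¹ := by
  have h0 : ∀ᶠ y in L z, φ y ≠ 0 := by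
    filter_upwards [h] with y hy h'
    rw [h', abs_zero] at hy; linarith
  have hb : BO z 0 φ⁻¹ := by
    refine BO.of_bounded hz (C := c⁻¹) ?_
    filter_upwards [h] with y hy
    rw [Pi.inv_apply, norm_inv, Real.norm_eq_abs]
    exact inv_anti₀ hc hy
  intro n
  induction n with
  | zero => exact ⟨hs.smooth.inv h0, hb⟩
  | succ n ih =>
    refine ⟨⟨hs.smooth.inv h0, hb⟩, fun i => Con.congr ?_ (pd_inv hs.smooth h0 i)⟩
    have := (((hs.pderiv i n).mul (ih.mul ih)).clm (-ContinuousLinearMap.id ℝ ℝ))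
    exact (this.mono (by linarith)).congr (Eventually.of_forall fun y => by simp)

lemma SmoothGerm.inv (hz : z 0 = 0) (hs : SmoothGerm z φ) {c : ℝ} (hc : 0 < c)
    (h : ∀ᶠ y in L z, c ≤ |φ y|) : SmoothGerm z φ⁻¹ := by
  have h0 : ∀ᶠ y in L z, φ y ≠ 0 := by
    filter_upwards [h] with y hy h'
    rw [h', abs_zero] at hy; linarith
  have hcn := hs.conormal.inv hz hc h
  intro k
  induction k with
  | zero => exact hcn
  | succ k ih => exact ⟨hcn, (((hs.pd_zero k).mul (ih.mul ih)).neg).congr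
      (pd_inv hs.conormal.smooth h0 0)⟩

lemma SmoothGerm.sqrt (hz : z 0 = 0) (hs : SmoothGerm z φ) {c : ℝ} (hc : 0 < c)
    (h : ∀ᶠ y in L z, c ≤ φ y) : SmoothGerm z (fun y => √(φ y)) := by
  have h' : ∀ᶠ y in L z, c ≤ |φ y| := h.mono fun y hy => hy.trans (le_abs_self _)
  have hi := hs.inv hz hc h'
  -- The logarithmic derivative of `√φ` is `φ' / (2 φ)`; the size of the root is controlled by `√φ ≤
  -- 1 + φ`.
  refine SmoothGerm.of_pd_eq_mul (h := fun i => ((1 / 2 : ℝ) • φ⁻¹) * pd i φ) ?_ ?_ ?_ ?_ ?_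
  · filter_upwards [hs.conormal.smooth, h] with y h1 h2 using h1.sqrt (by linarith)
  · refine ((Conormal.const hz (1 : ℝ)).bo.add hs.conormal.bo).of_le ?_
    filter_upwards [h] with y hy
    have h1 : 0 ≤ φ y := by linarith
    simp only [Real.norm_eq_abs, Pi.add_apply]
    rw [abs_of_nonneg (Real.sqrt_nonneg _), abs_of_nonneg (by linarith)]
    rw [Real.sqrt_le_left (by linarith)]
    nlinarith
  · intro i
    simpa using (hi.conormal.const_smul (1 / 2)).mul (hs.conormal.pd_weight i)
  · exact (hi.const_smul _).mul hs.pd_zero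
  · intro i
    filter_upwards [hs.conormal.smooth.differentiable, h] with y h1 h2
    have hp : 0 < φ y := by linarith
    have := (h1.hasFDerivAt.sqrt hp.ne').fderiv
    simp only [pd, Pi.mul_apply, Pi.smul_apply, Pi.inv_apply, smul_eq_mul]
    rw [this]
    simp only [smul_apply, smul_eq_mul]
    have h3 := Real.sq_sqrt hp.le
    have h4 := Real.sqrt_pos.2 hp
    rw [← h3]
    simp only [Real.sqrt_sq h4.le]
    field_simp

/-! ### The normal coordinate and the radial derivative -/

lemma fderiv_coord (y : E3) (j : Fin 3) :
    HasFDerivAt (fun y : E3 => y j) (EuclideanSpace.proj j : E3 →L[ℝ] ℝ) y :=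
  (EuclideanSpace.proj j : E3 →L[ℝ] ℝ).hasFDerivAt

lemma pd_coord (i : Fin 3) : pd i (fun y : E3 => y 0) = fun _ => wt i := by
  ext y
  simp only [pd, (fderiv_coord y 0).fderiv, wt]
  simp [stdVec, eq_comm]

lemma smoothNear_coord : SmoothNear z (fun y : E3 => y 0) :=
  Eventually.of_forall fun _ => (EuclideanSpace.proj 0 : E3 →L[ℝ] ℝ).contDiff.contDiffAt

lemma Conormal.rpow_coord (hz : z 0 = 0) (a : ℝ) : Conormal z a (fun y => y 0 ^ a) := by
  have hb : ∀ a, BO z a (fun y => y 0 ^ a) := by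
    intro a s hs
    refine ⟨1, ?_⟩
    filter_upwards [eventually_pos, eventually_lt_of_zero hz one_pos] with y h2 h3
    rw [Real.norm_eq_abs, abs_of_pos (Real.rpow_pos_of_pos h2 _), one_mul]
    exact Real.rpow_le_rpow_of_exponent_ge h2 h3.le hs.le
  have hsm : ∀ a : ℝ, SmoothNear z (fun y => y 0 ^ a) := by
    intro a
    filter_upwards [eventually_pos] with y hy
    exact ContDiffAt.rpow_const_of_ne (f := fun y : E3 => y 0)
      (EuclideanSpace.proj 0 : E3 →L[ℝ] ℝ).contDiff.contDiffAt hy.ne'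
  intro n
  induction n generalizing a with
  | zero => exact ⟨hsm a, hb a⟩
  | succ n ih =>
    refine ⟨⟨hsm a, hb a⟩, fun i => ?_⟩
    -- The derivative of `y₀^a` is this constant times `y₀^(a-1)`. In tangential directions the
    -- constant is zero and may be given the extra weight one.
    have hc : Con z n (1 - wt i) (fun _ : E3 => wt i * a) := by
      by_cases hi : i = 0
      · subst hi; simpa using Conormal.const hz (wt 0 * a) n
      · rw [wt_of_ne hi, zero_mul]; exact Con.zero
    refine Con.congr ((hc.mul (ih (a - 1))).mono (by linarith)) ?_
    filter_upwards [eventually_pos] with y hy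
    have := ((fderiv_coord y 0).rpow_const (p := a) (Or.inl hy.ne')).fderiv
    simp only [pd, Pi.mul_apply]
    rw [this]
    have h2 := congrFun (pd_coord i) y
    simp only [pd, (fderiv_coord y 0).fderiv] at h2
    simp only [smul_apply, smul_eq_mul, h2]
    ring

lemma Conormal.coord (hz : z 0 = 0) : Conormal z 1 (fun y => y 0) := by
  simpa using Conormal.rpow_coord hz 1

lemma Conormal.inv_coord (hz : z 0 = 0) : Conormal z (-1) (fun y => (y 0)⁻¹) := by
  refine (Conormal.rpow_coord hz (-1)).congr ?_
  filter_upwards [eventually_pos] with y hy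
  rw [Real.rpow_neg_one]

lemma NormalReg.pderiv (h : NormalReg z k F) {i : Fin 3} (hi : i ≠ 0) : NormalReg z k (pd i F) := by
  induction k generalizing F with
  | zero => exact Conormal.pd_ne h hi
  | succ k ih => exact ⟨h.1.pd_ne hi, (ih h.2).congr (pd_comm h.1.smooth i 0)⟩

lemma SmoothGerm.pderiv (h : SmoothGerm z F) (i : Fin 3) : SmoothGerm z (pd i F) := by
  by_cases hi : i = 0
  · subst hi; exact h.pd_zero
  · exact fun k => (h k).pderiv hi

/-- Each normal derivative costs one unit of weight, so weight `k` pays for `k` of them. -/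
lemma Conormal.normalReg (h : Conormal z k F) : NormalReg z k F := by
  induction k generalizing F with
  | zero => exact h.mono (by simp)
  | succ k ih =>
    refine ⟨h.mono (by positivity), ih ?_⟩
    have := h.pd_zero
    simpa using this

end Germs

/-! ### Interpolation: the decay of a conormal function passes to its derivatives. -/

section Interpolation

variable {V : Type*} [NormedAddCommGroup V] [NormedSpace ℝ V]
  {z : E3} {F : E3 → V} {t σ a b : ℝ} {m : ℕ}

lemma eventually_L_iff {p : E3 → Prop} :
    (∀ᶠ y in L z, p y) ↔ ∃ r > 0, ∀ y, dist y z < r → 0 < y 0 → p y := by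
  rw [L, eventually_nhdsWithin_iff, Metric.eventually_nhds_iff]
  rfl

lemma norm_stdVec (i : Fin 3) : ‖stdVec i‖ = 1 := by simp [stdVec]

lemma coord_add_smul (y : E3) (τ : ℝ) (i : Fin 3) : (y + τ • stdVec i) 0 = y 0 + τ * wt i := by
  simp [stdVec, wt, eq_comm]

lemma coord_le_dist (hz : z 0 = 0) (y : E3) : y 0 ≤ dist y z := by
  have := (le_abs_self _).trans (PiLp.norm_apply_le (y - z) 0)
  rw [dist_eq_norm]
  simpa [hz] using this

lemma hasDerivAt_line {y : E3} {τ : ℝ} {i : Fin 3}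
    (h : DifferentiableAt ℝ F (y + τ • stdVec i)) :
    HasDerivAt (fun τ : ℝ => F (y + τ • stdVec i)) (pd i F (y + τ • stdVec i)) τ := by
  have h1 : HasDerivAt (fun τ : ℝ => y + τ • stdVec i) (stdVec i) τ := by
    simpa using ((hasDerivAt_id τ).smul_const (stdVec i)).const_add y
  exact h.hasFDerivAt.comp_hasDerivAt τ h1

lemma rpow_le_of_le_two_mul {x w : ℝ} (p : ℝ) (hx : 0 < x) (h1 : x ≤ w) (h2 : w ≤ 2 * x) :
    w ^ p ≤ 2 ^ |p| * x ^ p := by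
  rcases le_total 0 p with hp | hp
  · rw [abs_of_nonneg hp, ← Real.mul_rpow (by norm_num) hx.le]
    exact Real.rpow_le_rpow (hx.le.trans h1) h2 hp
  · calc w ^ p ≤ x ^ p := Real.rpow_le_rpow_of_nonpos hx h1 hp
      _ ≤ 2 ^ |p| * x ^ p := le_mul_of_one_le_left (by positivity)
        (Real.one_le_rpow (by norm_num) (abs_nonneg p))

/-- The bound on the second derivative is integrated twice by the mean value inequality. The
constant is cruder than in Taylor's formula, but only the order `h²` matters. -/
lemma norm_taylor_le {y : E3} {h M : ℝ} {i : Fin 3} (hh : 0 ≤ h)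
    (hd : ∀ τ ∈ Icc 0 h, ContDiffAt ℝ ∞ F (y + τ • stdVec i))
    (hM : ∀ τ ∈ Icc 0 h, ‖pd i (pd i F) (y + τ • stdVec i)‖ ≤ M) :
    ‖F (y + h • stdVec i) - F y - h • pd i F y‖ ≤ M * h * h := by
  have hM0 : 0 ≤ M := (norm_nonneg _).trans (hM 0 ⟨le_rfl, hh⟩)
  have h1 : ∀ τ ∈ Icc 0 h, ‖pd i F (y + τ • stdVec i) - pd i F y‖ ≤ M * h := by
    intro τ hτ
    have := norm_image_sub_le_of_norm_deriv_le_segment' (a := 0) (b := h)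
      (f := fun τ : ℝ => pd i F (y + τ • stdVec i)) (C := M)
      (fun x hx => (hasDerivAt_line (F := pd i F) (i := i)
        (((hd x hx).fderiv_right (m := ∞) (by simp)).clm_apply
          contDiffAt_const |>.differentiableAt (by simp))).hasDerivWithinAt)
      (fun x hx => hM x (Ico_subset_Icc_self hx)) τ hτ
    simp only [zero_smul, add_zero, sub_zero] at this
    exact this.trans (by gcongr; exact hτ.2)
  have := norm_image_sub_le_of_norm_deriv_le_segment' (a := 0) (b := h)
      (f := fun τ : ℝ => F (y + τ • stdVec i) - τ • pd i F y) (C := M * h)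
      (f' := fun τ => pd i F (y + τ • stdVec i) - pd i F y)
      (fun x hx => ((hasDerivAt_line (i := i) ((hd x hx).differentiableAt (by simp))).sub
        (by simpa using (hasDerivAt_id x).smul_const (pd i F y))).hasDerivWithinAt)
      (fun x hx => h1 x (Ico_subset_Icc_self hx)) h ⟨hh, le_rfl⟩
  simpa [sub_right_comm] using this

/-- Landau's inequality in weighted form. -/
lemma BO.landau (hz : z 0 = 0) (hs : SmoothNear z F) {i : Fin 3} (hab : b ≤ a) (hf : BO z a F)
    (h2 : BO z (b - 2 * wt i) (pd i (pd i F))) : BO z ((a + b) / 2 - wt i) (pd i F) := by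
  intro s hsl
  set ε := (a + b) / 2 - wt i - s with hε
  obtain ⟨C₁, hC₁⟩ := hf (a - ε) (by linarith)
  obtain ⟨C₂, hC₂⟩ := h2 (b - 2 * wt i - ε) (by linarith)
  obtain ⟨r, hr, H⟩ := eventually_L_iff.1 (hs.and (hC₁.and hC₂))
  -- With `η ≤ r / 2` the segments used below stay in the ball where the bounds hold; with `η ≤ 1` a
  -- normal step is at most `y₀`.
  set η := min 1 (r / 2) with hη
  have hη0 : 0 < η := by positivity
  -- The step length `h = η y₀^p` balances the two error terms `F / h` and `h F''`: both become of
  -- order `y₀^((a+b)/2 - wt i)`. For the normal direction `p ≥ 1`, so that heights along the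
  -- segment lie between `y₀` and `2 y₀` and all powers of them are comparable.
  set p := (a - b) / 2 + wt i with hp
  have hp0 : 0 ≤ p := by have := wt_nonneg i; rw [hp]; linarith
  refine ⟨(|C₁| * 2 ^ |a - ε| + |C₁|) / η + |C₂| * 2 ^ |b - 2 * wt i - ε| * η, ?_⟩
  refine eventually_L_iff.2 ⟨η, hη0, fun y hy hy0 => ?_⟩
  have hy1 : y 0 ≤ 1 := (coord_le_dist hz y).trans (hy.le.trans (min_le_left _ _))
  set h := η * y 0 ^ p with hh
  have hh0 : 0 < h := by positivity
  have hhη : h ≤ η := mul_le_of_le_one_right hη0.le (Real.rpow_le_one hy0.le hy1 hp0)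
  have hhy : h * wt i ≤ y 0 := by
    by_cases hi : i = 0
    · subst hi
      rw [wt_zero, mul_one, hh]
      have h3 : y 0 ^ p ≤ y 0 ^ (1 : ℝ) :=
        Real.rpow_le_rpow_of_exponent_ge hy0 hy1 (by rw [hp, wt_zero]; linarith)
      rw [Real.rpow_one] at h3
      have : η ≤ 1 := min_le_left _ _
      nlinarith [Real.rpow_nonneg hy0.le p]
    · rw [wt_of_ne hi, mul_zero]; exact hy0.le
  have hbd : ∀ τ ∈ Icc 0 h, dist (y + τ • stdVec i) z < r ∧ y 0 ≤ (y + τ • stdVec i) 0 ∧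
      (y + τ • stdVec i) 0 ≤ 2 * y 0 := by
    intro τ hτ
    refine ⟨?_, ?_, ?_⟩
    · calc dist (y + τ • stdVec i) z ≤ dist (y + τ • stdVec i) y + dist y z := dist_triangle _ _ _
        _ < r / 2 + r / 2 := by
          refine add_lt_add_of_le_of_lt ?_ (hy.trans_le (min_le_right _ _))
          rw [dist_eq_norm, add_sub_cancel_left, norm_smul, norm_stdVec, mul_one, Real.norm_eq_abs,
            abs_of_nonneg hτ.1]
          exact hτ.2.trans (hhη.trans (min_le_right _ _))
        _ = r := by ring
    · rw [coord_add_smul]; nlinarith [wt_nonneg i, hτ.1]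
    · rw [coord_add_smul]; nlinarith [wt_nonneg i, hτ.2]
  have hH : ∀ τ ∈ Icc 0 h, _ := fun τ hτ =>
    H (y + τ • stdVec i) (hbd τ hτ).1 (hy0.trans_le (hbd τ hτ).2.1)
  set M := |C₂| * 2 ^ |b - 2 * wt i - ε| * y 0 ^ (b - 2 * wt i - ε) with hM
  have hT := norm_taylor_le (F := F) (y := y) (i := i) (M := M) hh0.le (fun τ hτ => (hH τ hτ).1)
    (fun τ hτ => by
      refine (hH τ hτ).2.2.trans ?_
      rw [hM, mul_assoc]
      refine mul_le_mul (le_abs_self _) (rpow_le_of_le_two_mul _ hy0 (hbd τ hτ).2.1 (hbd τ hτ).2.2)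
        (Real.rpow_nonneg (hy0.le.trans (hbd τ hτ).2.1) _) (abs_nonneg _))
  have hF1 : ‖F (y + h • stdVec i)‖ ≤ |C₁| * 2 ^ |a - ε| * y 0 ^ (a - ε) := by
    have h3 := hbd h ⟨hh0.le, le_rfl⟩
    refine (hH h ⟨hh0.le, le_rfl⟩).2.1.trans ?_
    rw [mul_assoc]
    exact mul_le_mul (le_abs_self _) (rpow_le_of_le_two_mul _ hy0 h3.2.1 h3.2.2)
        (Real.rpow_nonneg (hy0.le.trans h3.2.1) _) (abs_nonneg _)
  have hF0 : ‖F y‖ ≤ |C₁| * y 0 ^ (a - ε) := by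
    have := (hH 0 ⟨le_rfl, hh0.le⟩).2.1
    rw [zero_smul, add_zero] at this
    exact this.trans (by gcongr; exact le_abs_self _)
  have hmain : h * ‖pd i F y‖ ≤ (|C₁| * 2 ^ |a - ε| + |C₁|) * y 0 ^ (a - ε) + M * h * h := by
    have : h • pd i F y = F (y + h • stdVec i) - F y
        - (F (y + h • stdVec i) - F y - h • pd i F y) := by abel
    calc h * ‖pd i F y‖ = ‖h • pd i F y‖ := by rw [norm_smul, Real.norm_eq_abs, abs_of_pos hh0]
      _ ≤ (‖F (y + h • stdVec i)‖ + ‖F y‖) + M * h * h := by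
          rw [this]
          exact (norm_sub_le _ _).trans (add_le_add (norm_sub_le _ _) hT)
      _ ≤ _ := by linarith
  have e1 : y 0 ^ (a - ε) = y 0 ^ s * y 0 ^ p := by
    rw [← Real.rpow_add hy0]; congr 1; rw [hp, hε]; ring
  have e2 : y 0 ^ (b - 2 * wt i - ε) * y 0 ^ p = y 0 ^ s := by
    rw [← Real.rpow_add hy0]; congr 1; rw [hp, hε]; ring
  refine le_of_mul_le_mul_left (hmain.trans (le_of_eq ?_)) hh0
  have e3 : M * h = |C₂| * 2 ^ |b - 2 * wt i - ε| * η * y 0 ^ s := by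
    rw [hM, hh, ← e2]; ring
  rw [e3, e1]
  rw [hh]
  field_simp

/-- A loss `c (t - σ)` for first derivatives, applied twice, bounds second derivatives with loss
`(2c - c²)(t - σ)`. Landau's inequality halves this, which gives the better factor `c - c²/2`.
Starting from `c = 1`, the trivial bound, the factor after `k` rounds is at most `2/(k+2)`. -/
lemma Conormal.gain (hz : z 0 = 0) (i : Fin 3) (k : ℕ) (hσ : σ ≤ t)
    (hF : Conormal z σ F) (hb : BO z t F) :
    BO z (t - wt i - 2 / (k + 2) * (t - σ)) (pd i F) := by
  induction k generalizing F σ t with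
  | zero =>
    refine (hF.pderiv i).bo.mono (le_of_eq ?_)
    norm_num
  | succ k ih =>
    set c : ℝ := 2 / (k + 2) with hc
    have hc0 : 0 ≤ c := by positivity
    have hc1 : c ≤ 1 := by rw [hc, div_le_one (by positivity)]; linarith [(k.cast_nonneg : (0:ℝ) ≤ k)]
    have h1 := ih hσ hF hb
    have h2 := ih (σ := σ - wt i) (t := t - wt i - c * (t - σ)) (by nlinarith) (hF.pderiv i) h1
    have h3 := hb.landau hz hF.smooth (i := i) (b := t - (2 * c - c ^ 2) * (t - σ))
      (by nlinarith [mul_nonneg (mul_nonneg hc0 (by linarith : 0 ≤ 2 - c)) (sub_nonneg.2 hσ)])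
      (h2.mono (le_of_eq (by ring)))
    refine h3.mono ?_
    have h4 : c - c ^ 2 / 2 ≤ 2 / ((k + 1 : ℕ) + 2) := by
      rw [hc]; push_cast
      have : (0:ℝ) ≤ k := k.cast_nonneg
      rw [div_pow, div_div, div_sub_div _ _ (by positivity) (by positivity),
        div_le_div_iff₀ (by positivity) (by positivity)]
      nlinarith [sq_nonneg ((k:ℝ) + 2)]
    nlinarith [mul_le_mul_of_nonneg_right h4 (sub_nonneg.2 hσ)]

/-- The loss in `Conormal.gain` tends to zero with `k`, and `BO` only involves exponents strictly
below the weight. -/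
lemma Conormal.bo_pd (hz : z 0 = 0) (i : Fin 3) (hF : Conormal z σ F) (hb : BO z t F) :
    BO z (t - wt i) (pd i F) := by
  rcases le_total t σ with h | h
  · exact (hF.pderiv i).bo.mono (by linarith)
  intro s hs
  obtain ⟨k, hk⟩ := exists_nat_gt (2 * (t - σ) / (t - wt i - s))
  refine hF.gain hz i k h hb s ?_
  have hpos : 0 < t - wt i - s := by linarith
  rw [div_lt_iff₀ hpos] at hk
  have : 2 / ((k:ℝ) + 2) * (t - σ) < t - wt i - s := by
    rw [div_mul_eq_mul_div, div_lt_iff₀ (by positivity)]; nlinarith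
  linarith

/-- Conormal functions that decay have derivatives that decay accordingly. -/
lemma Conormal.of_bo (hz : z 0 = 0) (hF : Conormal z σ F) (hb : BO z t F) : Conormal z t F := by
  intro n
  induction n generalizing F σ t with
  | zero => exact ⟨hF.smooth, hb⟩
  | succ n ih => exact ⟨⟨hF.smooth, hb⟩, fun i => ih (hF.pderiv i) (hF.bo_pd hz i hb)⟩

end Interpolation

/-! ### The radial derivative, its differential equation, and division by the normal coordinate. -/

section Radial

variable {z : E3} {w r F G : E3 → ℝ} {t a b : ℝ} {m k : ℕ}

/-- The radial derivative `y₀ ∂₀`. -/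
def rad (w : E3 → ℝ) : E3 → ℝ := (fun y => y 0) * pd 0 w

/-- The commutator of `∂ᵢ` with `y₀∂₀` is `wt i • ∂ᵢ`: only the normal derivative meets the factor
`y₀`. -/
lemma pd_rad (hs : SmoothNear z w) (i : Fin 3) :
    rad (pd i w) + wt i • pd i w =ᶠ[L z] pd i (rad w) := by
  refine EventuallyEq.trans ?_ (pd_mul smoothNear_coord (hs.pderiv 0) i)
  filter_upwards [pd_comm hs 0 i] with y hy
  simp only [rad, Pi.add_apply, Pi.mul_apply, Pi.smul_apply, pd_coord, smul_eq_mul, hy]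
  by_cases hi : i = 0
  · subst hi; ring
  · rw [wt_of_ne hi]; ring

/-- A normal derivative raises the constant `a` of the equation by one. This is what removes the
resonance after `μ` derivatives and makes later equations easier. -/
lemma pd_rad_add (hs : SmoothNear z w) (i : Fin 3) (a : ℝ) (h : rad w + a • w =ᶠ[L z] r) :
    rad (pd i w) + (a + wt i) • pd i w =ᶠ[L z] pd i r := by
  have hr : SmoothNear z (rad w) := smoothNear_coord.mul (hs.pderiv 0)
  have h1 := pd_congr (i := i) h
  have h2 := pd_add hr (hs.clm (a • ContinuousLinearMap.id ℝ ℝ)) i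
  have h3 := pd_clm (a • ContinuousLinearMap.id ℝ ℝ) hs i
  filter_upwards [h1, h2, h3, pd_rad hs i] with y e1 e2 e3 e4
  rw [← e1]
  refine Eq.trans ?_ e2
  rw [Pi.add_apply (pd i (rad w)), ← e3, ← e4]
  simp only [Pi.add_apply, Pi.smul_apply, smul_apply, ContinuousLinearMap.id_apply, smul_eq_mul]
  ring

/-- Along normal lines the equation reads `d/dτ (τ^a w) = τ^(a-1) r`. The condition `-a < b`
excludes the homogeneous solution `y₀^(-a)`, so that `τ^a w` may be integrated from its boundary
value zero. -/
lemma BO.ode (hz : z 0 = 0) (hs : SmoothNear z w) (h : rad w + a • w =ᶠ[L z] r)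
    (hw : BO z b w) (hb : -a < b) (hr : BO z t r) (ht : -a < t) : BO z t w := by
  intro s hst
  obtain ⟨s₁, hs₁, hs₁t⟩ := exists_between (max_lt hst ht)
  obtain ⟨b₁, hb₁, hb₁b⟩ := exists_between hb
  have hκ : 0 < s₁ + a := by linarith [(le_max_right s (-a)).trans_lt hs₁]
  have hss : s ≤ s₁ := ((le_max_left s (-a)).trans_lt hs₁).le
  obtain ⟨C, hC⟩ := hr s₁ hs₁t
  obtain ⟨C', hC'⟩ := hw b₁ hb₁b
  obtain ⟨R, hR, H⟩ := eventually_L_iff.1 (hs.and (h.and (hC.and hC')))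
  refine ⟨|C| / (s₁ + a), eventually_L_iff.2 ⟨min 1 (R / 2), by positivity, fun y hy hy0 => ?_⟩⟩
  have hy1 : y 0 ≤ 1 := (coord_le_dist hz y).trans (hy.le.trans (min_le_left _ _))
  -- The normal line through `y`, parametrized by its height above the boundary.
  set P : ℝ → E3 := fun τ => (y - y 0 • stdVec 0) + τ • stdVec 0 with hP
  have hP0 : ∀ τ, P τ 0 = τ := fun τ => by simp [hP, stdVec]
  have hPy : P (y 0) = y := by simp [hP]
  have HP : ∀ τ ∈ Ioc 0 (y 0), _ := fun τ hτ => H (P τ) (by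
    have h1 : dist (P τ) y ≤ y 0 := by
      have : P τ - y = (τ - y 0) • stdVec 0 := by simp only [hP, sub_smul]; abel
      rw [dist_eq_norm, this, norm_smul, norm_stdVec, mul_one, Real.norm_eq_abs, abs_sub_comm,
        abs_of_nonneg (by linarith [hτ.2])]
      linarith [hτ.1]
    have h2 := dist_triangle (P τ) y z
    have h3 := coord_le_dist hz y
    have h4 := hy.trans_le (min_le_right 1 (R / 2))
    linarith) (by rw [hP0]; exact hτ.1)
  have hder : ∀ τ ∈ Ioc 0 (y 0), HasDerivAt (fun τ => τ ^ a * w (P τ)) (τ ^ (a - 1) * r (P τ)) τ := by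
    intro τ hτ
    have h1 := hasDerivAt_line (F := w) (i := 0) (y := y - y 0 • stdVec 0) (τ := τ)
      ((HP τ hτ).1.differentiableAt (by simp))
    have h2 := (Real.hasDerivAt_rpow_const (x := τ) (p := a) (Or.inl hτ.1.ne')).mul h1
    refine h2.congr_deriv ?_
    have h3 := (HP τ hτ).2.1
    simp only [rad, Pi.add_apply, Pi.mul_apply, Pi.smul_apply, smul_eq_mul, hP0] at h3
    rw [← h3]
    have h4 : τ ^ a = τ ^ (a - 1) * τ := by rw [← Real.rpow_add_one hτ.1.ne']; ring_nf
    rw [h4]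
    simp only [hP]
    ring
  -- The integration starts at height `e`; the last term bounds the initial value and disappears as
  -- `e → 0`, since `a + b₁ > 0`.
  have key : ∀ e ∈ Ioo 0 (y 0), y 0 ^ a * |w y| ≤ |C| / (s₁ + a) * y 0 ^ (s₁ + a)
      + |C'| * e ^ (a + b₁) := by
    intro e he
    have := image_norm_le_of_norm_deriv_right_le_deriv_boundary' (a := e) (b := y 0)
      (f := fun τ => τ ^ a * w (P τ)) (f' := fun τ => τ ^ (a - 1) * r (P τ))
      (B := fun τ => |C| / (s₁ + a) * τ ^ (s₁ + a) + |C'| * e ^ (a + b₁))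
      (B' := fun τ => |C| * τ ^ (s₁ + a - 1))
      (fun τ hτ => (hder τ ⟨he.1.trans_le hτ.1, hτ.2⟩).continuousAt.continuousWithinAt)
      (fun τ hτ => (hder τ ⟨he.1.trans_le hτ.1, hτ.2.le⟩).hasDerivWithinAt)
      ?_ ?_ ?_ ?_ ⟨he.2.le, le_rfl⟩
    · rw [hPy, Real.norm_eq_abs, abs_mul, abs_of_pos (Real.rpow_pos_of_pos hy0 a)] at this
      exact this
    · have h1 := (HP e ⟨he.1, he.2.le⟩).2.2.2
      rw [hP0] at h1
      have h2 : ‖e ^ a * w (P e)‖ ≤ |C'| * e ^ (a + b₁) := by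
        rw [norm_mul, Real.norm_eq_abs, abs_of_pos (Real.rpow_pos_of_pos he.1 a),
          Real.rpow_add he.1]
        have := Real.rpow_pos_of_pos he.1 a
        have h5 : ‖w (P e)‖ ≤ |C'| * e ^ b₁ := h1.trans (by
          have := Real.rpow_pos_of_pos he.1 b₁
          gcongr; exact le_abs_self _)
        nlinarith
      have := Real.rpow_pos_of_pos he.1 (s₁ + a)
      exact h2.trans (le_add_of_nonneg_left (by positivity))
    · refine ContinuousOn.add (ContinuousOn.mul continuousOn_const ?_) continuousOn_const
      exact fun τ hτ => (Real.continuousAt_rpow_const _ _ (Or.inr hκ.le)).continuousWithinAt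
    · intro τ hτ
      have hτ0 : 0 < τ := he.1.trans_le hτ.1
      refine HasDerivAt.hasDerivWithinAt ?_
      refine (((Real.hasDerivAt_rpow_const (x := τ) (p := s₁ + a) (Or.inl hτ0.ne')).const_mul
        (|C| / (s₁ + a))).add_const (|C'| * e ^ (a + b₁))).congr_deriv ?_
      field_simp
    · intro τ hτ
      have hτ0 : 0 < τ := he.1.trans_le hτ.1
      have h1 := (HP τ ⟨hτ0, hτ.2.le⟩).2.2.1
      rw [hP0] at h1
      rw [norm_mul, Real.norm_eq_abs, abs_of_pos (Real.rpow_pos_of_pos hτ0 _),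
        show s₁ + a - 1 = (a - 1) + s₁ by ring, Real.rpow_add hτ0]
      have h3 := Real.rpow_pos_of_pos hτ0 (a - 1)
      have h4 := Real.rpow_pos_of_pos hτ0 s₁
      have h5 : ‖r (P τ)‖ ≤ |C| * τ ^ s₁ := h1.trans (by gcongr; exact le_abs_self _)
      nlinarith
  have hlim : y 0 ^ a * |w y| ≤ |C| / (s₁ + a) * y 0 ^ (s₁ + a) := by
    have ht : Tendsto (fun e : ℝ => |C| / (s₁ + a) * y 0 ^ (s₁ + a) + |C'| * e ^ (a + b₁)) (𝓝[>] 0)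
        (𝓝 (|C| / (s₁ + a) * y 0 ^ (s₁ + a) + |C'| * 0 ^ (a + b₁))) :=
      (((Real.continuousAt_rpow_const 0 (a + b₁) (Or.inr (by linarith))).tendsto.mono_left
        nhdsWithin_le_nhds).const_mul _).const_add _
    rw [Real.zero_rpow (by linarith), mul_zero, add_zero] at ht
    refine ge_of_tendsto ht ?_
    filter_upwards [Ioo_mem_nhdsGT hy0] with e he using key e he
  have hya := Real.rpow_pos_of_pos hy0 a
  have h6 : ‖w y‖ ≤ |C| / (s₁ + a) * y 0 ^ s₁ := by
    rw [Real.rpow_add hy0] at hlim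
    refine le_of_mul_le_mul_left (hlim.trans (le_of_eq (by ring))) hya
  refine h6.trans (mul_le_mul_of_nonneg_left ?_ (by positivity))
  exact Real.rpow_le_rpow_of_exponent_ge hy0 hy1 hss

/-- Regularity for the ordinary differential equation `(y₀ ∂₀ + a) w = r`. -/
lemma Conormal.ode (hz : z 0 = 0) (h : rad w + a • w =ᶠ[L z] r)
    (hw : Conormal z b w) (hb : -a < b) (hr : Conormal z t r) (ht : -a < t) : Conormal z t w :=
  hw.of_bo hz (BO.ode hz hw.smooth h hw.bo hb hr.bo ht)

/-- The normal derivative of `w` solves the equation with `a + 1`. A priori it has only weight `-1`,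
which exceeds the critical exponent `-(a + 1)` because `a > 0`; so the argument repeats. -/
lemma NormalReg.ode (hz : z 0 = 0) (h : rad w + a • w =ᶠ[L z] r)
    (hw : Conormal z b w) (hb : -a < b) (hr : NormalReg z m r) (ha : 0 < a) :
    NormalReg z m w := by
  have h0 : Conormal z 0 w := hw.ode hz h hb hr.conormal (by linarith)
  induction m generalizing w r a b with
  | zero => exact h0
  | succ m ih =>
    have h1 := pd_rad_add hw.smooth 0 a h
    refine ⟨h0, ih h1 h0.pd_zero (by rw [wt_zero]; linarith) hr.2 (by rw [wt_zero]; linarith) ?_⟩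
    exact h0.pd_zero.ode hz h1 (by rw [wt_zero]; linarith) hr.2.conormal (by rw [wt_zero]; linarith)

lemma Conormal.coord_mul (hz : z 0 = 0) (h : Conormal z t w) :
    Conormal z (t + 1) ((fun y => y 0) * w) :=
  ((Conormal.coord hz).mul h).mono (by linarith)

lemma Conormal.radial (hz : z 0 = 0) (h : Conormal z t w) : Conormal z t (rad w) :=
  (h.pd_zero.coord_mul hz).mono (by linarith)

lemma NormalReg.radial (hz : z 0 = 0) (h : NormalReg z k w) : NormalReg z k (rad w) := by
  induction k generalizing w with
  | zero => exact Conormal.radial hz h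
  | succ k ih =>
    refine ⟨h.1.radial hz, ((ih h.2).add (h.2.const_smul (wt 0))).congr (pd_rad h.1.smooth 0)⟩

/-- Since `∂₀(y₀ w) = w + y₀∂₀ w` and `y₀∂₀` preserves normal regularity, the factor `y₀` gains a
derivative. -/
lemma NormalReg.coord_mul (hz : z 0 = 0) (h : NormalReg z k w) :
    NormalReg z (k + 1) ((fun y => y 0) * w) := by
  refine ⟨(h.conormal.coord_mul hz).mono (by norm_num), ?_⟩
  refine (h.add (h.radial hz)).congr ?_
  filter_upwards [pd_mul (z := z) smoothNear_coord h.conormal.smooth 0] with y hy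
  rw [← hy]
  simp [pd_coord, rad]

/-- Division by the normal coordinate. -/
lemma NormalReg.inv_coord_mul (hz : z 0 = 0) (h : NormalReg z (m + 1) F) {ε : ℝ} (hε : 0 < ε)
    (hb : BO z ε F) : NormalReg z m ((fun y => (y 0)⁻¹) * F) := by
  have hF : Conormal z ε F := h.conormal.of_bo hz hb
  have hi := Conormal.inv_coord hz
  -- The quotient `F / y₀` solves `(y₀∂₀ + 1) v = ∂₀F`; the decay of `F` separates it from the
  -- homogeneous solution `1/y₀`.
  refine NormalReg.ode (a := 1) (b := -1 + ε) hz ?_ (hi.mul hF) (by linarith) h.2 one_pos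
  have hp := pd_inv (z := z) smoothNear_coord (eventually_pos.mono fun y hy => hy.ne') 0
  filter_upwards [pd_mul hi.smooth hF.smooth 0, hp, eventually_pos] with y h1 h2 h3
  simp only [rad, Pi.add_apply, Pi.mul_apply, ← h1, one_smul]
  have h2' : pd 0 (fun y : E3 => (y 0)⁻¹) y = _ := h2.symm
  rw [h2']
  simp only [pd_coord, wt_zero, Pi.neg_apply, Pi.mul_apply, Pi.inv_apply]
  field_simp
  ring

lemma coord_mul_inv_coord (F : E3 → ℝ) :
    (fun y => y 0) * ((fun y => (y 0)⁻¹) * F) =ᶠ[L z] F := by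
  filter_upwards [eventually_pos] with y hy
  simp only [Pi.mul_apply]
  field_simp

lemma SmoothGerm.inv_coord_mul (hz : z 0 = 0) (h : SmoothGerm z F) (hb : BO z 1 F) :
    SmoothGerm z ((fun y => (y 0)⁻¹) * F) :=
  fun m => (h (m + 1)).inv_coord_mul hz one_pos hb

/-- A coefficient that vanishes at the boundary gains one normal derivative. -/
lemma NormalReg.vanishing_mul (hz : z 0 = 0) (h : SmoothGerm z F) (hb : BO z 1 F)
    (hG : NormalReg z k G) : NormalReg z (k + 1) (F * G) := by
  refine (((h.inv_coord_mul hz hb k).mul hG).coord_mul hz).congr ?_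
  filter_upwards [coord_mul_inv_coord (z := z) F] with y hy
  simp only [Pi.mul_apply] at hy ⊢
  rw [← mul_assoc, hy]

/-- Products of functions vanishing at the boundary gain one normal derivative. -/
lemma NormalReg.mul_gain (hF : NormalReg z k F) (hF1 : Conormal z 1 F) (hG : NormalReg z k G)
    (hG1 : Conormal z 1 G) : NormalReg z (k + 1) (F * G) := by
  -- A factor of weight one makes up for one missing normal derivative of the other factor. For `k =
  -- 0` the latter is only known to have weight `-1`. Each product-rule term of `∂₀(F G)` is of this
  -- form.
  have aux : ∀ k : ℕ, ∀ v w : E3 → ℝ, NormalReg z k v → Conormal z 1 v → Conormal z (-1) w →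
      (∀ j, j + 1 = k → NormalReg z j w) → NormalReg z k (v * w) := by
    intro k
    induction k with
    | zero => exact fun v w hv hv1 hw _ => (hv1.mul hw).mono (by norm_num)
    | succ k ih =>
      intro v w hv hv1 hw hwk
      refine ⟨(hv1.mul hw).mono (by norm_num), ?_⟩
      refine NormalReg.congr ?_ (pd_mul hv1.smooth hw.smooth 0)
      have hwk := hwk k rfl
      refine (hv.2.mul hwk).add (ih v _ hv.pred hv1 ?_ ?_)
      · simpa using hwk.conormal.pd_zero
      · rintro j rfl; exact hwk.2
  refine ⟨(hF1.mul hG1).mono (by norm_num), NormalReg.congr ?_ (pd_mul hF1.smooth hG1.smooth 0)⟩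
  have hd : ∀ {H : E3 → ℝ}, NormalReg z k H → ∀ j, j + 1 = k → NormalReg z j (pd 0 H) := by
    rintro H hH j rfl; exact hH.2
  refine NormalReg.add ?_ (aux k F _ hF hF1 ?_ (hd hG))
  · rw [mul_comm]
    exact aux k G _ hG hG1 (hF.conormal.pd_zero.mono (by norm_num)) (hd hF)
  · exact hG.conormal.pd_zero.mono (by norm_num)

end Radial

/-! ### Degenerate operators and the bootstrap in normal regularity. -/

section Bootstrap

variable {z : E3} {ρ u φ α h : E3 → ℝ} {A : Fin 3 → Fin 3 → E3 → ℝ} {B : Fin 3 → E3 → ℝ}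
  {C : E3 → ℝ} {t δ : ℝ} {k m : ℕ}

lemma SmoothGerm.sum {ι V : Type*} [NormedAddCommGroup V] [NormedSpace ℝ V] (s : Finset ι)
    {F : ι → E3 → V} (h : ∀ i ∈ s, SmoothGerm z (F i)) : SmoothGerm z (∑ i ∈ s, F i) :=
  Finset.sum_induction _ _ (fun _ _ => SmoothGerm.add) (fun _ => NormalReg.zero) h

lemma NormalReg.sum {ι V : Type*} [NormedAddCommGroup V] [NormedSpace ℝ V] (s : Finset ι)
    {F : ι → E3 → V} (h : ∀ i ∈ s, NormalReg z k (F i)) : NormalReg z k (∑ i ∈ s, F i) :=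
  Finset.sum_induction _ _ (fun _ _ => NormalReg.add) NormalReg.zero h

lemma Conormal.sum {ι V : Type*} [NormedAddCommGroup V] [NormedSpace ℝ V] (s : Finset ι)
    {F : ι → E3 → V} (h : ∀ i ∈ s, Conormal z t (F i)) : Conormal z t (∑ i ∈ s, F i) :=
  Finset.sum_induction _ _ (fun _ _ => Conormal.add) Conormal.zero h

lemma BO.zero {V : Type*} [NormedAddCommGroup V] [NormedSpace ℝ V] : BO z t (0 : E3 → V) :=
  Conormal.zero.bo

lemma BO.sum {ι V : Type*} [NormedAddCommGroup V] [NormedSpace ℝ V] (s : Finset ι)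
    {F : ι → E3 → V} (h : ∀ i ∈ s, BO z t (F i)) : BO z t (∑ i ∈ s, F i) :=
  Finset.sum_induction _ _ (fun _ _ => BO.add) BO.zero h

lemma BO.mul_smooth {F G : E3 → ℝ} (hF : BO z t F) (hG : SmoothGerm z G) : BO z t (F * G) := by
  simpa using hF.mul hG.conormal.bo

/-- The uniformly degenerate operator with coefficients `A`, `B`, `C`. -/
def degOp (A : Fin 3 → Fin 3 → E3 → ℝ) (B : Fin 3 → E3 → ℝ) (C ρ u : E3 → ℝ) : E3 → ℝ :=
  ∑ i, ∑ j, A i j * ρ ^ 2 * pd i (pd j u) + ∑ i, B i * ρ * pd i u + C * u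

/-- The squared length of `dρ` in terms of the principal part `A`. -/
def normSqGrad (A : Fin 3 → Fin 3 → E3 → ℝ) (ρ : E3 → ℝ) : E3 → ℝ :=
  ∑ i, ∑ j, A i j * pd i ρ * pd j ρ

/-- Assumptions on the coefficients of a degenerate operator, such that the indicial polynomial
is a multiple of `s (s - 2) - μ (μ - 2)`. -/
structure AdaptedCoeffs (z : E3) (A : Fin 3 → Fin 3 → E3 → ℝ) (B : Fin 3 → E3 → ℝ)
    (C ρ : E3 → ℝ) (μ : ℕ) : Prop where
  hz : z 0 = 0
  two_le : 2 ≤ μ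
  smooth_A : ∀ i j, SmoothGerm z (A i j)
  smooth_B : ∀ i, SmoothGerm z (B i)
  smooth_C : SmoothGerm z C
  smooth_ρ : SmoothGerm z ρ
  bo_ρ : BO z 1 ρ
  first_order : ∀ i, BO z 1 (B i + ∑ j, A i j * pd j ρ)
  zero_order : BO z 1 (C + ((μ : ℝ) * (μ - 2)) • normSqGrad A ρ)
  pos : ∃ c > 0, ∀ᶠ y in L z, c ≤ |normSqGrad A ρ y|

lemma smoothGerm_normSqGrad (hA : ∀ i j, SmoothGerm z (A i j)) (hρ : SmoothGerm z ρ) :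
    SmoothGerm z (normSqGrad A ρ) :=
  SmoothGerm.sum _ fun i _ => SmoothGerm.sum _ fun j _ =>
    ((hA i j).mul (hρ.pderiv i)).mul (hρ.pderiv j)

/-- With `h = ρ / y₀`, which is again a smooth germ, the difference is `y₀ ∂₀h`. -/
lemma pd_zero_sub_quotient (hz : z 0 = 0) (hρ : SmoothGerm z ρ) (hb : BO z 1 ρ) :
    BO z 1 (pd 0 ρ - (fun y => (y 0)⁻¹) * ρ) := by
  have hh := hρ.inv_coord_mul hz hb
  have := (hh.conormal.pd_zero.coord_mul hz).coord_mul hz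
  refine (((hh.pderiv 0).conormal.coord_mul hz).bo.mono (t' := 1) (by norm_num)).congr ?_
  filter_upwards [pd_congr (i := 0) (coord_mul_inv_coord (z := z) ρ),
    pd_mul (z := z) smoothNear_coord hh.conormal.smooth 0] with y h1 h2
  rw [Pi.sub_apply, ← h1, ← h2]
  simp [pd_coord]

lemma pd_ne_bo (hz : z 0 = 0) (hρ : SmoothGerm z ρ) (hb : BO z 1 ρ) {i : Fin 3} (hi : i ≠ 0) :
    BO z 1 (pd i ρ) := by
  simpa [wt_of_ne hi] using hρ.conormal.bo_pd hz i hb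

/-- On the boundary the tangential derivatives of `ρ` vanish and `∂₀ρ` equals `ρ / y₀`, so that only
the entry `A 0 0` contributes to the squared length. -/
lemma normSqGrad_sub (hz : z 0 = 0) (hA : ∀ i j, SmoothGerm z (A i j)) (hρ : SmoothGerm z ρ)
    (hb : BO z 1 ρ) :
    BO z 1 (A 0 0 * ((fun y => (y 0)⁻¹) * ρ) ^ 2 - normSqGrad A ρ) := by
  set h := (fun y : E3 => (y 0)⁻¹) * ρ
  have hh : SmoothGerm z h := hρ.inv_coord_mul hz hb
  have h0 := pd_zero_sub_quotient hz hρ hb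
  have h1 := pd_ne_bo hz hρ hb (i := 1) (by decide)
  have h2 := pd_ne_bo hz hρ hb (i := 2) (by decide)
  have e : A 0 0 * h ^ 2 - normSqGrad A ρ =
      -((pd 0 ρ - h) * (A 0 0 * (pd 0 ρ + h)) + pd 1 ρ * (A 0 1 * pd 0 ρ) +
        pd 2 ρ * (A 0 2 * pd 0 ρ) + pd 1 ρ * (A 1 0 * pd 0 ρ) + pd 2 ρ * (A 2 0 * pd 0 ρ) +
        pd 1 ρ * (A 1 1 * pd 1 ρ) + pd 1 ρ * (A 1 2 * pd 2 ρ) + pd 2 ρ * (A 2 1 * pd 1 ρ) +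
        pd 2 ρ * (A 2 2 * pd 2 ρ)) := by
    simp only [normSqGrad, Fin.sum_univ_three]
    ring
  rw [e]
  have hm : ∀ i j k, SmoothGerm z (A i j * pd k ρ) := fun i j k => (hA i j).mul (hρ.pderiv k)
  exact ((((((((h0.mul_smooth ((hA 0 0).mul ((hρ.pderiv 0).add hh))).add
    (h1.mul_smooth (hm _ _ _))).add (h2.mul_smooth (hm _ _ _))).add
    (h1.mul_smooth (hm _ _ _))).add (h2.mul_smooth (hm _ _ _))).add
    (h1.mul_smooth (hm _ _ _))).add (h1.mul_smooth (hm _ _ _))).add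
    (h2.mul_smooth (hm _ _ _))).add (h2.mul_smooth (hm _ _ _)) |>.neg

lemma rad_rad (hu : SmoothNear z u) :
    rad (rad u) =ᶠ[L z] rad u + (fun y => y 0) ^ 2 * pd 0 (pd 0 u) := by
  filter_upwards [pd_mul (z := z) smoothNear_coord (hu.pderiv 0) 0] with y h2
  have : rad (rad u) y = y 0 * pd 0 ((fun y => y 0) * pd 0 u) y := rfl
  rw [this, ← h2]
  simp [pd_coord, rad]
  ring

/-- The model of `degOp` at the boundary. -/
def modelOp (A : Fin 3 → Fin 3 → E3 → ℝ) (ρ : E3 → ℝ) (μ : ℕ) (u : E3 → ℝ) : E3 → ℝ :=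
  normSqGrad A ρ * (rad (rad u) - (2 : ℝ) • rad u - ((μ : ℝ) * (μ - 2)) • u)

/-- The difference of `degOp` and its model has vanishing coefficients. -/
lemma AdaptedCoeffs.remainder {μ : ℕ} (H : AdaptedCoeffs z A B C ρ μ) (hu : SmoothNear z u)
    {Q Q' : (E3 → ℝ) → Prop}
    (hV : ∀ F G, SmoothGerm z F → BO z 1 F → Q G → Q' (F * G))
    (hadd : ∀ F G, Q' F → Q' G → Q' (F + G))
    (hcongr : ∀ F G, Q' F → F =ᶠ[L z] G → Q' G)
    (h0 : Q u) (h1 : Q (rad u)) (h2 : Q (rad (rad u) - rad u)) (h3 : ∀ i ≠ 0, Q (pd i u))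
    (h4 : ∀ i ≠ 0, Q (rad (pd i u))) (h5 : ∀ i ≠ 0, ∀ j ≠ 0, Q (pd i (pd j u))) :
    Q' (degOp A B C ρ u - modelOp A ρ μ u) := by
  -- `Q` and `Q'` stand for conormality of weights `t` and `t + 1`, or for normal regularity of
  -- orders `k` and `k + 1`; one splitting serves both. The operator is rewritten through `y₀∂₀` and
  -- tangential derivatives by means of `ρ = y₀ h`.
  obtain ⟨hz, -, hA, hB, hC, hρ, hb, hfo, hzo, -⟩ := H
  set h := (fun y : E3 => (y 0)⁻¹) * ρ with hh'
  have hh : SmoothGerm z h := hρ.inv_coord_mul hz hb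
  have hα := smoothGerm_normSqGrad hA hρ
  have hα0 := normSqGrad_sub hz hA hρ hb
  have h12 : (1 : Fin 3) ≠ 0 := by decide
  have h22 : (2 : Fin 3) ≠ 0 := by decide
  have d0 := pd_zero_sub_quotient hz hρ hb
  have d1 := pd_ne_bo hz hρ hb h12
  have d2 := pd_ne_bo hz hρ hb h22
  have hbρ : ∀ {F}, SmoothGerm z F → BO z 1 (ρ * F) := fun hF => hb.mul_smooth hF
  have hsρ : ∀ {F}, SmoothGerm z F → SmoothGerm z (ρ * F) := fun hF => hρ.mul hF
  have hAh : ∀ i j, SmoothGerm z (h * A i j) := fun i j => hh.mul (hA i j)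
  -- This is where the self-adjoint form of the first-order part enters: on the boundary `dρ = h
  -- dy₀`, hence `B₀ h = -A₀₀ h² = -|dρ|²`.
  have hB0 : BO z 1 (B 0 * h + normSqGrad A ρ) := by
    have e : B 0 * h + normSqGrad A ρ = (B 0 + ∑ j, A 0 j * pd j ρ) * h
        - (A 0 0 * h ^ 2 - normSqGrad A ρ) - (pd 0 ρ - h) * (A 0 0 * h) - pd 1 ρ * (A 0 1 * h)
        - pd 2 ρ * (A 0 2 * h) := by
      simp only [Fin.sum_univ_three]; ring
    rw [e]
    exact ((((hfo 0).mul_smooth hh).sub hα0).sub (d0.mul_smooth ((hA 0 0).mul hh))).sub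
      (d1.mul_smooth ((hA 0 1).mul hh)) |>.sub (d2.mul_smooth ((hA 0 2).mul hh))
  have T1 := hV _ _ (((hA 0 0).mul (hh.pow hz 2)).sub hα) hα0 h2
  have T4 := hV _ _ (((hB 0).mul hh).add hα) hB0 h1
  have T5 := hV _ _ (hC.add (hα.const_smul _)) hzo h0
  have T3 : ∀ i ≠ 0, Q' (ρ * B i * pd i u) := fun i hi => hV _ _ (hsρ (hB i)) (hbρ (hB i)) (h3 i hi)
  have T2 : ∀ i ≠ 0, Q' (ρ * (h * A 0 i) * rad (pd i u)) := fun i hi =>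
    hV _ _ (hsρ (hAh _ _)) (hbρ (hAh _ _)) (h4 i hi)
  have T2' : ∀ i ≠ 0, Q' (ρ * (h * A i 0) * rad (pd i u)) := fun i hi =>
    hV _ _ (hsρ (hAh _ _)) (hbρ (hAh _ _)) (h4 i hi)
  have T6 : ∀ i ≠ 0, ∀ j ≠ 0, Q' (ρ * (ρ * A i j) * pd i (pd j u)) := fun i hi j hj =>
    hV _ _ (hsρ (hsρ (hA _ _))) (hbρ (hsρ (hA _ _))) (h5 i hi j hj)
  refine hcongr _ _ (hadd _ _ (hadd _ _ (hadd _ _ T1 T4) (hadd _ _ T5 (hadd _ _ (T3 1 h12)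
    (T3 2 h22)))) (hadd _ _ (hadd _ _ (hadd _ _ (T2 1 h12) (T2 2 h22))
    (hadd _ _ (T2' 1 h12) (T2' 2 h22))) (hadd _ _ (hadd _ _ (T6 1 h12 1 h12) (T6 1 h12 2 h22))
    (hadd _ _ (T6 2 h22 1 h12) (T6 2 h22 2 h22))))) ?_
  filter_upwards [rad_rad hu, pd_comm hu 0 1, pd_comm hu 0 2, eventually_pos] with y e1 e2 e3 hy
  have eh : ρ y = y 0 * h y := by simp only [hh', Pi.mul_apply]; field_simp
  simp only [degOp, modelOp, Pi.add_apply, Pi.mul_apply, Pi.sub_apply, Pi.smul_apply, Pi.pow_apply,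
    Fin.sum_univ_three, e1, smul_eq_mul]
  simp only [rad, Pi.mul_apply, e2, e3, eh]
  ring

lemma Conormal.remainder {μ : ℕ} (H : AdaptedCoeffs z A B C ρ μ) (hu : Conormal z t u) :
    Conormal z (t + 1) (degOp A B C ρ u - modelOp A ρ μ u) := by
  have hz := H.hz
  refine H.remainder hu.smooth (Q := Conormal z t)
    (fun F G hF hF1 hG => ((hF.conormal.of_bo hz hF1).mul hG).mono (by linarith))
    (fun _ _ => Conormal.add) (fun _ _ => Conormal.congr) hu (hu.radial hz)
    (((hu.radial hz).radial hz).sub (hu.radial hz)) (fun i hi => hu.pd_ne hi)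
    (fun i hi => (hu.pd_ne hi).radial hz) (fun i hi j hj => (hu.pd_ne hj).pd_ne hi)

lemma NormalReg.remainder {μ : ℕ} (H : AdaptedCoeffs z A B C ρ μ) (hu : NormalReg z k u) :
    NormalReg z (k + 1) (degOp A B C ρ u - modelOp A ρ μ u) := by
  have hz := H.hz
  refine H.remainder hu.conormal.smooth (Q := NormalReg z k)
    (fun F G hF hF1 hG => hG.vanishing_mul hz hF hF1)
    (fun _ _ => NormalReg.add) (fun _ _ => NormalReg.congr) hu (hu.radial hz)
    (((hu.radial hz).radial hz).sub (hu.radial hz)) (fun i hi => hu.pderiv hi)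
    (fun i hi => (hu.pderiv hi).radial hz) (fun i hi j hj => (hu.pderiv hj).pderiv hi)

lemma pd_iterate_rad_add {w r : E3 → ℝ} {a : ℝ} (hs : SmoothNear z w)
    (h : rad w + a • w =ᶠ[L z] r) (j : ℕ) :
    SmoothNear z ((pd 0)^[j] w) ∧
      rad ((pd 0)^[j] w) + (a + j) • (pd 0)^[j] w =ᶠ[L z] (pd 0)^[j] r := by
  induction j with
  | zero => simpa using ⟨hs, h⟩
  | succ j ih =>
    simp only [Function.iterate_succ', Function.comp_apply]
    refine ⟨ih.1.pderiv 0, ?_⟩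
    have := pd_rad_add ih.1 0 _ ih.2
    rw [wt_zero] at this
    push_cast
    rwa [add_assoc] at this

lemma NormalReg.iterate {F : E3 → ℝ} {j : ℕ} (h : NormalReg z (j + m) F) :
    NormalReg z m ((pd 0)^[j] F) := by
  induction j generalizing F with
  | zero => simpa using h
  | succ j ih =>
    rw [Function.iterate_succ_apply]
    rw [show j + 1 + m = (j + m) + 1 by ring] at h
    exact ih h.2

lemma Conormal.iterate {F : E3 → ℝ} (h : Conormal z t F) (j : ℕ) :
    Conormal z (t - j) ((pd 0)^[j] F) := by
  induction j with
  | zero => simpa using h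
  | succ j ih =>
    rw [Function.iterate_succ_apply']
    exact ih.pd_zero.mono (by push_cast; linarith)

lemma NormalReg.of_iterate {F : E3 → ℝ} {j : ℕ} (h : NormalReg z j F)
    (h' : NormalReg z m ((pd 0)^[j + 1] F)) : NormalReg z (j + 1 + m) F := by
  induction j generalizing F with
  | zero =>
    rw [show 0 + 1 + m = m + 1 by ring]
    exact ⟨h, h'⟩
  | succ j ih =>
    rw [show j + 1 + 1 + m = (j + 1 + m) + 1 by ring]
    exact ⟨h.1, ih h.2 (by rwa [Function.iterate_succ_apply] at h')⟩

/-- Regularity for the model equation: one more normal derivative. -/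
lemma NormalReg.model_step {μ : ℕ} (hz : z 0 = 0) (hμ : 2 ≤ μ) {r : E3 → ℝ} {ε : ℝ} (hε : 0 < ε)
    (hu : Conormal z μ u)
    (h : rad (rad u) - (2 : ℝ) • rad u - ((μ : ℝ) * (μ - 2)) • u =ᶠ[L z] r)
    (hr : NormalReg z (μ + (m + 1)) r) (hr' : Conormal z (μ + ε) r) :
    NormalReg z (μ + 1 + m) u := by
  have hμ' : (2 : ℝ) ≤ μ := by exact_mod_cast hμ
  -- Factorization `s² - 2s - μ(μ - 2) = (s - μ)(s + μ - 2)` with `s = y₀∂₀`.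
  set v : E3 → ℝ := rad u + ((μ : ℝ) - 2) • u with hv
  have hvc : Conormal z μ v := (hu.radial hz).add (hu.const_smul _)
  have hve : rad v + (-(μ : ℝ)) • v =ᶠ[L z] r := by
    refine EventuallyEq.trans ?_ h
    have h2 := pd_add (hu.radial hz).smooth (hu.const_smul ((μ : ℝ) - 2)).smooth 0
    have h3 := pd_clm (((μ : ℝ) - 2) • ContinuousLinearMap.id ℝ ℝ) hu.smooth 0
    filter_upwards [h2, h3] with y e2 e3
    have e4 : pd 0 v y = pd 0 (rad u) y + (μ - 2) * pd 0 u y := by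
      rw [hv, ← e2, Pi.add_apply]
      exact congrArg₂ (· + ·) rfl e3.symm
    have e5 : rad v y = y 0 * pd 0 v y := rfl
    have e6 : rad (rad u) y = y 0 * pd 0 (rad u) y := rfl
    have e7 : rad u y = y 0 * pd 0 u y := rfl
    have e8 : v y = rad u y + (μ - 2) * u y := rfl
    simp only [Pi.add_apply, Pi.sub_apply, Pi.smul_apply, e5, e6, e4, e8, smul_eq_mul]
    rw [e7]; ring
  have hrμ : NormalReg z (m + 1) ((pd 0)^[μ] r) := hr.iterate
  have hrε : BO z ε ((pd 0)^[μ] r) := by simpa using (hr'.iterate μ).bo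
  have hvμ := (pd_iterate_rad_add hvc.smooth hve μ).2
  have huμ := (pd_iterate_rad_add hu.smooth (EventuallyEq.refl _ v) μ)
  -- After `μ` derivatives the constant in the equation for `v` is `-μ + μ = 0`, and what remains is
  -- `y₀ ∂₀^(μ+1) v = ∂₀^μ r`. The quotient by `y₀` is regular because the right side is `O(y₀^ε)`
  -- in the sense of `BO`; otherwise a logarithm would appear.
  have hdv : NormalReg z m (pd 0 ((pd 0)^[μ] v)) := by
    refine (hrμ.inv_coord_mul hz hε hrε).congr ?_
    filter_upwards [hvμ, eventually_pos] with y h1 h2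
    rw [Pi.mul_apply, ← h1]
    simp only [rad, Pi.add_apply, Pi.mul_apply, neg_add_cancel, zero_smul,
      Pi.zero_apply, add_zero]
    field_simp
  have h5 := pd_rad_add huμ.1 0 _ huμ.2
  have huc : Conormal z (-1) (pd 0 ((pd 0)^[μ] u)) := by
    simpa using (hu.iterate μ).pd_zero
  -- For the other factor the constant is now `(μ - 2) + μ + 1 = 2μ - 1`. It is at least three, so
  -- weight `-1` suffices and no derivative is lost.
  have h6 : NormalReg z m (pd 0 ((pd 0)^[μ] u)) :=
    NormalReg.ode hz h5 huc (by rw [wt_zero]; linarith) hdv (by rw [wt_zero]; linarith)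
  refine hu.normalReg.of_iterate ?_
  rwa [Function.iterate_succ_apply']

/-- Local regularity at the boundary for the semilinear equation. -/
theorem AdaptedCoeffs.smoothGerm {μ : ℕ} (H : AdaptedCoeffs z A B C ρ μ) (hu : Conormal z μ u)
    (hPu : degOp A B C ρ u =ᶠ[L z] φ) (hδ : (μ : ℝ) < δ) (hφ : BO z δ φ) {a : ℕ → E3 → ℝ}
    (ha : ∀ l, SmoothGerm z (a l)) (ha1 : BO z 1 (a 1))
    (hser : ∀ N : ℕ, BO z (N * μ) (φ - ∑ l ∈ Finset.range N, a l * u ^ l)) : SmoothGerm z u := by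
  have hz := H.hz
  have hμ : (2 : ℝ) ≤ μ := by exact_mod_cast H.two_le
  have hα := smoothGerm_normSqGrad H.smooth_A H.smooth_ρ
  obtain ⟨c, hc, hαc⟩ := H.pos
  have hαi := hα.inv hz hc hαc
  have hrem := Conormal.remainder H hu
  have hmod : Conormal z μ (modelOp A ρ μ u) := by
    have := hα.conormal.mul ((((hu.radial hz).radial hz).sub ((hu.radial hz).const_smul 2)).sub
      (hu.const_smul ((μ : ℝ) * (μ - 2))))
    exact this.mono (by simp)
  -- Conormality of the right side is read off from the equation; interpolation with its decay then
  -- raises the weight to `δ`.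
  have hφc : Conormal z μ φ := by
    refine ((hrem.mono (by simp)).add hmod).congr ?_
    filter_upwards [hPu] with y hy
    simp [hy]
  have hφδ := hφc.of_bo hz hφ
  -- The gain over the weight `μ`: `δ - μ` from the nonlinearity, one from the remainder of the
  -- operator.
  set ε := min (δ - μ) 1 with hε
  have hε0 : 0 < ε := lt_min (by linarith) one_pos
  set r := (normSqGrad A ρ)⁻¹ * (φ - (degOp A B C ρ u - modelOp A ρ μ u)) with hr
  have hrc : Conormal z (μ + ε) r := by
    refine (hαi.conormal.mul ((hφδ.mono ?_).sub (hrem.mono ?_))).mono (zero_add _).ge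
    · linarith [min_le_left (δ - μ) 1]
    · linarith [min_le_right (δ - μ) 1]
  have heq : rad (rad u) - (2 : ℝ) • rad u - ((μ : ℝ) * (μ - 2)) • u =ᶠ[L z] r := by
    filter_upwards [hPu, hαc] with y h1 h2
    have h3 : normSqGrad A ρ y ≠ 0 := fun h => by rw [h, abs_zero] at h2; linarith
    rw [hr]
    simp only [Pi.mul_apply, Pi.sub_apply, Pi.inv_apply, ← h1, modelOp, Pi.smul_apply, smul_eq_mul]
    field_simp
    ring
  have hu1 : Conormal z 1 u := hu.mono (by linarith)
  -- Since `μ ≥ 2`, `u` has weight at least one. Every power from the square on is a product of two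
  -- factors that vanish at the boundary and hence gains a normal derivative.
  have hpow : ∀ {k}, NormalReg z k u → ∀ l, NormalReg z (k + 1) (u ^ (l + 2)) ∧
      Conormal z 1 (u ^ (l + 2)) := by
    intro k hk l
    induction l with
    | zero =>
      rw [zero_add, pow_two]
      exact ⟨hk.mul_gain hu1 hk hu1, (hu1.mul hu1).mono (by norm_num)⟩
    | succ l ih =>
      rw [show l + 1 + 2 = (l + 2) + 1 by ring, pow_succ]
      exact ⟨ih.1.pred.mul_gain ih.2 hk hu1, (ih.2.mul hu1).mono (by norm_num)⟩
  have hφk : ∀ {k}, NormalReg z k u → NormalReg z (k + 1) φ := by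
    intro k hk
    have hS : NormalReg z (k + 1) (∑ l ∈ Finset.range (k + 1), a l * u ^ l) := by
      refine NormalReg.sum _ fun l _ => ?_
      match l with
      | 0 => simpa using ha 0 (k + 1)
      | 1 => simpa using NormalReg.vanishing_mul hz (ha 1) ha1 hk
      | l + 2 => exact (ha _ _).mul (hpow hk l).1
    -- The tail starting at `l = k + 1` has weight `(k + 1) μ ≥ k + 1`, enough for `k + 1` normal
    -- derivatives. A finite partial sum therefore suffices at each order.
    have hR : Conormal z (k + 1 : ℕ) (φ - ∑ l ∈ Finset.range (k + 1), a l * u ^ l) := by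
      refine (((hφc.mono (by positivity)).sub hS.conormal).of_bo hz (hser (k + 1))).mono ?_
      have : (0 : ℝ) ≤ (k + 1 : ℕ) := by positivity
      nlinarith
    have := hR.normalReg.add hS
    rwa [sub_add_cancel] at this
  -- Conormality of weight `μ` provides the first `μ` normal derivatives; each round of the model
  -- equation adds one.
  have main : ∀ m, NormalReg z (μ + m) u := by
    intro m
    induction m with
    | zero => exact hu.normalReg
    | succ m ih =>
      have := NormalReg.model_step hz H.two_le hε0 hu heq (m := m)
        ((hαi (μ + m + 1)).mul ((hφk ih).sub (NormalReg.remainder H ih))) hrc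
      rwa [show μ + 1 + m = μ + (m + 1) by ring] at this
  exact fun k => (main k).mono (by omega)

end Bootstrap

/-! ### Smoothness up to the boundary; powers and logarithms of a defining function. -/

section UpToBoundary

variable {z : E3} {F ρ : E3 → ℝ} {V : Type*} [NormedAddCommGroup V] [NormedSpace ℝ V]
  {t c : ℝ} {n : ℕ}

/-- The closed half-space. -/
def closedHalf : Set E3 := {y | 0 ≤ y 0}

lemma convex_closedHalf : Convex ℝ closedHalf :=
  convex_halfSpace_ge (f := fun y : E3 => y 0) ⟨fun _ _ => rfl, fun _ _ => rfl⟩ 0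

lemma convex_openHalf : Convex ℝ openHalf :=
  convex_halfSpace_gt (f := fun y : E3 => y 0) ⟨fun _ _ => rfl, fun _ _ => rfl⟩ 0

lemma openHalf_subset : openHalf ⊆ closedHalf := fun y (h : 0 < y 0) => (h.le : 0 ≤ y 0)

lemma closedHalf_subset_closure {U : Set E3} (hU : IsOpen U) :
    closedHalf ∩ U ⊆ closure (openHalf ∩ U) := by
  rintro y ⟨hy, hyU⟩
  rw [mem_closure_iff_nhdsWithin_neBot, ← mem_closure_iff_nhdsWithin_neBot]
  have h1 : Tendsto (fun τ : ℝ => y + τ • stdVec 0) (𝓝[>] 0) (𝓝 y) := by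
    have : Tendsto (fun τ : ℝ => y + τ • stdVec 0) (𝓝 0) (𝓝 (y + (0:ℝ) • stdVec 0)) :=
      Continuous.tendsto (by fun_prop) 0
    simpa using this.mono_left nhdsWithin_le_nhds
  refine mem_closure_of_tendsto h1 ?_
  filter_upwards [h1.eventually (hU.mem_nhds hyU), self_mem_nhdsWithin] with τ h2 h3
  refine ⟨?_, h2⟩
  have h4 : (0:ℝ) ≤ y 0 := hy
  change 0 < (y + τ • stdVec 0) 0
  rw [coord_add_smul, wt_zero]
  have : (0:ℝ) < τ := h3
  linarith

lemma L_neBot (hz : 0 ≤ z 0) : (L z).NeBot := by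
  have := closedHalf_subset_closure isOpen_univ (⟨hz, mem_univ _⟩ : z ∈ closedHalf ∩ univ)
  rw [inter_univ] at this
  exact mem_closure_iff_nhdsWithin_neBot.1 this

lemma uniqueDiffOn_closedHalf_inter {U : Set E3} (hU : IsOpen U) :
    UniqueDiffOn ℝ (closedHalf ∩ U) := by
  refine UniqueDiffOn.inter (uniqueDiffOn_convex convex_closedHalf ?_) hU
  refine ⟨stdVec 0, interior_maximal openHalf_subset isOpen_openHalf ?_⟩
  simp [openHalf, stdVec]

/-- Functions smooth up to the boundary are germs of the required type. -/
lemma SmoothGerm.of_contDiffOn (hz : z 0 = 0) {F : E3 → V} {U : Set E3} (hU : IsOpen U)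
    (hzU : z ∈ U) (hF : ContDiffOn ℝ ∞ F (closedHalf ∩ U)) : SmoothGerm z F := by
  have hUd := uniqueDiffOn_closedHalf_inter hU
  have hint : ∀ᶠ y in L z, closedHalf ∩ U ∈ 𝓝 y := by
    have h1 : ∀ᶠ y in L z, y ∈ U := nhdsWithin_le_nhds (hU.mem_nhds hzU)
    filter_upwards [h1, eventually_pos] with y h2 h3
    exact inter_mem (mem_of_superset (isOpen_openHalf.mem_nhds h3) openHalf_subset)
      (hU.mem_nhds h2)
  have hb : ∀ {F : E3 → V}, ContDiffOn ℝ ∞ F (closedHalf ∩ U) → SmoothNear z F ∧ BO z 0 F := by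
    intro F hF
    refine ⟨?_, ?_⟩
    · filter_upwards [hint] with y hy using hF.contDiffAt hy
    · have hc : ContinuousWithinAt F (closedHalf ∩ U) z := hF.continuousOn z ⟨hz.ge, hzU⟩
      have h1 : Tendsto F (L z) (𝓝 (F z)) := by
        refine hc.mono_left ?_
        rw [L, nhdsWithin_inter_of_mem' (nhdsWithin_le_nhds (hU.mem_nhds hzU))]
        exact nhdsWithin_mono _ openHalf_subset
      refine BO.of_bounded hz (C := ‖F z‖ + 1) ?_
      exact (h1.norm.eventually (gt_mem_nhds (lt_add_one _))).mono fun _ h => h.le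
  -- The derivative within the closed half-space is again smooth up to the boundary and agrees with
  -- `pd i F` in the interior, so the class is closed under differentiation.
  have hd : ∀ {F : E3 → V} (i : Fin 3), ContDiffOn ℝ ∞ F (closedHalf ∩ U) →
      ∃ G : E3 → V, ContDiffOn ℝ ∞ G (closedHalf ∩ U) ∧ G =ᶠ[L z] pd i F := by
    intro F i hF
    refine ⟨fun y => fderivWithin ℝ F (closedHalf ∩ U) y (stdVec i),
      (hF.fderivWithin hUd (m := ∞) (by simp)).clm_apply contDiffOn_const, ?_⟩
    filter_upwards [hint] with y hy
    simp only [pd, fderivWithin_of_mem_nhds hy]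
  have hcon : ∀ n, ∀ {F : E3 → V}, ContDiffOn ℝ ∞ F (closedHalf ∩ U) → Con z n 0 F := by
    intro n
    induction n with
    | zero => exact fun hF => hb hF
    | succ n ih =>
      intro F hF
      refine ⟨hb hF, fun i => ?_⟩
      obtain ⟨G, hG, hGe⟩ := hd i hF
      exact ((ih hG).mono (by linarith [wt_nonneg i])).congr hGe
  intro k
  induction k generalizing F with
  | zero => exact fun n => hcon n hF
  | succ k ih =>
    obtain ⟨G, hG, hGe⟩ := hd 0 hF
    exact ⟨fun n => hcon n hF, (ih hG).congr hGe⟩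

/-- The normal derivative is `O(y₀^(-1/2))`, which is integrable down to the boundary. Integration
starts at a fixed height `η`, where `F` is bounded. -/
lemma SmoothGerm.bounded (hz : z 0 = 0) (hF : SmoothGerm z F) :
    ∃ C, ∀ᶠ y in L z, |F y| ≤ C := by
  obtain ⟨C₁, hC₁⟩ := hF.conormal.bo (-1 / 2) (by norm_num)
  obtain ⟨C₂, hC₂⟩ := (hF.pderiv 0).conormal.bo (-1 / 2) (by norm_num)
  obtain ⟨r, hr, H⟩ := eventually_L_iff.1 (hF.conormal.smooth.and (hC₁.and hC₂))
  set η := r / 4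
  have hη : 0 < η := by positivity
  refine ⟨C₁ * η ^ (-1 / 2 : ℝ) + 2 * |C₂| * √η, eventually_L_iff.2 ⟨η, hη, fun y hy hy0 => ?_⟩⟩
  have hyη : y 0 < η := (coord_le_dist hz y).trans_lt hy
  have hP0 : ∀ τ, (y + (τ - y 0) • stdVec 0) 0 = τ := fun τ => by
    rw [coord_add_smul, wt_zero]; ring
  have HP : ∀ τ ∈ Icc (y 0) η, _ := fun τ hτ => H (y + (τ - y 0) • stdVec 0) (by
    have h1 : dist (y + (τ - y 0) • stdVec 0) y ≤ η := by
      rw [dist_eq_norm, add_sub_cancel_left, norm_smul, norm_stdVec, mul_one, Real.norm_eq_abs,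
        abs_of_nonneg (by linarith [hτ.1])]
      linarith [hτ.2]
    have h2 := dist_triangle (y + (τ - y 0) • stdVec 0) y z
    have h3 : η = r / 4 := rfl
    linarith) (by rw [hP0]; exact hy0.trans_le hτ.1)
  have hder : ∀ τ ∈ Icc (y 0) η, HasDerivAt (fun τ => F (y + (τ - y 0) • stdVec 0) - F y)
      (pd 0 F (y + (τ - y 0) • stdVec 0)) τ := by
    intro τ hτ
    have h1 := hasDerivAt_line (F := F) (i := 0) (y := y) (τ := τ - y 0)
      ((HP τ hτ).1.differentiableAt (by simp))
    exact (h1.comp_sub_const τ (y 0)).sub_const _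
  have key := image_norm_le_of_norm_deriv_right_le_deriv_boundary' (a := y 0) (b := η)
      (B := fun τ => 2 * |C₂| * (√τ - √(y 0))) (B' := fun τ => |C₂| * τ ^ (-1 / 2 : ℝ))
      (fun τ hτ => (hder τ hτ).continuousAt.continuousWithinAt)
      (fun τ hτ => (hder τ ⟨hτ.1, hτ.2.le⟩).hasDerivWithinAt) (by simp) (by fun_prop)
      (fun τ hτ => by
        have hτ0 := hy0.trans_le hτ.1
        refine HasDerivAt.hasDerivWithinAt ?_
        refine (((Real.hasDerivAt_sqrt hτ0.ne').sub_const _).const_mul (2 * |C₂|)).congr_deriv ?_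
        rw [show (-1 / 2 : ℝ) = -(1 / 2) by norm_num, Real.rpow_neg hτ0.le, ← Real.sqrt_eq_rpow]
        field_simp)
      (fun τ hτ => by
        have h1 := (HP τ ⟨hτ.1, hτ.2.le⟩).2.2
        rw [hP0] at h1
        have := Real.rpow_pos_of_pos (hy0.trans_le hτ.1) (-1 / 2)
        exact h1.trans (by gcongr; exact le_abs_self _)) ⟨hyη.le, le_rfl⟩
  have h1 := (HP η ⟨hyη.le, le_rfl⟩).2.1
  rw [hP0] at h1
  rw [Real.norm_eq_abs] at h1 key
  have h2 : 2 * |C₂| * (√η - √(y 0)) ≤ 2 * |C₂| * √η := by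
    have := Real.sqrt_nonneg (y 0)
    gcongr; linarith
  have h3 := abs_sub_abs_le_abs_sub (F y) (F (y + (η - y 0) • stdVec 0))
  rw [abs_sub_comm] at h3
  linarith

lemma fderiv_eq_sum_pd (y : E3) :
    fderiv ℝ F y = ∑ i, pd i F y • (EuclideanSpace.proj i : E3 →L[ℝ] ℝ) := by
  ext v
  have hv : v = ∑ i, v i • stdVec i := by
    ext j
    simp [Fin.sum_univ_three, stdVec]
    fin_cases j <;> simp
  conv_lhs => rw [hv]
  simp [map_sum, pd, mul_comm]

/-- Germs of smooth functions have Lipschitz extensions. -/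
lemma SmoothGerm.exists_lipschitz (hz : z 0 = 0) (hF : SmoothGerm z F) :
    ∃ r > 0, ∃ K, ∃ g : E3 → ℝ, LipschitzWith K g ∧ ∀ y, dist y z < r → 0 < y 0 → F y = g y := by
  choose C hC using fun i => (hF.pderiv i).bounded hz
  obtain ⟨r, hr, H⟩ := eventually_L_iff.1 (hF.conormal.smooth.and (eventually_all.2 hC))
  have hconv : Convex ℝ (openHalf ∩ Metric.ball z r) := convex_openHalf.inter (convex_ball z r)
  have hlip : LipschitzOnWith (∑ i, (C i).toNNReal) F (openHalf ∩ Metric.ball z r) := by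
    refine hconv.lipschitzOnWith_of_nnnorm_fderiv_le (𝕜 := ℝ)
      (fun y hy => (H y hy.2 hy.1).1.differentiableAt (by simp)) fun y hy => ?_
    rw [fderiv_eq_sum_pd]
    refine (nnnorm_sum_le _ _).trans (Finset.sum_le_sum fun i _ => ?_)
    rw [nnnorm_smul]
    have h1 : ‖(EuclideanSpace.proj i : E3 →L[ℝ] ℝ)‖₊ ≤ 1 := by
      refine ContinuousLinearMap.opNNNorm_le_bound _ _ fun v => ?_
      rw [one_mul]
      exact PiLp.nnnorm_apply_le v i
    have h2 : ‖pd i F y‖₊ ≤ (C i).toNNReal := by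
      rw [← NNReal.coe_le_coe, coe_nnnorm, Real.norm_eq_abs]
      exact ((H y hy.2 hy.1).2 i).trans (Real.le_coe_toNNReal _)
    calc _ ≤ (C i).toNNReal * 1 := mul_le_mul' h2 h1
      _ = _ := mul_one _
  obtain ⟨g, hg, hgF⟩ := hlip.extend_real
  exact ⟨r, hr, _, g, hg, fun y h1 h2 => hgF ⟨h2, h1⟩⟩

lemma eventuallyEq_of_dist_lt {α : Type*} {F G : E3 → α} {r : ℝ}
    (h : ∀ y, dist y z < r → 0 < y 0 → F y = G y)
    {x : E3} (hx : dist x z < r) : F =ᶠ[L x] G := by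
  have : ∀ᶠ y in L x, dist y z < r :=
    nhdsWithin_le_nhds (Metric.isOpen_ball.mem_nhds hx)
  filter_upwards [this, eventually_pos] with y h1 h2 using h y h1 h2

/-- A germ of a smooth function with boundary value zero is `O(y₀)`. -/
lemma SmoothGerm.bo_one (hz : z 0 = 0) (hF : SmoothGerm z F) {r : ℝ} (hr : 0 < r)
    (h : ∀ x : E3, dist x z < r → x 0 = 0 → Tendsto F (L x) (𝓝 0)) : BO z 1 F := by
  obtain ⟨r', hr', K, g, hg, hgF⟩ := hF.exists_lipschitz hz
  have hK : ∀ᶠ y in L z, ‖F y‖ ≤ ‖(K : ℝ) * y 0‖ := by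
    refine eventually_L_iff.2 ⟨min r r' / 2, by positivity, fun y hy hy0 => ?_⟩
    have hyr : dist y z < min r r' := hy.trans (half_lt_self (by positivity))
    -- The foot of the perpendicular from `y`. The Lipschitz extension vanishes there, at distance
    -- `y₀` from `y`.
    set x := y - y 0 • stdVec 0 with hx
    have hx0 : x 0 = 0 := by simp [hx, stdVec]
    have hxy : dist y x = y 0 := by
      rw [dist_eq_norm, hx, sub_sub_cancel, norm_smul, norm_stdVec, mul_one, Real.norm_eq_abs,
        abs_of_pos hy0]
    have hxz : dist x z < min r r' := by
      have h1 := dist_triangle x y z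
      rw [dist_comm x y, hxy] at h1
      have h2 := coord_le_dist hz y
      linarith
    have hgx : g x = 0 := by
      have : (𝓝[openHalf] x).NeBot := L_neBot (z := x) hx0.ge
      refine tendsto_nhds_unique (hg.continuous.tendsto x |>.mono_left nhdsWithin_le_nhds)
        ((h x (hxz.trans_le (min_le_left _ _)) hx0).congr'
          (eventuallyEq_of_dist_lt hgF (hxz.trans_le (min_le_right _ _))))
    have h3 := hg.dist_le_mul y x
    rw [hgx, hxy, dist_zero_right] at h3
    rw [hgF y (hyr.trans_le (min_le_right _ _)) hy0, norm_mul]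
    refine h3.trans (le_of_eq ?_)
    rw [Real.norm_of_nonneg K.coe_nonneg, Real.norm_of_nonneg hy0.le]
  exact (((Conormal.coord hz).const_smul (K : ℝ)).bo).of_le hK

/-! ### Extension to the closed half-space -/

lemma SmoothGerm.exists_tendsto (hz : z 0 = 0) (hF : SmoothGerm z F) :
    ∃ r > 0, ∀ x, dist x z < r →
      Tendsto F (𝓝[openHalf] x) (𝓝 (extendFrom openHalf F x)) := by
  obtain ⟨r, hr, K, g, hg, hgF⟩ := hF.exists_lipschitz hz
  refine ⟨r, hr, fun x hx => tendsto_extendFrom ⟨g x, ?_⟩⟩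
  exact (hg.continuous.tendsto x |>.mono_left nhdsWithin_le_nhds).congr'
    (eventuallyEq_of_dist_lt hgF hx).symm

lemma extendFrom_openHalf_eq {α : Type*} [TopologicalSpace α] [T2Space α] {F : E3 → α} {y : E3}
    (hy : 0 < y 0) (h : ContinuousAt F y) : extendFrom openHalf F y = F y :=
  extendFrom_eq (subset_closure hy) (h.mono_left nhdsWithin_le_nhds)

/-- On a convex open set, a function whose values and differentials have limits at a point of the
closure is differentiable there. The partial derivatives are again smooth germs, which supplies the
limits. -/
lemma SmoothGerm.hasFDerivWithinAt (hz : z 0 = 0) (hF : SmoothGerm z F) :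
    ∃ r > 0, ∀ x ∈ closedHalf ∩ Metric.ball z r, HasFDerivWithinAt (extendFrom openHalf F)
      (∑ i, extendFrom openHalf (pd i F) x • (EuclideanSpace.proj i : E3 →L[ℝ] ℝ))
      closedHalf x := by
  obtain ⟨r₁, hr₁, h1⟩ := hF.exists_tendsto hz
  choose r₂ hr₂ h2 using fun i => (hF.pderiv i).exists_tendsto hz
  obtain ⟨r₃, hr₃, h3⟩ := eventually_L_iff.1 hF.conormal.smooth
  -- The inequalities are strict because points in the closure of the ball are only known to satisfy
  -- `dist ≤ r`.
  obtain ⟨r, hr, hr1, hr3, hr2⟩ : ∃ r > 0, r < r₁ ∧ r < r₃ ∧ ∀ i, r < r₂ i := by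
    have : ∀ᶠ r in 𝓝[>] (0:ℝ), 0 < r ∧ r < r₁ ∧ r < r₃ ∧ ∀ i, r < r₂ i := by
      refine eventually_mem_nhdsWithin.and (Eventually.and ?_ (Eventually.and ?_
        (eventually_all.2 fun i => ?_)))
      exacts [nhdsWithin_le_nhds (gt_mem_nhds hr₁), nhdsWithin_le_nhds (gt_mem_nhds hr₃),
        nhdsWithin_le_nhds (gt_mem_nhds (hr₂ i))]
    exact this.exists
  refine ⟨r, hr, fun x hx => ?_⟩
  set s := openHalf ∩ Metric.ball z r with hs
  have hso : IsOpen s := isOpen_openHalf.inter Metric.isOpen_ball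
  have hFe : ∀ y ∈ s, extendFrom openHalf F =ᶠ[𝓝 y] F := by
    intro y hy
    filter_upwards [hso.mem_nhds hy] with w hw
    exact extendFrom_openHalf_eq hw.1 (h3 w (lt_trans hw.2 hr3) hw.1).continuousAt
  have hdist : ∀ y ∈ closure s, dist y z ≤ r := fun y hy =>
    Metric.closure_ball_subset_closedBall (closure_mono inter_subset_right hy)
  have hxs : x ∈ closure s := closedHalf_subset_closure Metric.isOpen_ball hx
  have key : HasFDerivWithinAt (extendFrom openHalf F)
      (∑ i, extendFrom openHalf (pd i F) x • (EuclideanSpace.proj i : E3 →L[ℝ] ℝ))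
      (closure s) x := by
    refine hasFDerivWithinAt_closure_of_tendsto_fderiv ?_
      (convex_openHalf.inter (convex_ball z r)) hso ?_ ?_
    · intro y hy
      exact ((h3 y (lt_trans hy.2 hr3) hy.1).congr_of_eventuallyEq (hFe y hy)).differentiableAt
        (by simp) |>.differentiableWithinAt
    · intro y hy
      refine Tendsto.congr' ?_ ((h1 y ((hdist y hy).trans_lt hr1)).mono_left
        (nhdsWithin_mono _ inter_subset_left))
      filter_upwards [self_mem_nhdsWithin] with w hw using (hFe w hw).self_of_nhds.symm
    · have : Tendsto (fun y => ∑ i, pd i F y • (EuclideanSpace.proj i : E3 →L[ℝ] ℝ)) (𝓝[s] x)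
          (𝓝 (∑ i, extendFrom openHalf (pd i F) x • (EuclideanSpace.proj i : E3 →L[ℝ] ℝ))) :=
        tendsto_finsetSum _ fun i _ => (((h2 i x (lt_trans hx.2 (hr2 i))).mono_left
          (nhdsWithin_mono _ inter_subset_left)).smul_const _)
      refine this.congr' ?_
      filter_upwards [self_mem_nhdsWithin] with w hw
      rw [(hFe w hw).fderiv_eq, fderiv_eq_sum_pd]
  refine key.mono_of_mem_nhdsWithin ?_
  exact mem_of_superset (inter_mem_nhdsWithin _ (Metric.isOpen_ball.mem_nhds hx.2))
    (closedHalf_subset_closure Metric.isOpen_ball)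

/-- Germs of smooth functions extend smoothly to the closed half-space. -/
lemma SmoothGerm.contDiffWithinAt_extendFrom (hz : z 0 = 0) (hF : SmoothGerm z F) :
    ContDiffWithinAt ℝ ∞ (extendFrom openHalf F) closedHalf z := by
  rw [contDiffWithinAt_infty]
  intro n
  induction n generalizing F with
  | zero =>
    obtain ⟨r, hr, h⟩ := hF.hasFDerivWithinAt hz
    rw [CharP.cast_eq_zero, contDiffWithinAt_zero (show z ∈ closedHalf from hz.ge)]
    refine ⟨Metric.ball z r, nhdsWithin_le_nhds (Metric.ball_mem_nhds z hr), fun x hx => ?_⟩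
    exact (h x hx).continuousWithinAt.mono inter_subset_left
  | succ n ih =>
    obtain ⟨r, hr, h⟩ := hF.hasFDerivWithinAt hz
    push_cast
    rw [contDiffWithinAt_succ_iff_hasFDerivWithinAt (by simp)]
    refine ⟨closedHalf ∩ Metric.ball z r, ?_, by simp, _,
      fun x hx => (h x hx).mono inter_subset_left, ?_⟩
    · rw [insert_eq_of_mem (show z ∈ closedHalf from hz.ge)]
      exact inter_mem_nhdsWithin _ (Metric.ball_mem_nhds z hr)
    · exact (ContDiffWithinAt.sum fun i _ => (ih (hF.pderiv i)).smul contDiffWithinAt_const).mono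
        inter_subset_left

/-! ### Polyhomogeneous functions are conormal -/

/-- A uniform bound on all derivatives is stronger than what `Con` asks; it is used for the
remainders of asymptotic expansions. -/
lemma Con.of_iteratedFDeriv {F : E3 → V} (hs : SmoothNear z F)
    (h : ∀ j ≤ n, BO z c (iteratedFDeriv ℝ j F)) : Con z n c F := by
  have h0 : BO z c F := (h 0 n.zero_le).of_le (Eventually.of_forall fun y => by simp)
  induction n generalizing c F with
  | zero => exact ⟨hs, h0⟩
  | succ n ih =>
    refine ⟨⟨hs, h0⟩, fun i => ?_⟩
    have hle : ∀ j, ∀ᶠ y in L z,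
        ‖iteratedFDeriv ℝ j (pd i F) y‖ ≤ ‖iteratedFDeriv ℝ (j + 1) F y‖ := by
      intro j
      filter_upwards [hs] with y hy
      have hy' : ContDiffAt ℝ j (fderiv ℝ F) y :=
        (hy.fderiv_right (m := ∞) (by simp)).of_le (by exact_mod_cast le_top)
      have h1 := (ContinuousLinearMap.apply ℝ V (stdVec i)).norm_iteratedFDeriv_comp_left hy' le_rfl
      rw [← norm_iteratedFDeriv_fderiv]
      refine h1.trans (mul_le_of_le_one_left (norm_nonneg _) ?_)
      refine ContinuousLinearMap.opNorm_le_bound _ zero_le_one fun T => ?_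
      rw [one_mul]
      refine (T.le_opNorm _).trans ?_
      rw [norm_stdVec, mul_one]
    have hbo : ∀ j ≤ n, BO z (c - wt i) (iteratedFDeriv ℝ j (pd i F)) := fun j hj =>
      ((h (j + 1) (by omega)).of_le (hle j)).mono (by linarith [wt_nonneg i])
    exact ih (hs.pderiv i) hbo ((hbo 0 n.zero_le).of_le (Eventually.of_forall fun y => by simp))

/-- Local properties of a boundary defining function. -/
structure IsLocalDefining (z : E3) (ρ : E3 → ℝ) : Prop where
  hz : z 0 = 0
  smooth : SmoothGerm z ρ
  bo : BO z 1 ρ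
  lower : ∃ c > 0, ∀ᶠ y in L z, c * y 0 ≤ ρ y
  lt_one : ∀ᶠ y in L z, ρ y ≤ 1

lemma IsLocalDefining.pos (H : IsLocalDefining z ρ) : ∀ᶠ y in L z, 0 < ρ y := by
  obtain ⟨c, hc, h⟩ := H.lower
  filter_upwards [h, eventually_pos] with y h1 h2
  exact (mul_pos hc h2).trans_le h1

lemma IsLocalDefining.inv (H : IsLocalDefining z ρ) : Conormal z (-1) ρ⁻¹ := by
  obtain ⟨c, hc, h⟩ := H.lower
  have hh := H.smooth.inv_coord_mul H.hz H.bo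
  have hi := hh.inv H.hz hc (by
    filter_upwards [h, eventually_pos] with y h1 h2
    refine le_trans ?_ (le_abs_self _)
    rw [Pi.mul_apply, inv_mul_eq_div, le_div_iff₀ h2]
    exact h1)
  refine (((Conormal.inv_coord H.hz).mul hi.conormal).mono (by norm_num)).congr ?_
  filter_upwards [eventually_pos] with y h2
  simp only [Pi.mul_apply, Pi.inv_apply]
  field_simp

lemma IsLocalDefining.logDeriv (H : IsLocalDefining z ρ) (i : Fin 3) :
    Conormal z (-wt i) (ρ⁻¹ * pd i ρ) := by
  have h1 : Conormal z 1 ρ := H.smooth.conormal.of_bo H.hz H.bo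
  exact (H.inv.mul (h1.pderiv i)).mono (by linarith)

lemma IsLocalDefining.log (H : IsLocalDefining z ρ) : Conormal z 0 (fun y => Real.log (ρ y)) := by
  have hb : BO z 0 (fun y => Real.log (ρ y)) := by
    intro s hs
    obtain ⟨c, hc, h⟩ := H.lower
    refine ⟨1 / (-s) * c ^ s, ?_⟩
    filter_upwards [h, eventually_pos, H.pos, H.lt_one] with y h1 h2 h3 h4
    have h5 := Real.abs_log_mul_self_rpow_lt (ρ y) (-s) h3 h4 (by linarith)
    rw [abs_mul, abs_of_pos (Real.rpow_pos_of_pos h3 _), Real.rpow_neg h3.le,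
      ← div_eq_mul_inv, div_lt_iff₀ (Real.rpow_pos_of_pos h3 _)] at h5
    rw [Real.norm_eq_abs, mul_assoc, ← Real.mul_rpow hc.le h2.le]
    refine h5.le.trans (mul_le_mul_of_nonneg_left ?_ (by
      have : 0 < -s := by linarith
      positivity))
    exact Real.rpow_le_rpow_of_nonpos (by positivity) h1 hs.le
  have hs : SmoothNear z (fun y => Real.log (ρ y)) := by
    filter_upwards [H.smooth.conormal.smooth, H.pos] with y h1 h2 using h1.log h2.ne'
  rintro (_ | n)
  · exact ⟨hs, hb⟩
  · refine ⟨⟨hs, hb⟩, fun i => Con.congr (by simpa using H.logDeriv i n) ?_⟩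
    filter_upwards [H.smooth.conormal.smooth.differentiable, H.pos] with y h1 h2
    simp [pd, fderiv.log h1 h2.ne']

/-- The logarithmic derivative of `ρ^s` is `s ρ⁻¹ dρ`. The weight is cut off at zero because only a
common lower bound for the terms of an expansion is needed. -/
lemma IsLocalDefining.cpow (H : IsLocalDefining z ρ) (s : ℂ) :
    Conormal z (min s.re 0) (fun y => (ρ y : ℂ) ^ s) := by
  refine Conormal.of_pd_eq_mul
    (h := fun i => (fun _ => s) * fun y => Complex.ofRealCLM ((ρ⁻¹ * pd i ρ) y)) ?_ ?_ ?_ ?_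
  · filter_upwards [H.smooth.conormal.smooth, H.pos] with y h1 h2
    have h3 : ContDiffAt ℝ ∞ (fun y => Complex.exp (((Real.log (ρ y) : ℝ) : ℂ) * s)) y :=
      ((Complex.ofRealCLM.contDiff.contDiffAt.comp y (h1.log h2.ne')).mul contDiffAt_const).cexp
    refine h3.congr_of_eventuallyEq ?_
    filter_upwards [h1.continuousAt.eventually (lt_mem_nhds h2)] with w hw
    rw [Complex.cpow_def_of_ne_zero (by exact_mod_cast hw.ne'), Complex.ofReal_log hw.le]
  · obtain ⟨c, hc, h⟩ := H.lower
    rcases le_total 0 s.re with h0 | h0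
    · rw [min_eq_right h0]
      refine BO.of_bounded H.hz (C := 1) ?_
      filter_upwards [H.pos, H.lt_one] with y h1 h2
      rw [Complex.norm_cpow_eq_rpow_re_of_pos h1]
      exact Real.rpow_le_one h1.le h2 h0
    · rw [min_eq_left h0]
      refine ((Conormal.rpow_coord H.hz s.re).const_smul (c ^ s.re)).bo.of_le ?_
      filter_upwards [H.pos, h, eventually_pos] with y h1 h2 h3
      rw [Complex.norm_cpow_eq_rpow_re_of_pos h1, Pi.smul_apply, smul_eq_mul,
        ← Real.mul_rpow hc.le h3.le]
      refine le_trans ?_ (le_abs_self _)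
      exact Real.rpow_le_rpow_of_nonpos (by positivity) h2 h0
  · intro i
    simpa using (Conormal.const H.hz s).mul ((H.logDeriv i).clm Complex.ofRealCLM)
  · intro i
    filter_upwards [H.smooth.conormal.smooth, H.pos] with y h1 h2
    have hd := h1.differentiableAt (n := ∞) (by simp)
    have e1 : (fun y => (ρ y : ℂ) ^ s) =ᶠ[𝓝 y]
        fun y => Complex.exp (((Real.log (ρ y) : ℝ) : ℂ) * s) := by
      filter_upwards [h1.continuousAt.eventually (lt_mem_nhds h2)] with w hw
      rw [Complex.cpow_def_of_ne_zero (by exact_mod_cast hw.ne'), Complex.ofReal_log hw.le]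
    have e2 : HasFDerivAt (fun y => Complex.exp (((Real.log (ρ y) : ℝ) : ℂ) * s)) _ y :=
      ((Complex.ofRealCLM.hasFDerivAt.comp y (hd.hasFDerivAt.log h2.ne')).mul_const s).cexp
    have e3 := e1.self_of_nhds
    simp only at e3
    simp only [pd, e1.fderiv_eq, e2.fderiv, Pi.mul_apply, e3]
    simp
    ring

end UpToBoundary

/-! ### The defining function and the compactified metric in boundary charts. -/

section Charts

variable {Mbar : Type*} [TopologicalSpace Mbar] [ChartedSpace H3 Mbar]
  [IsManifold (𝓡∂ 3) ∞ Mbar] {V : Type*} [NormedAddCommGroup V] [NormedSpace ℝ V]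

/-- The open set that cuts out the target of the chart at `q` from the closed half-space. -/
def chartOpen (q : Mbar) : Set E3 := (𝓡∂ 3).symm ⁻¹' (chartAt H3 q).target

lemma isOpen_chartOpen (q : Mbar) : IsOpen (chartOpen q) :=
  (chartAt H3 q).open_target.preimage (𝓡∂ 3).continuous_symm

lemma range_model : range (𝓡∂ 3) = closedHalf := range_modelWithCornersEuclideanHalfSpace 3

lemma chart_target (q : Mbar) : (extChartAt (𝓡∂ 3) q).target = closedHalf ∩ chartOpen q := by
  rw [extChartAt_target, range_model, inter_comm]; rfl

lemma interior_closedHalf : interior closedHalf = openHalf := interior_halfSpace _ _ _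

lemma symm_mem_IntM {q : Mbar} {y : E3} (hy : y ∈ closedHalf ∩ chartOpen q) :
    (extChartAt (𝓡∂ 3) q).symm y ∈ IntM Mbar ↔ 0 < y 0 := by
  rw [← chart_target] at hy
  have hs : (extChartAt (𝓡∂ 3) q).symm y ∈ (chartAt H3 q).source := by
    rw [← extChartAt_source (𝓡∂ 3)]; exact (extChartAt (𝓡∂ 3) q).map_target hy
  have h := (𝓡∂ 3).isInteriorPoint_iff_of_mem_atlas (n := ∞) (by simp) (chart_mem_atlas H3 q) hs
  have e1 : (chartAt H3 q).extend (𝓡∂ 3) = extChartAt (𝓡∂ 3) q := rfl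
  rw [e1, (extChartAt (𝓡∂ 3) q).right_inv hy, chart_target, interior_inter,
    (isOpen_chartOpen q).interior_eq, interior_closedHalf] at h
  rw [chart_target] at hy
  exact h.trans ⟨fun h => h.1, fun h => ⟨h, hy.2⟩⟩

lemma symm_mem_Bdry {q : Mbar} {y : E3} (hy : y ∈ closedHalf ∩ chartOpen q) :
    (extChartAt (𝓡∂ 3) q).symm y ∈ Bdry Mbar ↔ y 0 = 0 := by
  rw [Bdry, ← ModelWithCorners.compl_interior, mem_compl_iff]
  have h1 : 0 ≤ y 0 := hy.1
  rw [show (extChartAt (𝓡∂ 3) q).symm y ∈ (𝓡∂ 3).interior Mbar ↔ _ from symm_mem_IntM hy, not_lt]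
  exact ⟨fun h => le_antisymm h h1, fun h => h.le⟩

lemma chart_self_mem (q : Mbar) : extChartAt (𝓡∂ 3) q q ∈ closedHalf ∩ chartOpen q := by
  rw [← chart_target]; exact mem_extChartAt_target q

lemma chart_self_zero {q : Mbar} (hq : q ∈ Bdry Mbar) : extChartAt (𝓡∂ 3) q q 0 = 0 := by
  rw [← symm_mem_Bdry (chart_self_mem q), extChartAt_to_inv]; exact hq

lemma tendsto_chart_symm {q : Mbar} {x : E3} (hx : x ∈ closedHalf ∩ chartOpen q) :
    Tendsto (extChartAt (𝓡∂ 3) q).symm (L x) (𝓝[IntM Mbar] ((extChartAt (𝓡∂ 3) q).symm x)) := by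
  refine tendsto_nhdsWithin_iff.2 ⟨?_, ?_⟩
  · rw [← chart_target] at hx
    exact (continuousAt_extChartAt_symm'' hx).tendsto.mono_left nhdsWithin_le_nhds
  · have h1 : ∀ᶠ y in L x, y ∈ chartOpen q :=
      nhdsWithin_le_nhds ((isOpen_chartOpen q).mem_nhds hx.2)
    filter_upwards [h1, eventually_pos] with y h2 h3
    exact (symm_mem_IntM ⟨h3.le, h2⟩).2 h3

lemma tendsto_chart_symm_self (q : Mbar) :
    Tendsto (extChartAt (𝓡∂ 3) q).symm (L (extChartAt (𝓡∂ 3) q q)) (𝓝[IntM Mbar] q) := by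
  have := tendsto_chart_symm (chart_self_mem q)
  rwa [extChartAt_to_inv] at this

lemma eventually_mem_target (q : Mbar) :
    ∀ᶠ y in L (extChartAt (𝓡∂ 3) q q), y ∈ openHalf ∩ chartOpen q := by
  have h1 : ∀ᶠ y in L (extChartAt (𝓡∂ 3) q q), y ∈ chartOpen q :=
    nhdsWithin_le_nhds ((isOpen_chartOpen q).mem_nhds (chart_self_mem q).2)
  filter_upwards [h1, eventually_pos] with y h2 h3 using ⟨h3, h2⟩

lemma contDiffOn_chart {w : Mbar → V} (hw : ContMDiff (𝓡∂ 3) 𝓘(ℝ, V) ∞ w) (q : Mbar) :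
    ContDiffOn ℝ ∞ (w ∘ (extChartAt (𝓡∂ 3) q).symm) (closedHalf ∩ chartOpen q) := by
  rw [← chart_target, ← contMDiffOn_iff_contDiffOn]
  exact hw.comp_contMDiffOn (contMDiffOn_extChartAt_symm q)

lemma contDiffOn_chart_interior {w : Mbar → V}
    (hw : ContMDiffOn (𝓡∂ 3) 𝓘(ℝ, V) ∞ w (IntM Mbar)) (q : Mbar) :
    ContDiffOn ℝ ∞ (w ∘ (extChartAt (𝓡∂ 3) q).symm) (openHalf ∩ chartOpen q) := by
  rw [← contMDiffOn_iff_contDiffOn]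
  have hsub : openHalf ∩ chartOpen q ⊆ closedHalf ∩ chartOpen q :=
    inter_subset_inter_left _ openHalf_subset
  refine hw.comp ((contMDiffOn_extChartAt_symm q).mono ?_) fun y hy => ?_
  · rwa [chart_target]
  · exact (symm_mem_IntM (hsub hy)).2 hy.1

lemma smoothGerm_chart {w : Mbar → V} (hw : ContMDiff (𝓡∂ 3) 𝓘(ℝ, V) ∞ w) {q : Mbar}
    (hq : q ∈ Bdry Mbar) :
    SmoothGerm (extChartAt (𝓡∂ 3) q q) (w ∘ (extChartAt (𝓡∂ 3) q).symm) :=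
  SmoothGerm.of_contDiffOn (chart_self_zero hq) (isOpen_chartOpen q) (chart_self_mem q).2
    (contDiffOn_chart hw q)

lemma smoothNear_chart {w : Mbar → V} (hw : ContMDiffOn (𝓡∂ 3) 𝓘(ℝ, V) ∞ w (IntM Mbar))
    (q : Mbar) : SmoothNear (extChartAt (𝓡∂ 3) q q) (w ∘ (extChartAt (𝓡∂ 3) q).symm) := by
  filter_upwards [eventually_mem_target q] with y hy
  exact (contDiffOn_chart_interior hw q).contDiffAt
    ((isOpen_openHalf.inter (isOpen_chartOpen q)).mem_nhds hy)

lemma tendsto_of_contDiffOn {z : E3} {F : E3 → V} {U : Set E3} (hU : IsOpen U)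
    (hzU : z ∈ closedHalf ∩ U) (hF : ContDiffOn ℝ ∞ F (closedHalf ∩ U)) :
    Tendsto F (L z) (𝓝 (F z)) := by
  refine (hF.continuousOn z hzU).mono_left ?_
  rw [L, nhdsWithin_inter_of_mem' (nhdsWithin_le_nhds (hU.mem_nhds hzU.2))]
  exact nhdsWithin_mono _ openHalf_subset

lemma tendsto_pd {z : E3} {F : E3 → V} {U : Set E3} (hU : IsOpen U)
    (hzU : z ∈ closedHalf ∩ U) (hF : ContDiffOn ℝ ∞ F (closedHalf ∩ U)) (i : Fin 3) :
    Tendsto (pd i F) (L z) (𝓝 (fderivWithin ℝ F (closedHalf ∩ U) z (stdVec i))) := by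
  have h1 := tendsto_of_contDiffOn hU hzU ((hF.fderivWithin (uniqueDiffOn_closedHalf_inter hU)
    (m := ∞) (by simp)).clm_apply (contDiffOn_const (c := stdVec i)))
  refine h1.congr' ?_
  have h2 : ∀ᶠ y in L z, y ∈ U := nhdsWithin_le_nhds (hU.mem_nhds hzU.2)
  filter_upwards [h2, eventually_pos] with y h2 h3
  have : closedHalf ∩ U ∈ 𝓝 y :=
    inter_mem (mem_of_superset (isOpen_openHalf.mem_nhds h3) openHalf_subset) (hU.mem_nhds h2)
  simp only [pd, fderivWithin_of_mem_nhds this]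

lemma tendsto_zero_of_le_rpow {z : E3} (hz : z 0 = 0) {s C : ℝ}
    (hs : 0 < s) {F : E3 → V}
    (h : ∀ᶠ y in L z, ‖F y‖ ≤ C * y 0 ^ s) : Tendsto F (L z) (𝓝 0) := by
  refine squeeze_zero_norm' h ?_
  have h1 : Tendsto (fun y : E3 => y 0) (L z) (𝓝 0) := by
    have : Tendsto (fun y : E3 => y 0) (𝓝 z) (𝓝 (z 0)) := Continuous.tendsto (by fun_prop) z
    rw [hz] at this
    exact this.mono_left nhdsWithin_le_nhds
  have h2 := (h1.rpow_const (p := s) (Or.inr hs.le)).const_mul C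
  rwa [Real.zero_rpow hs.ne', mul_zero] at h2

lemma BO.tendsto_zero {z : E3} (hz : z 0 = 0) {t : ℝ} (ht : 0 < t) {F : E3 → V}
    (h : BO z t F) : Tendsto F (L z) (𝓝 0) := by
  obtain ⟨C, hC⟩ := h (t / 2) (by linarith)
  exact tendsto_zero_of_le_rpow hz (half_pos ht) hC

/-- A boundary defining function in a chart. -/
lemma IsDefiningFunction.isLocalDefining {ρ : Mbar → ℝ} (hρ : IsDefiningFunction ρ) {q : Mbar}
    (hq : q ∈ Bdry Mbar) :
    IsLocalDefining (extChartAt (𝓡∂ 3) q q) (ρ ∘ (extChartAt (𝓡∂ 3) q).symm) := by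
  set e := extChartAt (𝓡∂ 3) q with he
  set z := e q with hz'
  have hz : z 0 = 0 := chart_self_zero hq
  set R := ρ ∘ e.symm with hR
  have hRd := contDiffOn_chart hρ.smooth q
  have hzU := chart_self_mem q
  have hUo := isOpen_chartOpen q
  have hRs : SmoothGerm z R := smoothGerm_chart hρ.smooth hq
  have hR0 : R z = 0 := by
    simp only [hR, Function.comp_apply, hz', he, extChartAt_to_inv]
    exact (hρ.zero_iff q).2 hq
  have hRnn : ∀ y, 0 ≤ R y := fun y => hρ.nonneg _
  have hb : BO z 1 R := by
    obtain ⟨r, hr, hrU⟩ := Metric.isOpen_iff.1 hUo z hzU.2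
    refine hRs.bo_one hz hr fun x hx hx0 => ?_
    have hxU : x ∈ closedHalf ∩ chartOpen q := ⟨hx0.ge, hrU hx⟩
    have := tendsto_of_contDiffOn hUo hxU hRd
    have hx1 : R x = 0 := (hρ.zero_iff _).2 ((symm_mem_Bdry hxU).2 hx0)
    change Tendsto R (L x) (𝓝 (R x)) at this
    rwa [hx1] at this
  have hL : (L z).NeBot := L_neBot hz.ge
  set T := fderivWithin ℝ R (closedHalf ∩ chartOpen q) z with hT
  have hlim : ∀ i, Tendsto (pd i R) (L z) (𝓝 (T (stdVec i))) := fun i => tendsto_pd hUo hzU hRd i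
  -- Tangential derivatives of `ρ` vanish on the boundary, so `dρ ≠ 0` says that the normal one does
  -- not.
  have hT0 : T (stdVec 0) ≠ 0 := by
    intro h0
    have hTi : ∀ i, T (stdVec i) = 0 := by
      intro i
      by_cases hi : i = 0
      · rw [hi, h0]
      · exact tendsto_nhds_unique (hlim i) ((pd_ne_bo hz hRs hb hi).tendsto_zero hz one_pos)
    have hTz : T = 0 := by
      ext v
      have hv : v = ∑ i, v i • stdVec i := by
        ext j
        simp [Fin.sum_univ_three, stdVec]
        fin_cases j <;> simp
      rw [hv, map_sum]
      simp [hTi]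
    refine hρ.differential_ne_zero q hq ?_
    have hmd : MDifferentiableAt (𝓡∂ 3) 𝓘(ℝ, ℝ) ρ q := hρ.smooth.mdifferentiable (by simp) q
    have e1 : fderivWithin ℝ (writtenInExtChartAt (𝓡∂ 3) 𝓘(ℝ, ℝ) q ρ) (range (𝓡∂ 3)) z = T := by
      rw [range_model, hT, fderivWithin_inter (hUo.mem_nhds hzU.2)]
      rfl
    exact hmd.mfderiv.trans (e1.trans hTz)
  -- The quotient `ρ / y₀` and `∂₀ρ` have the same limit. The quotient shows that this limit is
  -- nonnegative, hence positive, and that `ρ` is bounded below by a multiple of `y₀`.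
  have hquot : Tendsto ((fun y : E3 => (y 0)⁻¹) * R) (L z) (𝓝 (T (stdVec 0))) := by
    have := (hlim 0).sub ((pd_zero_sub_quotient hz hRs hb).tendsto_zero hz one_pos)
    rw [sub_zero] at this
    refine this.congr fun y => ?_
    simp
  have hTpos : 0 < T (stdVec 0) := by
    refine lt_of_le_of_ne (ge_of_tendsto hquot ?_) hT0.symm
    filter_upwards [eventually_pos] with y hy
    exact mul_nonneg (inv_nonneg.2 hy.le) (hRnn y)
  refine ⟨hz, hRs, hb, ⟨T (stdVec 0) / 2, half_pos hTpos, ?_⟩, ?_⟩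
  · filter_upwards [hquot.eventually (lt_mem_nhds (half_lt_self hTpos)), eventually_pos] with y h1 h2
    rw [Pi.mul_apply, inv_mul_eq_div, lt_div_iff₀ h2] at h1
    exact h1.le
  · exact ((hb.tendsto_zero hz one_pos).eventually (gt_mem_nhds one_pos)).mono fun _ h => h.le

/-! ### The metric in a chart -/

/-- The components of a metric in the chart at `q`, up to the boundary. -/
def barComp (gbar : BilinField Mbar) (q : Mbar) (i j : Fin 3) (y : E3) : ℝ :=
  gbar ((extChartAt (𝓡∂ 3) q).symm y)
    (mfderivWithin 𝓘(ℝ, E3) (𝓡∂ 3) (extChartAt (𝓡∂ 3) q).symm (extChartAt (𝓡∂ 3) q).target y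
      (stdVec i))
    (mfderivWithin 𝓘(ℝ, E3) (𝓡∂ 3) (extChartAt (𝓡∂ 3) q).symm (extChartAt (𝓡∂ 3) q).target y
      (stdVec j))

/-- The coordinate frame is the tangent map, within the chart target, of the inverse chart. It is
smooth at boundary points too, and the metric is a smooth bundle section. -/
lemma contDiffOn_barComp (gbar : Bundle.ContMDiffRiemannianMetric (𝓡∂ 3) ∞ E3
      (fun x : Mbar => TangentSpace (𝓡∂ 3) x)) (q : Mbar) (i j : Fin 3) :
    ContDiffOn ℝ ∞ (barComp gbar.inner q i j) (closedHalf ∩ chartOpen q) := by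
  rw [← chart_target, ← contMDiffOn_iff_contDiffOn]
  have hu : UniqueMDiffOn 𝓘(ℝ, E3) (extChartAt (𝓡∂ 3) q).target :=
    (uniqueDiffOn_extChartAt_target q).uniqueMDiffOn
  have hsymm := contMDiffOn_extChartAt_symm (I := 𝓡∂ 3) (n := ∞) q
  have ht := hsymm.contMDiffOn_tangentMapWithin (m := ∞) (by simp) hu
  have hv : ∀ i : Fin 3, ContMDiffOn 𝓘(ℝ, E3) ((𝓡∂ 3).prod 𝓘(ℝ, E3)) ∞
      (fun y : E3 => Bundle.TotalSpace.mk' E3 (E := fun x : Mbar => TangentSpace (𝓡∂ 3) x)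
        ((extChartAt (𝓡∂ 3) q).symm y)
        (mfderivWithin 𝓘(ℝ, E3) (𝓡∂ 3) (extChartAt (𝓡∂ 3) q).symm (extChartAt (𝓡∂ 3) q).target y
          (stdVec i))) (extChartAt (𝓡∂ 3) q).target := by
    intro i
    have hc : ContMDiffOn 𝓘(ℝ, E3) ((𝓘(ℝ, E3)).prod 𝓘(ℝ, E3)) ∞
        (fun y : E3 => (⟨y, stdVec i⟩ : TangentBundle 𝓘(ℝ, E3) E3))
        (extChartAt (𝓡∂ 3) q).target := by
      refine (contMDiffOn_vectorSpace_iff_contDiffOn (V := fun _ => stdVec i)).2 contDiffOn_const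
    exact ht.comp hc fun y hy => hy
  have key : ContMDiffOn 𝓘(ℝ, E3) ((𝓡∂ 3).prod 𝓘(ℝ, ℝ)) ∞
      (fun y : E3 => Bundle.TotalSpace.mk' ℝ (E := Bundle.Trivial Mbar ℝ)
        ((extChartAt (𝓡∂ 3) q).symm y) (barComp gbar.inner q i j y))
      (extChartAt (𝓡∂ 3) q).target := by
    apply ContMDiffOn.clm_bundle_apply₂ (F₁ := E3) (F₂ := E3)
    · exact gbar.contMDiff.comp_contMDiffOn hsymm
    · exact hv i
    · exact hv j
  intro y hy
  have := key y hy
  simp only [Bundle.contMDiffWithinAt_totalSpace] at this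
  exact this.2

end Charts

/-! ### Charts composed with dilations of the half-space. -/

section Scaling

/-- Dilation of the half-space. -/
def dilation (c : ℝ) (hc : 0 < c) : H3 ≃ₜ H3 where
  toFun p := ⟨c • p.1, by simpa using mul_nonneg hc.le p.2⟩
  invFun p := ⟨c⁻¹ • p.1, by simpa using mul_nonneg (inv_pos.2 hc).le p.2⟩
  left_inv p := Subtype.ext (by simp [smul_smul, inv_mul_cancel₀ hc.ne'])
  right_inv p := Subtype.ext (by simp [smul_smul, mul_inv_cancel₀ hc.ne'])
  continuous_toFun := (continuous_subtype_val.const_smul c).subtype_mk _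
  continuous_invFun := (continuous_subtype_val.const_smul c⁻¹).subtype_mk _

/-- The inverse of the model map truncates the normal coordinate at zero, and this commutes with
positive dilations. -/
lemma model_symm_smul {c : ℝ} (hc : 0 < c) (w : E3) :
    ((𝓡∂ 3).symm (c • w)).1 = c • ((𝓡∂ 3).symm w).1 := by
  ext i
  change Function.update (c • w).ofLp 0 (max ((c • w) 0) 0) i =
    c * Function.update w.ofLp 0 (max (w 0) 0) i
  by_cases hi : i = 0
  · subst hi
    simp only [Function.update_self, PiLp.smul_apply, smul_eq_mul]
    rw [mul_max_of_nonneg _ _ hc.le, mul_zero]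
  · simp [Function.update_of_ne hi]

lemma dilation_mem_groupoid (c : ℝ) (hc : 0 < c) :
    (dilation c hc).toOpenPartialHomeomorph ∈ contDiffGroupoid ∞ (𝓡∂ 3) := by
  have key : ∀ c : ℝ, 0 < c → ContDiffOn ℝ ∞ (fun y : E3 => c • y) univ :=
    fun c _ => (contDiff_id.const_smul c).contDiffOn
  rw [contDiffGroupoid, mem_groupoid_of_pregroupoid]
  constructor
  · refine (key c hc).congr_mono (fun x hx => ?_) (subset_univ _)
    have := (𝓡∂ 3).right_inv hx.2
    change c • (𝓡∂ 3) ((𝓡∂ 3).symm x) = _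
    rw [this]
  · refine (key c⁻¹ (inv_pos.2 hc)).congr_mono (fun x hx => ?_) (subset_univ _)
    have := (𝓡∂ 3).right_inv hx.2
    change c⁻¹ • (𝓡∂ 3) ((𝓡∂ 3).symm x) = _
    rw [this]

variable {Mbar : Type*} [TopologicalSpace Mbar] [ChartedSpace H3 Mbar]

/-- The chart at `q`, followed by a dilation. -/
def dilatedChart (q : Mbar) (c : ℝ) (hc : 0 < c) : OpenPartialHomeomorph Mbar H3 :=
  chartAt H3 q ≫ₕ (dilation c hc).toOpenPartialHomeomorph

lemma dilatedChart_source (q : Mbar) (c : ℝ) (hc : 0 < c) :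
    (dilatedChart q c hc).source = (chartAt H3 q).source := by
  simp [dilatedChart]

lemma dilatedChart_extend_apply (q : Mbar) (c : ℝ) (hc : 0 < c) (x : Mbar) :
    (dilatedChart q c hc).extend (𝓡∂ 3) x = c • extChartAt (𝓡∂ 3) q x := rfl

lemma dilatedChart_extend_symm (q : Mbar) (c : ℝ) (hc : 0 < c) :
    ⇑((dilatedChart q c hc).extend (𝓡∂ 3)).symm =
      fun w => (extChartAt (𝓡∂ 3) q).symm (c⁻¹ • w) := by
  funext w
  change (chartAt H3 q).symm ((dilation c hc).symm ((𝓡∂ 3).symm w)) =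
    (chartAt H3 q).symm ((𝓡∂ 3).symm (c⁻¹ • w))
  congr 1
  exact Subtype.ext (model_symm_smul (inv_pos.2 hc) w).symm

/-- A geometric operator has the same polynomials in all these charts, so the dilation factor may be
chosen separately for each point. -/
lemma dilatedChart_mem_maximalAtlas [IsManifold (𝓡∂ 3) ∞ Mbar] (q : Mbar) (c : ℝ) (hc : 0 < c) :
    dilatedChart q c hc ∈ IsManifold.maximalAtlas (𝓡∂ 3) ∞ Mbar := by
  have hh := dilation_mem_groupoid c hc
  rw [IsManifold.maximalAtlas, mem_maximalAtlas_iff]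
  intro e' he'
  have h1 := HasGroupoid.compatible (G := contDiffGroupoid ∞ (𝓡∂ 3)) (chart_mem_atlas H3 q) he'
  have h2 := HasGroupoid.compatible (G := contDiffGroupoid ∞ (𝓡∂ 3)) he' (chart_mem_atlas H3 q)
  constructor
  · have := (contDiffGroupoid ∞ (𝓡∂ 3)).trans ((contDiffGroupoid ∞ (𝓡∂ 3)).symm hh) h1
    rwa [← OpenPartialHomeomorph.trans_assoc, ← OpenPartialHomeomorph.trans_symm_eq_symm_trans_symm] at this
  · have := (contDiffGroupoid ∞ (𝓡∂ 3)).trans h2 hh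
    rwa [OpenPartialHomeomorph.trans_assoc] at this

/-! ### Metric components in dilated charts -/

/-- The pullback of a field of bilinear forms under a parametrization. -/
def pullbackComp (g : BilinField Mbar) (f : E3 → Mbar) (i j : Fin 3) (y : E3) : ℝ :=
  g (f y) (mfderiv 𝓘(ℝ, E3) (𝓡∂ 3) f y (stdVec i)) (mfderiv 𝓘(ℝ, E3) (𝓡∂ 3) f y (stdVec j))

lemma pullbackComp_smul (g : BilinField Mbar) {f : E3 → Mbar} {c : ℝ} {w : E3}
    (hf : MDifferentiableAt 𝓘(ℝ, E3) (𝓡∂ 3) f (c • w)) (i j : Fin 3) :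
    pullbackComp g (fun w => f (c • w)) i j w = c ^ 2 * pullbackComp g f i j (c • w) := by
  have hm : HasMFDerivAt 𝓘(ℝ, E3) 𝓘(ℝ, E3) (fun w : E3 => c • w) w (c • ContinuousLinearMap.id ℝ E3) :=
    ((hasFDerivAt_id w).const_smul c).hasMFDerivAt
  have hd := (HasMFDerivAt.comp w hf.hasMFDerivAt hm).mfderiv
  have hv : ∀ i, mfderiv 𝓘(ℝ, E3) (𝓡∂ 3) (fun w => f (c • w)) w (stdVec i) =
      c • mfderiv 𝓘(ℝ, E3) (𝓡∂ 3) f (c • w) (stdVec i) := by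
    intro i
    change mfderiv 𝓘(ℝ, E3) (𝓡∂ 3) (f ∘ fun w => c • w) w (stdVec i) = _
    rw [hd]
    exact map_smul (mfderiv 𝓘(ℝ, E3) (𝓡∂ 3) f (c • w)) c (stdVec i)
  unfold pullbackComp
  rw [hv i, hv j]
  simp only [map_smul]
  erw [smul_apply]
  simp only [smul_eq_mul]
  ring

lemma metricComp_dilatedChart (g : BilinField Mbar) (q : Mbar) {c : ℝ} (hc : 0 < c) (i j : Fin 3)
    {w : E3} (hf : MDifferentiableAt 𝓘(ℝ, E3) (𝓡∂ 3) (extChartAt (𝓡∂ 3) q).symm (c⁻¹ • w)) :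
    metricComp g (dilatedChart q c hc) i j w =
      (c⁻¹) ^ 2 * pullbackComp g (extChartAt (𝓡∂ 3) q).symm i j (c⁻¹ • w) := by
  change pullbackComp g ((dilatedChart q c hc).extend (𝓡∂ 3)).symm i j w = _
  rw [dilatedChart_extend_symm]
  exact pullbackComp_smul g hf i j

end Scaling

/-! ### Derivatives of `ρ⁻ⁿ F` without negative powers of `ρ`. -/

section Twist

/-- The derivative `ρ ∂ₖ F - n (∂ₖρ) F`, which is `ρ ^ (n + 1) ∂ₖ (ρ ^ (-n) F)`. -/
def twist (n : ℕ) (ρ : E3 → ℝ) (k : Fin 3) (F : E3 → ℝ) : E3 → ℝ :=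
  ρ * pd k F - (n : ℝ) • (pd k ρ * F)

lemma SmoothGerm.twist {z : E3} {ρ F : E3 → ℝ} (hρ : SmoothGerm z ρ) (hF : SmoothGerm z F) (n : ℕ)
    (k : Fin 3) : SmoothGerm z (twist n ρ k F) :=
  (hρ.mul (hF.pderiv k)).sub (((hρ.pderiv k).mul hF).const_smul _)

lemma contDiffOn_pd {F : E3 → ℝ} {U : Set E3} (hU : IsOpen U) (hF : ContDiffOn ℝ ∞ F U)
    (k : Fin 3) : ContDiffOn ℝ ∞ (pd k F) U :=
  (hF.fderiv_of_isOpen (m := ∞) hU (by simp)).clm_apply contDiffOn_const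

lemma contDiffOn_twist {ρ F : E3 → ℝ} {U : Set E3} (hU : IsOpen U)
    (hρ : ContDiffOn ℝ ∞ ρ U) (hF : ContDiffOn ℝ ∞ F U) (n : ℕ) (k : Fin 3) :
    ContDiffOn ℝ ∞ (twist n ρ k F) U :=
  (hρ.mul (contDiffOn_pd hU hF k)).sub
    (contDiffOn_const.mul ((contDiffOn_pd hU hρ k).mul hF) :
      ContDiffOn ℝ ∞ (fun y => (n : ℝ) * (pd k ρ y * F y)) U)

lemma pd_inv_pow_mul {ρ F : E3 → ℝ} {y : E3} (hρ : DifferentiableAt ℝ ρ y)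
    (hF : DifferentiableAt ℝ F y) (h0 : ρ y ≠ 0) (n : ℕ) (k : Fin 3) :
    pd k (fun y => (ρ y)⁻¹ ^ n * F y) y = (ρ y)⁻¹ ^ (n + 1) * twist n ρ k F y := by
  have h1 : HasDerivAt (fun x : ℝ => x⁻¹ ^ n) (n * (ρ y)⁻¹ ^ (n - 1) * -((ρ y) ^ 2)⁻¹) (ρ y) :=
    (hasDerivAt_inv h0).fun_pow n
  have h2 := (h1.comp_hasFDerivAt y hρ.hasFDerivAt).mul hF.hasFDerivAt
  have h3 := h2.fderiv
  simp only [pd, twist]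
  change fderiv ℝ ((((fun x : ℝ => x⁻¹ ^ n) ∘ ρ) * F)) y (stdVec k) = _
  rw [h3]
  simp only [FunLike.coe_add, FunLike.coe_smul, Pi.add_apply, Pi.smul_apply, smul_eq_mul, Pi.mul_apply, Pi.sub_apply, pd,
    Function.comp_apply]
  rcases n with _ | n
  · simp; field_simp
  · obtain ⟨r, hr⟩ : ∃ r, r = (ρ y)⁻¹ := ⟨_, rfl⟩
    have h4 : r * ρ y = 1 := by rw [hr, inv_mul_cancel₀ h0]
    simp only [Nat.add_sub_cancel, ← inv_pow, ← hr]
    push_cast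
    linear_combination (-r ^ (n + 1) * fderiv ℝ F y (stdVec k)) * h4

lemma pd_const_mul_comp_smul (a s : ℝ) (F : E3 → ℝ) (k : Fin 3) (w : E3) :
    pd k (fun w => a * F (s • w)) w = a * s * pd k F (s • w) := by
  have h1 : fderiv ℝ (fun w => F (s • w)) w = s • fderiv ℝ F (s • w) := fderiv_comp_smul s
  have h2 : fderiv ℝ (fun w => a * F (s • w)) w = a • fderiv ℝ (fun w => F (s • w)) w :=
    congrFun (fderiv_const_smul_field (f := fun w => F (s • w)) a) w
  simp only [pd, h2, h1, FunLike.coe_smul, Pi.smul_apply, smul_eq_mul, mul_assoc]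

end Twist

/-! ### Positivity of the metric determinant up to the boundary. -/

section Metric

lemma bilinear_apply_sum (T : E3 →L[ℝ] E3) (B : E3 →L[ℝ] E3 →L[ℝ] ℝ) (v : Fin 3 → ℝ) :
    star v ⬝ᵥ (Matrix.of fun i j => B (T (stdVec i)) (T (stdVec j))).mulVec v =
      B (T (∑ i, v i • stdVec i)) (T (∑ i, v i • stdVec i)) := by
  simp only [map_sum, map_smul, sum_apply, smul_apply, dotProduct, Matrix.mulVec, Matrix.of_apply,
    star_trivial, Finset.mul_sum, smul_eq_mul]
  rw [Finset.sum_comm]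
  exact Finset.sum_congr rfl fun i _ => Finset.sum_congr rfl fun j _ => by ring

variable {Mbar : Type*} [TopologicalSpace Mbar] [ChartedSpace H3 Mbar]
  [IsManifold (𝓡∂ 3) ∞ Mbar]

/-- The image of the interior in the chart at `q`. -/
def chartInt (q : Mbar) : Set E3 := openHalf ∩ chartOpen q

lemma isOpen_chartInt (q : Mbar) : IsOpen (chartInt q) := isOpen_openHalf.inter (isOpen_chartOpen q)

lemma chartInt_subset (q : Mbar) : chartInt q ⊆ closedHalf ∩ chartOpen q :=
  inter_subset_inter_left _ openHalf_subset

lemma chartInt_subset_target (q : Mbar) : chartInt q ⊆ (extChartAt (𝓡∂ 3) q).target := by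
  rw [chart_target]; exact chartInt_subset q

lemma target_mem_nhds {q : Mbar} {y : E3} (hy : y ∈ chartInt q) :
    (extChartAt (𝓡∂ 3) q).target ∈ 𝓝 y :=
  mem_of_superset ((isOpen_chartInt q).mem_nhds hy) (chartInt_subset_target q)

lemma mdifferentiableAt_chart_symm {q : Mbar} {y : E3} (hy : y ∈ chartInt q) :
    MDifferentiableAt 𝓘(ℝ, E3) (𝓡∂ 3) (extChartAt (𝓡∂ 3) q).symm y :=
  ((contMDiffOn_extChartAt_symm (n := ∞) q).contMDiffAt (target_mem_nhds hy)).mdifferentiableAt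
    (by simp)

lemma barComp_eq_pullbackComp (gbar : BilinField Mbar) {q : Mbar} {y : E3} (hy : y ∈ chartInt q)
    (i j : Fin 3) :
    barComp gbar q i j y = pullbackComp gbar (extChartAt (𝓡∂ 3) q).symm i j y := by
  simp only [barComp, pullbackComp, mfderivWithin_of_mem_nhds (target_mem_nhds hy)]

variable (gbar : Bundle.ContMDiffRiemannianMetric (𝓡∂ 3) ∞ E3
      (fun x : Mbar => TangentSpace (𝓡∂ 3) x))

lemma barComp_symm (q : Mbar) (i j : Fin 3) (y : E3) :
    barComp gbar.inner q i j y = barComp gbar.inner q j i y := gbar.symm _ _ _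

lemma mfderivWithin_symm_injective (q : Mbar) {y : E3} (hy : y ∈ (extChartAt (𝓡∂ 3) q).target) :
    Function.Injective (mfderivWithin 𝓘(ℝ, E3) (𝓡∂ 3) (extChartAt (𝓡∂ 3) q).symm
      (extChartAt (𝓡∂ 3) q).target y) := by
  have h := isInvertible_mfderivWithin_extChartAt_symm hy
  rw [← mfderivWithin_congr_set (extChartAt_target_eventuallyEq_of_mem hy)] at h
  exact h.injective

lemma det_barComp_pos (q : Mbar) {y : E3} (hy : y ∈ (extChartAt (𝓡∂ 3) q).target) :
    0 < (Matrix.of fun i j => barComp gbar.inner q i j y).det := by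
  refine Matrix.PosDef.det_pos (Matrix.PosDef.of_dotProduct_mulVec_pos ?_ fun v hv => ?_)
  · ext i j
    simp [Matrix.conjTranspose_apply, barComp_symm gbar q j i]
  · set T := mfderivWithin 𝓘(ℝ, E3) (𝓡∂ 3) (extChartAt (𝓡∂ 3) q).symm
      (extChartAt (𝓡∂ 3) q).target y with hT
    have hV : (∑ i, v i • stdVec i : E3) ≠ 0 := by
      contrapose! hv
      ext j
      have := congrArg (fun w : E3 => w j) hv
      simpa [stdVec, Pi.single_apply, Finset.sum_apply] using this
    have hTV : T (∑ i, v i • stdVec i) ≠ 0 := fun h0 =>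
      hV (mfderivWithin_symm_injective q hy (h0.trans (map_zero T).symm))
    have hp := gbar.pos _ _ hTV
    exact hp.trans_eq (bilinear_apply_sum T (gbar.inner _) v).symm

end Metric

/-! ### Rescaled metric jets and the coefficients they determine. -/

section Jets

/-- The values of the jet variables of the metric `ρ⁻² b` in coordinates dilated by `ρ⁻¹`. -/
def jetFun (ρ : E3 → ℝ) (b : Fin 3 → Fin 3 → E3 → ℝ) : JetVar → E3 → ℝ
  | .metric i j => b i j
  | .deriv k i j => twist 2 ρ k (b i j)
  | .deriv₂ k l i j => twist 3 ρ k (twist 2 ρ l (b i j))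
  | .invSqrtDet => (fun y => √(Matrix.of fun i j => b i j y).det)⁻¹

/-- The value of a universal polynomial on the dilated jet. -/
def coeffFun (ρ : E3 → ℝ) (b : Fin 3 → Fin 3 → E3 → ℝ) (p : MvPolynomial JetVar ℝ) (y : E3) : ℝ :=
  MvPolynomial.eval (fun v => jetFun ρ b v y) p

variable {z : E3} {ρ : E3 → ℝ} {b : Fin 3 → Fin 3 → E3 → ℝ}

lemma smoothGerm_det (hb : ∀ i j, SmoothGerm z (b i j)) :
    SmoothGerm z (fun y => (Matrix.of fun i j => b i j y).det) := by
  have : (fun y => (Matrix.of fun i j => b i j y).det) =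
      b 0 0 * b 1 1 * b 2 2 - b 0 0 * b 1 2 * b 2 1 - b 0 1 * b 1 0 * b 2 2 +
        b 0 1 * b 1 2 * b 2 0 + b 0 2 * b 1 0 * b 2 1 - b 0 2 * b 1 1 * b 2 0 := by
    funext y
    simp [Matrix.det_fin_three]
  rw [this]
  have h3 : ∀ i j k l m n, SmoothGerm z (b i j * b k l * b m n) := fun i j k l m n =>
    ((hb i j).mul (hb k l)).mul (hb m n)
  exact (((((h3 _ _ _ _ _ _).sub (h3 _ _ _ _ _ _)).sub (h3 _ _ _ _ _ _)).add (h3 _ _ _ _ _ _)).add (h3 _ _ _ _ _ _)).sub (h3 _ _ _ _ _ _)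

/-- All negative powers of `ρ` have been scaled away in `jetFun`, and the determinant is bounded
below. -/
lemma smoothGerm_jetFun (hz : z 0 = 0) (hρ : SmoothGerm z ρ) (hb : ∀ i j, SmoothGerm z (b i j))
    {c : ℝ} (hc : 0 < c) (hdet : ∀ᶠ y in L z, c ≤ (Matrix.of fun i j => b i j y).det)
    (v : JetVar) : SmoothGerm z (jetFun ρ b v) := by
  cases v with
  | metric i j => exact hb i j
  | deriv k i j => exact hρ.twist (hb i j) 2 k
  | deriv₂ k l i j => exact hρ.twist (hρ.twist (hb i j) 2 l) 3 k
  | invSqrtDet =>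
    refine ((smoothGerm_det hb).sqrt hz hc hdet).inv hz (Real.sqrt_pos.2 hc) ?_
    filter_upwards [hdet] with y hy
    exact (Real.sqrt_le_sqrt hy).trans (le_abs_self _)

lemma smoothGerm_coeffFun (hz : z 0 = 0) (h : ∀ v, SmoothGerm z (jetFun ρ b v))
    (p : MvPolynomial JetVar ℝ) : SmoothGerm z (coeffFun ρ b p) := by
  induction p using MvPolynomial.induction_on with
  | C a =>
    have : coeffFun ρ b (MvPolynomial.C a) = fun _ => a := by funext y; simp [coeffFun]
    rw [this]; exact SmoothGerm.const hz a
  | add p q hp hq =>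
    have : coeffFun ρ b (p + q) = coeffFun ρ b p + coeffFun ρ b q := by
      funext y; simp [coeffFun]
    rw [this]; exact hp.add hq
  | mul_X p v hp =>
    have : coeffFun ρ b (p * MvPolynomial.X v) = coeffFun ρ b p * jetFun ρ b v := by
      funext y; simp [coeffFun]
    rw [this]; exact hp.mul (h v)

end Jets

/-! ### The geometric operator as a uniformly degenerate operator. -/

section Formula

variable {Mbar : Type*} [TopologicalSpace Mbar] [ChartedSpace H3 Mbar]
  [IsManifold (𝓡∂ 3) ∞ Mbar]

/-- A function read in the chart at `q`. -/
abbrev inChart {V : Type*} (q : Mbar) (w : Mbar → V) : E3 → V := w ∘ (extChartAt (𝓡∂ 3) q).symm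

lemma IsDefiningFunction.pos {ρ : Mbar → ℝ} (hρ : IsDefiningFunction ρ) {x : Mbar}
    (hx : x ∈ IntM Mbar) : 0 < ρ x := by
  refine lt_of_le_of_ne (hρ.nonneg x) fun h => ?_
  have := (hρ.zero_iff x).1 h.symm
  rw [Bdry, ← ModelWithCorners.compl_interior] at this
  exact this hx

lemma symm_mem_interior {q : Mbar} {y : E3} (hy : y ∈ chartInt q) :
    (extChartAt (𝓡∂ 3) q).symm y ∈ IntM Mbar :=
  (symm_mem_IntM (chartInt_subset q hy)).2 hy.1

variable {ρ : Mbar → ℝ} {g : BilinField Mbar}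
  {gbar : Bundle.ContMDiffRiemannianMetric (𝓡∂ 3) ∞ E3 (fun x : Mbar => TangentSpace (𝓡∂ 3) x)}

lemma pullbackComp_eq (hρ : IsDefiningFunction ρ)
    (hg : ∀ x ∈ IntM Mbar, ∀ v w : TangentSpace (𝓡∂ 3) x,
      gbar.inner x v w = ρ x ^ 2 * g x v w) (q : Mbar) {y : E3} (hy : y ∈ chartInt q)
    (i j : Fin 3) :
    pullbackComp g (extChartAt (𝓡∂ 3) q).symm i j y =
      (inChart q ρ y)⁻¹ ^ 2 * barComp gbar.inner q i j y := by
  have h0 : ρ ((extChartAt (𝓡∂ 3) q).symm y) ≠ 0 := (hρ.pos (symm_mem_interior hy)).ne'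
  rw [barComp_eq_pullbackComp _ hy, pullbackComp, pullbackComp, hg _ (symm_mem_interior hy),
    ← mul_assoc, ← mul_pow, show (inChart q ρ y)⁻¹ * ρ _ = 1 from inv_mul_cancel₀ h0, one_pow,
    one_mul]

/-- A `k`-th derivative of the components of `ρ⁻² b` carries the factor `ρ^(-k-2)`, and dilation by
`c` multiplies it by `c^(-k-2)`. For `c = 1/ρ(y)` the two cancel. The factor `c` is constant during
differentiation, so the identity is for the single point `y`. -/
lemma jetVal_dilatedChart (hρ : IsDefiningFunction ρ)
    (hg : ∀ x ∈ IntM Mbar, ∀ v w : TangentSpace (𝓡∂ 3) x,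
      gbar.inner x v w = ρ x ^ 2 * g x v w) (q : Mbar) {y : E3} (hy : y ∈ chartInt q)
    {c : ℝ} (hc : 0 < c) (hcR : c⁻¹ = inChart q ρ y) (v : JetVar) :
    jetVal g (dilatedChart q c hc) (c • y) v =
      jetFun (inChart q ρ) (barComp gbar.inner q) v y := by
  set R := inChart q ρ with hR
  set b := barComp gbar.inner q with hb
  have hRy : 0 < R y := hρ.pos (symm_mem_interior hy)
  have hR0 : ∀ y ∈ chartInt q, R y ≠ 0 := fun y hy => (hρ.pos (symm_mem_interior hy)).ne'
  have hUo := isOpen_chartInt q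
  have hRs : ContDiffOn ℝ ∞ R (chartInt q) := (contDiffOn_chart hρ.smooth q).mono (chartInt_subset q)
  have hbs : ∀ i j, ContDiffOn ℝ ∞ (b i j) (chartInt q) := fun i j =>
    (contDiffOn_barComp gbar q i j).mono (chartInt_subset q)
  have hd : ∀ {F : E3 → ℝ}, ContDiffOn ℝ ∞ F (chartInt q) → ∀ y ∈ chartInt q,
      DifferentiableAt ℝ F y := fun hF y hy =>
    (hF.contDiffAt (hUo.mem_nhds hy)).differentiableAt (by simp)
  have hcy : c⁻¹ • c • y = y := by rw [smul_smul, inv_mul_cancel₀ hc.ne', one_smul]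
  have e0 : ∀ i j, ∀ w, c⁻¹ • w ∈ chartInt q →
      metricComp g (dilatedChart q c hc) i j w =
        (c⁻¹) ^ 2 * (fun y => (R y)⁻¹ ^ 2 * b i j y) (c⁻¹ • w) := fun i j w hw => by
    rw [metricComp_dilatedChart g q hc i j (mdifferentiableAt_chart_symm hw),
      pullbackComp_eq hρ hg q hw]
  have hopen : IsOpen ((fun w : E3 => c⁻¹ • w) ⁻¹' chartInt q) :=
    hUo.preimage (continuous_const_smul _)
  have hpdcongr : ∀ {F G : E3 → ℝ} {U : Set E3}, IsOpen U → (∀ w ∈ U, F w = G w) →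
      ∀ k, ∀ w ∈ U, pd k F w = pd k G w := by
    intro F G U hU h k w hw
    have : F =ᶠ[𝓝 w] G := mem_of_superset (hU.mem_nhds hw) h
    rw [pd, this.fderiv_eq, pd]
  have e1 : ∀ l i j, ∀ w, c⁻¹ • w ∈ chartInt q →
      partialD l (metricComp g (dilatedChart q c hc) i j) w =
        (c⁻¹) ^ 3 * (fun y => (R y)⁻¹ ^ 3 * twist 2 R l (b i j) y) (c⁻¹ • w) := fun l i j w hw => by
    rw [partialD_eq_pd, hpdcongr hopen (e0 i j) l w hw,
      pd_const_mul_comp_smul _ _ (fun y => (R y)⁻¹ ^ 2 * b i j y),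
      pd_inv_pow_mul (hd hRs _ hw) (hd (hbs i j) _ hw) (hR0 _ hw)]
    ring
  have e2 : ∀ k l i j, ∀ w, c⁻¹ • w ∈ chartInt q →
      partialD k (partialD l (metricComp g (dilatedChart q c hc) i j)) w =
        (c⁻¹) ^ 4 * ((R (c⁻¹ • w))⁻¹ ^ 4 * twist 3 R k (twist 2 R l (b i j)) (c⁻¹ • w)) :=
    fun k l i j w hw => by
    rw [partialD_eq_pd k, hpdcongr hopen (e1 l i j) k w hw,
      pd_const_mul_comp_smul _ _ (fun y => (R y)⁻¹ ^ 3 * twist 2 R l (b i j) y),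
      pd_inv_pow_mul (hd hRs _ hw) (hd (contDiffOn_twist hUo hRs (hbs i j) 2 l) _ hw) (hR0 _ hw)]
    ring
  have hw : c⁻¹ • c • y ∈ chartInt q := by rwa [hcy]
  have hcan : ∀ n (t : ℝ), (c⁻¹) ^ n * ((R y)⁻¹ ^ n * t) = t := fun n t => by
    rw [hcR, ← mul_assoc, ← mul_pow, mul_inv_cancel₀ hRy.ne', one_pow, one_mul]
  have e0' : ∀ i j, metricComp g (dilatedChart q c hc) i j (c • y) = b i j y := fun i j => by
    rw [e0 i j _ hw]; simp only [hcy, hcan]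
  cases v with
  | metric i j => exact e0' i j
  | deriv k i j => simp only [jetVal, jetFun, e1 k i j _ hw, hcy, hcan]
  | deriv₂ k l i j => simp only [jetVal, jetFun, e2 k l i j _ hw, hcy, hcan]
  | invSqrtDet => simp only [jetVal, jetFun, metricDet, e0', Pi.inv_apply]

/-- In the chart dilated by `1/ρ(y)`, each derivative of `u` produces a factor `ρ(y)`. This is the
source of the powers of `ρ` in `degOp`. -/
lemma Represents.eq_degOp (hρ : IsDefiningFunction ρ)
    (hg : ∀ x ∈ IntM Mbar, ∀ v w : TangentSpace (𝓡∂ 3) x,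
      gbar.inner x v w = ρ x ^ 2 * g x v w) {P : (Mbar → ℝ) → Mbar → ℝ} {Q : GeometricCoeffs}
    (hP : Represents g P Q) {u : Mbar → ℝ} (hu : ContMDiffOn (𝓡∂ 3) 𝓘(ℝ, ℝ) ∞ u (IntM Mbar))
    (q : Mbar) {y : E3} (hy : y ∈ chartInt q) :
    P u ((extChartAt (𝓡∂ 3) q).symm y) =
      degOp (fun i j => coeffFun (inChart q ρ) (barComp gbar.inner q) (Q.a i j))
        (fun i => coeffFun (inChart q ρ) (barComp gbar.inner q) (Q.b i))
        (coeffFun (inChart q ρ) (barComp gbar.inner q) Q.c) (inChart q ρ) (inChart q u) y := by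
  set R := inChart q ρ with hR
  have hRy : 0 < R y := hρ.pos (symm_mem_interior hy)
  obtain ⟨c, hcR⟩ : ∃ c : ℝ, c⁻¹ = R y := ⟨(R y)⁻¹, inv_inv _⟩
  have hc : 0 < c := inv_pos.1 (hcR.symm ▸ hRy)
  have hyt := chartInt_subset_target q hy
  have hmem : (extChartAt (𝓡∂ 3) q).symm y ∈ (dilatedChart q c hc).source ∩ IntM Mbar := by
    refine ⟨?_, symm_mem_interior hy⟩
    rw [dilatedChart_source, ← extChartAt_source (𝓡∂ 3)]
    exact (extChartAt (𝓡∂ 3) q).map_target hyt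
  have e := hP _ (dilatedChart_mem_maximalAtlas q _ hc) u hu _ hmem
  rw [dilatedChart_extend_apply, (extChartAt (𝓡∂ 3) q).right_inv hyt,
    dilatedChart_extend_symm] at e
  have hj := funext (jetVal_dilatedChart hρ hg q hy hc hcR)
  have hcy : c⁻¹ • c • y = y := by rw [smul_smul, inv_mul_cancel₀ hc.ne', one_smul]
  have d1 : ∀ i, partialD i (u ∘ fun w => (extChartAt (𝓡∂ 3) q).symm (c⁻¹ • w)) =
      fun w => c⁻¹ * pd i (inChart q u) (c⁻¹ • w) := fun i => by
    funext w
    have := pd_const_mul_comp_smul 1 c⁻¹ (inChart q u) i w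
    simp only [one_mul] at this
    exact this
  have d2 : ∀ i j, partialD i (partialD j (u ∘ fun w =>
      (extChartAt (𝓡∂ 3) q).symm (c⁻¹ • w))) =
      fun w => c⁻¹ * c⁻¹ * pd i (pd j (inChart q u)) (c⁻¹ • w) := fun i j => by
    funext w
    rw [d1 j, partialD_eq_pd, pd_const_mul_comp_smul]
  rw [hj] at e
  simp only [d2] at e
  simp only [d1, hcy] at e
  simp only [hcR] at e
  rw [e]
  simp only [degOp, Pi.add_apply, Finset.sum_apply, Pi.mul_apply, coeffFun,
    mul_assoc, sq]
  rfl

end Formula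

/-! ### Formally self-adjoint second-order operators on open sets of Euclidean space. -/

section SelfAdjoint

/-- A second-order differential operator on functions of three variables. -/
def secondOrderOp (a : Fin 3 → Fin 3 → E3 → ℝ) (b : Fin 3 → E3 → ℝ) (c v : E3 → ℝ) : E3 → ℝ :=
  ∑ i, ∑ j, a i j * pd i (pd j v) + ∑ i, b i * pd i v + c * v

/-- Smooth functions with compact support in `U`. -/
structure IsTestFunction (U : Set E3) (η : E3 → ℝ) : Prop where
  smooth : ContDiff ℝ ∞ η
  compact : HasCompactSupport η
  subset : tsupport η ⊆ U

variable {U : Set E3} {η w : E3 → ℝ} {a : Fin 3 → Fin 3 → E3 → ℝ} {b : Fin 3 → E3 → ℝ}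
  {c : E3 → ℝ}

lemma contDiff_pd {F : E3 → ℝ} (hF : ContDiff ℝ ∞ F) (i : Fin 3) : ContDiff ℝ ∞ (pd i F) := by
  rw [← contDiffOn_univ] at *
  exact contDiffOn_pd isOpen_univ hF i

lemma tsupport_pd_subset (F : E3 → ℝ) (i : Fin 3) : tsupport (pd i F) ⊆ tsupport F :=
  (tsupport_comp_subset (g := fun T : E3 →L[ℝ] ℝ => T (stdVec i)) (by simp) (fderiv ℝ F)).trans
    (tsupport_fderiv_subset ℝ)

lemma IsTestFunction.pderiv (h : IsTestFunction U η) (i : Fin 3) : IsTestFunction U (pd i η) :=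
  ⟨contDiff_pd h.smooth i, h.compact.of_isClosed_subset (isClosed_tsupport _)
    (tsupport_pd_subset η i), (tsupport_pd_subset η i).trans h.subset⟩

lemma IsTestFunction.mul (h : IsTestFunction U η) {F : E3 → ℝ} (hF : ContDiff ℝ ∞ F) :
    IsTestFunction U (F * η) :=
  ⟨hF.mul h.smooth, h.compact.mul_left, (tsupport_mul_subset_right).trans h.subset⟩

lemma IsTestFunction.integrable (h : IsTestFunction U η) {F : E3 → ℝ} (hF : ContinuousOn F U) :
    Integrable (F * η) := by
  have h1 : IntegrableOn (F * η) (tsupport η) :=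
    ((hF.mono h.subset).mul h.smooth.continuous.continuousOn).integrableOn_compact h.compact
  refine (integrableOn_iff_integrable_of_support_subset ?_).1 h1
  exact (Function.support_mul_subset_right _ _).trans (subset_tsupport _)

lemma IsTestFunction.integral_by_parts (hU : IsOpen U) (h : IsTestFunction U η) {F : E3 → ℝ}
    (hF : ContDiffOn ℝ ∞ F U) (j : Fin 3) : ∫ y, (F * pd j η) y = -∫ y, (pd j F * η) y := by
  refine integral_mul_fderiv_eq_neg_fderiv_mul_of_integrable
    (h.integrable (contDiffOn_pd hU hF j).continuousOn)
    ((h.pderiv j).integrable hF.continuousOn) (h.integrable hF.continuousOn)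
    (fun x hx => (hF.contDiffAt (hU.mem_nhds (h.subset hx))).differentiableAt (by simp))
    fun x _ => h.smooth.differentiable (by simp) x

lemma IsTestFunction.exists_cutoff (hU : IsOpen U) (h : IsTestFunction U η) :
    ∃ χ, IsTestFunction U χ ∧ ∀ᶠ y in 𝓝ˢ (tsupport η), χ y = 1 := by
  obtain ⟨K, hK, hηK, hKU⟩ := exists_compact_between h.compact hU h.subset
  obtain ⟨f, h1, h0, -⟩ := exists_contMDiffMap_one_nhds_of_subset_interior (n := ⊤) 𝓘(ℝ, E3)
    (isClosed_tsupport η) hηK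
  have hs : tsupport f ⊆ K := closure_minimal (fun x hx => by_contra fun hxK => hx (h0 x hxK))
    hK.isClosed
  exact ⟨f, ⟨f.contMDiff.contDiff, hK.of_isClosed_subset (isClosed_tsupport _) hs, hs.trans hKU⟩, h1⟩

lemma secondOrderOp_congr {u v : E3 → ℝ} {y : E3} (h : u =ᶠ[𝓝 y] v) :
    secondOrderOp a b c u y = secondOrderOp a b c v y := by
  have h1 : ∀ i, pd i u =ᶠ[𝓝 y] pd i v := fun i => by
    filter_upwards [h.fderiv (𝕜 := ℝ)] with x hx; simp only [pd, hx]
  have h2 : ∀ i j, pd i (pd j u) y = pd i (pd j v) y := fun i j => by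
    rw [pd, (h1 j).fderiv_eq, ← pd]
  simp only [secondOrderOp, Pi.add_apply, Finset.sum_apply, Pi.mul_apply, h2, h.self_of_nhds,
    fun i => (h1 i).self_of_nhds]

lemma secondOrderOp_zero : secondOrderOp a b c 0 = 0 := by
  have : ∀ i, pd i (0 : E3 → ℝ) = 0 := fun i => pd_const 0 i
  simp [secondOrderOp, this]

lemma secondOrderOp_eq_zero {y : E3} (hy : y ∉ tsupport η) : secondOrderOp a b c η y = 0 := by
  rw [secondOrderOp_congr (notMem_tsupport_iff_eventuallyEq.1 hy), secondOrderOp_zero]; rfl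

lemma secondOrderOp_mul {u v : E3 → ℝ} (hu : ContDiff ℝ ∞ u) (hv : ContDiff ℝ ∞ v) :
    secondOrderOp a b c (u * v) = u * secondOrderOp a b c v + v * secondOrderOp a b c u
      + ∑ i, ∑ j, (a i j + a j i) * pd i u * pd j v - c * u * v := by
  have hp : ∀ {u v : E3 → ℝ}, ContDiff ℝ ∞ u → ContDiff ℝ ∞ v → ∀ i,
      pd i (u * v) = pd i u * v + u * pd i v := by
    intro u v hu hv i
    funext y
    have := fderiv_mul (hu.differentiable (by simp) y) (hv.differentiable (by simp) y)
    simp only [pd, Pi.add_apply, Pi.mul_apply, this, FunLike.coe_add, FunLike.coe_smul,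
      Pi.smul_apply, smul_eq_mul]
    ring
  have ha : ∀ {u v : E3 → ℝ}, ContDiff ℝ ∞ u → ContDiff ℝ ∞ v → ∀ i,
      pd i (u + v) = pd i u + pd i v := by
    intro u v hu hv i
    funext y
    have := fderiv_add (hu.differentiable (by simp) y) (hv.differentiable (by simp) y)
    simp only [pd, Pi.add_apply, this, FunLike.coe_add]
  have h2 : ∀ i j, pd i (pd j (u * v)) =
      pd i (pd j u) * v + pd j u * pd i v + (pd i u * pd j v + u * pd i (pd j v)) := by
    intro i j
    rw [hp hu hv, ha (u := pd j u * v) (v := u * pd j v) ((contDiff_pd hu j).mul hv)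
        (hu.mul (contDiff_pd hv j)),
      hp (contDiff_pd hu j) hv, hp hu (contDiff_pd hv j)]
  funext y
  simp only [secondOrderOp, h2]
  simp only [hp hu hv, Pi.add_apply, Pi.mul_apply,
    Pi.sub_apply, Fin.sum_univ_three]
  ring

/-- One argument need not have compact support: it is multiplied by a cutoff equal to one near the
support of the other, which changes neither integrand. -/
lemma IsTestFunction.integral_symm (hU : IsOpen U)
    (hS : ∀ u v, IsTestFunction U u → IsTestFunction U v →
      ∫ y in U, u y * secondOrderOp a b c v y * w y =
        ∫ y in U, secondOrderOp a b c u y * v y * w y)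
    (h : IsTestFunction U η) {p : E3 → ℝ} (hp : ContDiff ℝ ∞ p) :
    ∫ y, p y * secondOrderOp a b c η y * w y = ∫ y, secondOrderOp a b c p y * η y * w y := by
  obtain ⟨χ, hχ, h1⟩ := h.exists_cutoff hU
  have e := hS _ _ (hχ.mul hp) h
  have hout : ∀ y, y ∉ U → y ∉ tsupport η := fun y hy h' => hy (h.subset h')
  rw [setIntegral_eq_integral_of_forall_compl_eq_zero fun y hy => by
      rw [secondOrderOp_eq_zero (hout y hy)]; ring,
    setIntegral_eq_integral_of_forall_compl_eq_zero fun y hy => by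
      rw [image_eq_zero_of_notMem_tsupport (hout y hy)]; ring] at e
  have h2 : ∀ y ∈ tsupport η, p * χ =ᶠ[𝓝 y] p := fun y hy => by
    filter_upwards [(eventually_nhdsSet_iff_forall.1 h1) y hy] with x hx
    rw [Pi.mul_apply, hx, mul_one]
  convert e using 2 <;> funext y <;> by_cases hy : y ∈ tsupport η
  · rw [(h2 y hy).self_of_nhds]
  · rw [secondOrderOp_eq_zero hy]; ring
  · rw [secondOrderOp_congr (h2 y hy)]
  · rw [image_eq_zero_of_notMem_tsupport hy]; ring

lemma contDiff_coord (k : Fin 3) : ContDiff ℝ ∞ (fun y : E3 => y k) := by fun_prop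

lemma pd_coord_fun (i k : Fin 3) : pd i (fun y : E3 => y k) = fun _ => if i = k then 1 else 0 := by
  funext y
  have : HasFDerivAt (fun y : E3 => y k) (EuclideanSpace.proj k : E3 →L[ℝ] ℝ) y :=
    (EuclideanSpace.proj k : E3 →L[ℝ] ℝ).hasFDerivAt
  simp [pd, this.fderiv, stdVec, eq_comm]

lemma secondOrderOp_one : secondOrderOp a b c (fun _ => 1) = c := by
  funext y
  simp [secondOrderOp, pd_const, show ∀ i, pd i (0 : E3 → ℝ) = 0 from fun i => pd_const 0 i]

lemma secondOrderOp_coord (k : Fin 3) :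
    secondOrderOp a b c (fun y => y k) = fun y => b k y + c y * y k := by
  funext y
  simp [secondOrderOp, pd_coord_fun, pd_const]

/-- A formally self-adjoint operator has its first-order part determined by the second-order
part. -/
theorem first_order_of_selfAdjoint (hU : IsOpen U) (ha : ∀ i j, ContDiffOn ℝ ∞ (a i j) U)
    (hb : ∀ i, ContDiffOn ℝ ∞ (b i) U) (hc : ContDiffOn ℝ ∞ c U) (hw : ContDiffOn ℝ ∞ w U)
    (hS : ∀ u v, IsTestFunction U u → IsTestFunction U v →
      ∫ y in U, u y * secondOrderOp a b c v y * w y =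
        ∫ y in U, secondOrderOp a b c u y * v y * w y) (k : Fin 3) {y : E3} (hy : y ∈ U) :
    2 * (w y * b k y) = ∑ j, pd j (w * (a k j + a j k)) y := by
  have haw : ∀ j, ContDiffOn ℝ ∞ (w * (a k j + a j k)) U := fun j =>
    hw.mul ((ha k j).add (ha j k))
  have hG : ContDiffOn ℝ ∞ (fun y => 2 * (w y * b k y) - ∑ j, pd j (w * (a k j + a j k)) y) U :=
    (contDiffOn_const.mul (hw.mul (hb k))).sub
      (ContDiffOn.sum fun j _ => contDiffOn_pd hU (haw j) j)
  have key : ∀ η : E3 → ℝ, ContDiff ℝ ∞ η → HasCompactSupport η → tsupport η ⊆ U →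
      ∫ y, η y • (2 * (w y * b k y) - ∑ j, pd j (w * (a k j + a j k)) y) = 0 := by
    intro η h1 h2 h3
    have h : IsTestFunction U η := ⟨h1, h2, h3⟩
    have hk := h.mul (contDiff_coord k)
    -- Symmetry is tested on the pairs `(1, yₖ η)` and `(yₖ, η)`. Combining the two cancels the
    -- zeroth-order terms and leaves `2 ∫ w bₖ η = -∑ ∫ w (aₖⱼ + aⱼₖ) ∂ⱼη`, to be integrated by
    -- parts.
    have s1 := hk.integral_symm hU hS (p := fun _ => 1) contDiff_const
    have s2 := h.integral_symm hU hS (contDiff_coord k)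
    rw [secondOrderOp_one] at s1
    rw [secondOrderOp_coord] at s2
    have hwb := hw.continuousOn.mul (hb k).continuousOn
    have i1 : Integrable fun y => w y * b k y * η y := h.integrable hwb
    have i2 : Integrable fun y => c y * (y k * η y) * w y := by
      have := hk.integrable (hc.mul hw).continuousOn
      refine this.congr (ae_of_all _ fun y => ?_)
      simp only [Pi.mul_apply]; ring
    have i3 : ∀ j, Integrable fun y => (w * (a k j + a j k) * pd j η) y := fun j =>
      (h.pderiv j).integrable (haw j).continuousOn
    have i4 : Integrable fun y => ∑ j, (w * (a k j + a j k) * pd j η) y :=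
      integrable_finsetSum _ fun j _ => i3 j
    have i5 : ∀ j, Integrable fun y => (pd j (w * (a k j + a j k)) * η) y := fun j =>
      h.integrable (contDiffOn_pd hU (haw j) j).continuousOn
    have e1 : ∀ y, 1 * secondOrderOp a b c ((fun y => y k) * η) y * w y =
        y k * secondOrderOp a b c η y * w y + w y * b k y * η y +
          ∑ j, (w * (a k j + a j k) * pd j η) y := by
      intro y
      rw [secondOrderOp_mul (contDiff_coord k) h1, secondOrderOp_coord]
      simp only [pd_coord_fun, Pi.add_apply, Pi.mul_apply, Pi.sub_apply, Finset.sum_apply,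
        mul_ite, mul_one, mul_zero, ite_mul, zero_mul, Finset.sum_ite_irrel, Finset.sum_const_zero,
        Finset.sum_ite_eq', Finset.mem_univ, if_true]
      rw [mul_comm _ (w y)]
      simp only [mul_add, mul_sub, one_mul, Finset.mul_sum]
      simp only [Fin.sum_univ_three]
      ring
    have i6 : Integrable fun y => y k * secondOrderOp a b c η y * w y := by
      have hD : Continuous fun y : E3 => y k := (contDiff_coord k).continuous
      have q : ∀ {F G : E3 → ℝ}, ContinuousOn F U → IsTestFunction U G →
          Integrable fun y => y k * w y * (F y * G y) := by
        intro F G hF hG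
        have := hG.integrable ((hD.continuousOn.mul hw.continuousOn).mul hF)
        refine this.congr (ae_of_all _ fun y => ?_)
        simp only [Pi.mul_apply]; ring
      have := ((integrable_finsetSum Finset.univ fun i _ => integrable_finsetSum Finset.univ
        fun j _ => q (ha i j).continuousOn ((h.pderiv j).pderiv i)).add
          (integrable_finsetSum Finset.univ fun i _ => q (hb i).continuousOn (h.pderiv i))).add
            (q hc.continuousOn h)
      refine this.congr (ae_of_all _ fun y => ?_)
      simp only [secondOrderOp, Pi.add_apply, Pi.mul_apply, Finset.sum_apply, ← Finset.mul_sum]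
      ring
    have i7 : Integrable fun y => y k * secondOrderOp a b c η y * w y + w y * b k y * η y :=
      i6.add i1
    simp only [e1] at s1
    rw [integral_add i7 i4, integral_add i6 i1, s2, integral_finsetSum _ fun j _ => i3 j] at s1
    have e2 : ∫ y, (b k y + c y * y k) * η y * w y =
        (∫ y, w y * b k y * η y) + ∫ y, c y * (y k * η y) * w y := by
      rw [← integral_add i1 i2]
      exact integral_congr_ae (ae_of_all _ fun y => by ring)
    rw [e2] at s1
    have s3 : (∫ y, c y * ((fun y : E3 => y k) * η) y * w y) = ∫ y, c y * (y k * η y) * w y := rfl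
    rw [s3] at s1
    simp only [fun j => h.integral_by_parts hU (haw j) j] at s1
    have e3 : ∀ y, η y • (2 * (w y * b k y) - ∑ j, pd j (w * (a k j + a j k)) y) =
        2 * (w y * b k y * η y) - ∑ j, (pd j (w * (a k j + a j k)) * η) y := by
      intro y
      simp only [smul_eq_mul, Pi.mul_apply, mul_sub, Finset.mul_sum]
      congr 1
      · ring
      · exact Finset.sum_congr rfl fun j _ => mul_comm _ _
    simp only [e3]
    rw [integral_sub (i1.const_mul 2) (integrable_finsetSum _ fun j _ => i5 j),
      integral_finsetSum _ fun j _ => i5 j, integral_const_mul]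
    rw [Finset.sum_neg_distrib] at s1
    linarith
  -- Fundamental lemma of the calculus of variations; continuity then turns almost everywhere into
  -- everywhere.
  have h0 := hU.ae_eq_zero_of_integral_contDiff_smul_eq_zero
    (hG.continuousOn.locallyIntegrableOn hU.measurableSet) key
  have h1 : (fun y => 2 * (w y * b k y) - ∑ j, pd j (w * (a k j + a j k)) y) =ᵐ[volume.restrict U]
      fun _ => 0 := (ae_restrict_iff' hU.measurableSet).2 h0
  have := Measure.eqOn_open_of_ae_eq h1 hU hG.continuousOn continuousOn_const hy
  exact sub_eq_zero.1 this

end SelfAdjoint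

/-! ### Smoothness of the coefficients in the interior of a chart. -/

section SmoothOn

variable {ρ : E3 → ℝ} {b : Fin 3 → Fin 3 → E3 → ℝ} {U : Set E3}

lemma contDiffOn_det (hb : ∀ i j, ContDiffOn ℝ ∞ (b i j) U) :
    ContDiffOn ℝ ∞ (fun y => (Matrix.of fun i j => b i j y).det) U := by
  simp only [Matrix.det_fin_three, Matrix.of_apply]
  exact ((((((((hb _ _).mul (hb _ _)).mul (hb _ _)).sub (((hb _ _).mul (hb _ _)).mul (hb _ _))).sub
    (((hb _ _).mul (hb _ _)).mul (hb _ _))).add (((hb _ _).mul (hb _ _)).mul (hb _ _))).add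
    (((hb _ _).mul (hb _ _)).mul (hb _ _))).sub (((hb _ _).mul (hb _ _)).mul (hb _ _)))

lemma contDiffOn_coeffFun (hU : IsOpen U) (hρ : ContDiffOn ℝ ∞ ρ U)
    (hb : ∀ i j, ContDiffOn ℝ ∞ (b i j) U)
    (hdet : ∀ y ∈ U, 0 < (Matrix.of fun i j => b i j y).det) (p : MvPolynomial JetVar ℝ) :
    ContDiffOn ℝ ∞ (coeffFun ρ b p) U := by
  have hj : ∀ v, ContDiffOn ℝ ∞ (jetFun ρ b v) U := by
    intro v
    cases v with
    | metric i j => exact hb i j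
    | deriv k i j => exact contDiffOn_twist hU hρ (hb i j) 2 k
    | deriv₂ k l i j => exact contDiffOn_twist hU hρ (contDiffOn_twist hU hρ (hb i j) 2 l) 3 k
    | invSqrtDet =>
      exact ((contDiffOn_det hb).sqrt fun y hy => (hdet y hy).ne').inv fun y hy =>
        (Real.sqrt_pos.2 (hdet y hy)).ne'
  induction p using MvPolynomial.induction_on with
  | C a =>
    have : coeffFun ρ b (MvPolynomial.C a) = fun _ => a := by funext y; simp [coeffFun]
    rw [this]; exact contDiffOn_const
  | add p q hp hq =>
    have : coeffFun ρ b (p + q) = fun y => coeffFun ρ b p y + coeffFun ρ b q y := by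
      funext y; simp [coeffFun]
    rw [this]; exact hp.add hq
  | mul_X p v hp =>
    have : coeffFun ρ b (p * MvPolynomial.X v) = fun y => coeffFun ρ b p y * jetFun ρ b v y := by
      funext y; simp [coeffFun]
    rw [this]; exact hp.mul (hj v)

end SmoothOn

/-! ### Transfer of test functions from a chart to the manifold. -/

section Lift

variable {Mbar : Type*} [TopologicalSpace Mbar] [ChartedSpace H3 Mbar]
  [IsManifold (𝓡∂ 3) ∞ Mbar]

open Classical in
/-- A function of the coordinates of the chart at `q`, extended by zero. -/
def liftFn (q : Mbar) (η : E3 → ℝ) (x : Mbar) : ℝ :=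
  if x ∈ (extChartAt (𝓡∂ 3) q).source then η (extChartAt (𝓡∂ 3) q x) else 0

lemma inChart_liftFn (q : Mbar) (η : E3 → ℝ) {y : E3} (hy : y ∈ chartInt q) :
    inChart q (liftFn q η) y = η y := by
  have hyt := chartInt_subset_target q hy
  simp only [Function.comp_apply, liftFn, if_pos ((extChartAt (𝓡∂ 3) q).map_target hyt),
    (extChartAt (𝓡∂ 3) q).right_inv hyt]

lemma image_chart (q : Mbar) :
    extChartAt (𝓡∂ 3) q '' ((chartAt H3 q).source ∩ IntM Mbar) = chartInt q := by
  rw [← extChartAt_source (𝓡∂ 3)]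
  ext y
  constructor
  · rintro ⟨x, ⟨hx, hxi⟩, rfl⟩
    have ht := (extChartAt (𝓡∂ 3) q).map_source hx
    rw [chart_target] at ht
    refine ⟨(symm_mem_IntM ht).1 ?_, ht.2⟩
    rwa [(extChartAt (𝓡∂ 3) q).left_inv hx]
  · intro hy
    have hyt := chartInt_subset_target q hy
    exact ⟨_, ⟨(extChartAt (𝓡∂ 3) q).map_target hyt, symm_mem_interior hy⟩,
      (extChartAt (𝓡∂ 3) q).right_inv hyt⟩

variable [T2Space Mbar]

lemma liftFn_support {q : Mbar} {η : E3 → ℝ} (h : IsTestFunction (chartInt q) η) :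
    tsupport (liftFn q η) ⊆ (extChartAt (𝓡∂ 3) q).symm '' tsupport η ∧
      IsCompact ((extChartAt (𝓡∂ 3) q).symm '' tsupport η) := by
  have hK : IsCompact ((extChartAt (𝓡∂ 3) q).symm '' tsupport η) :=
    h.compact.isCompact.image_of_continuousOn ((continuousOn_extChartAt_symm q).mono
      (h.subset.trans (chartInt_subset_target q)))
  refine ⟨closure_minimal (fun x hx => ?_) hK.isClosed, hK⟩
  by_cases hs : x ∈ (extChartAt (𝓡∂ 3) q).source
  · rw [Function.mem_support, liftFn, if_pos hs] at hx
    exact ⟨_, subset_tsupport _ hx, (extChartAt (𝓡∂ 3) q).left_inv hs⟩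
  · exact absurd (if_neg hs) hx

lemma liftFn_tsupport_subset {q : Mbar} {η : E3 → ℝ} (h : IsTestFunction (chartInt q) η) :
    tsupport (liftFn q η) ⊆ (chartAt H3 q).source ∩ IntM Mbar := by
  refine (liftFn_support h).1.trans ?_
  rintro _ ⟨y, hy, rfl⟩
  rw [← extChartAt_source (𝓡∂ 3)]
  exact ⟨(extChartAt (𝓡∂ 3) q).map_target (chartInt_subset_target q (h.subset hy)),
    symm_mem_interior (h.subset hy)⟩

lemma liftFn_hasCompactSupport {q : Mbar} {η : E3 → ℝ} (h : IsTestFunction (chartInt q) η) :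
    HasCompactSupport (liftFn q η) :=
  (liftFn_support h).2.of_isClosed_subset (isClosed_tsupport _) (liftFn_support h).1

lemma liftFn_contMDiff {q : Mbar} {η : E3 → ℝ} (h : IsTestFunction (chartInt q) η) :
    ContMDiff (𝓡∂ 3) 𝓘(ℝ, ℝ) ∞ (liftFn q η) := by
  refine contMDiff_of_tsupport fun x hx => ?_
  have hs := (liftFn_tsupport_subset h hx).1
  have e : liftFn q η =ᶠ[𝓝 x] η ∘ extChartAt (𝓡∂ 3) q := by
    filter_upwards [(chartAt H3 q).open_source.mem_nhds hs] with x hx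
    rw [← extChartAt_source (𝓡∂ 3)] at hx
    exact if_pos hx
  exact (h.smooth.contMDiff.contMDiffAt.comp x (contMDiffAt_extChartAt' hs)).congr_of_eventuallyEq e

end Lift

/-! ### Formal self-adjointness written in a boundary chart. -/

section ChartOperator

variable {Mbar : Type*} [TopologicalSpace Mbar] [ChartedSpace H3 Mbar]
  [IsManifold (𝓡∂ 3) ∞ Mbar] [T2Space Mbar] {ρ : Mbar → ℝ} {g : BilinField Mbar}
  {gbar : Bundle.ContMDiffRiemannianMetric (𝓡∂ 3) ∞ E3 (fun x : Mbar => TangentSpace (𝓡∂ 3) x)}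

/-- The volume density of `ρ² g` in the chart at `q`. -/
def barDensity (gbar : BilinField Mbar) (q : Mbar) (y : E3) : ℝ :=
  √(Matrix.of fun i j => barComp gbar q i j y).det

lemma sqrt_metricDet (hρ : IsDefiningFunction ρ)
    (hg : ∀ x ∈ IntM Mbar, ∀ v w : TangentSpace (𝓡∂ 3) x,
      gbar.inner x v w = ρ x ^ 2 * g x v w) (q : Mbar) {y : E3} (hy : y ∈ chartInt q) :
    √(metricDet g (chartAt H3 q) y) =
      (inChart q ρ y)⁻¹ ^ 3 * barDensity gbar.inner q y := by
  have hR : 0 < inChart q ρ y := hρ.pos (symm_mem_interior hy)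
  have e : (Matrix.of fun i j => metricComp g (chartAt H3 q) i j y) =
      (inChart q ρ y)⁻¹ ^ 2 • Matrix.of fun i j => barComp gbar.inner q i j y := by
    ext i j
    exact pullbackComp_eq hρ hg q hy i j
  rw [metricDet, e, Matrix.det_smul, Fintype.card_fin, Real.sqrt_mul (by positivity), barDensity,
    show ((inChart q ρ y)⁻¹ ^ 2) ^ 3 = ((inChart q ρ y)⁻¹ ^ 3) ^ 2 by ring,
    Real.sqrt_sq (by positivity)]

/-- Formal self-adjointness in the chart at `q`. -/
lemma IsFormallySelfAdjoint.first_order (hρ : IsDefiningFunction ρ)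
    (hg : ∀ x ∈ IntM Mbar, ∀ v w : TangentSpace (𝓡∂ 3) x,
      gbar.inner x v w = ρ x ^ 2 * g x v w) {P : (Mbar → ℝ) → Mbar → ℝ} {Q : GeometricCoeffs}
    (hP : Represents g P Q) (hS : IsFormallySelfAdjoint g P) (q : Mbar) {A : Fin 3 → Fin 3 → E3 → ℝ}
    {B : Fin 3 → E3 → ℝ} (hA : A = fun i j => coeffFun (inChart q ρ) (barComp gbar.inner q) (Q.a i j))
    (hB : B = fun i => coeffFun (inChart q ρ) (barComp gbar.inner q) (Q.b i))
    (k : Fin 3) {y : E3} (hy : y ∈ chartInt q) :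
    2 * (barDensity gbar.inner q y * B k y) =
      ∑ j, twist 1 (inChart q ρ) j (barDensity gbar.inner q * (A k j + A j k)) y := by
  set R := inChart q ρ with hR
  set D := barDensity gbar.inner q with hD
  set C := coeffFun R (barComp gbar.inner q) Q.c with hC
  have hU := isOpen_chartInt q
  have hR0 : ∀ y ∈ chartInt q, R y ≠ 0 := fun y hy => (hρ.pos (symm_mem_interior hy)).ne'
  have hRs : ContDiffOn ℝ ∞ R (chartInt q) := (contDiffOn_chart hρ.smooth q).mono (chartInt_subset q)
  have hbs : ∀ i j, ContDiffOn ℝ ∞ (barComp gbar.inner q i j) (chartInt q) := fun i j =>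
    (contDiffOn_barComp gbar q i j).mono (chartInt_subset q)
  have hdet : ∀ y ∈ chartInt q, 0 < (Matrix.of fun i j => barComp gbar.inner q i j y).det :=
    fun y hy => det_barComp_pos gbar q (chartInt_subset_target q hy)
  have hDs : ContDiffOn ℝ ∞ D (chartInt q) := (contDiffOn_det hbs).sqrt fun y hy => (hdet y hy).ne'
  have hAs : ∀ i j, ContDiffOn ℝ ∞ (A i j) (chartInt q) := fun i j => by
    rw [hA]; exact contDiffOn_coeffFun hU hRs hbs hdet _
  have hBs : ∀ i, ContDiffOn ℝ ∞ (B i) (chartInt q) := fun i => by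
    rw [hB]; exact contDiffOn_coeffFun hU hRs hbs hdet _
  have hCs : ContDiffOn ℝ ∞ C (chartInt q) := contDiffOn_coeffFun hU hRs hbs hdet _
  set w : E3 → ℝ := fun y => (R y)⁻¹ ^ 3 * D y with hw
  have hws : ContDiffOn ℝ ∞ w (chartInt q) := ((hRs.inv hR0).pow 3).mul hDs
  have hdeg : ∀ v, IsTestFunction (chartInt q) v → ∀ y ∈ chartInt q,
      P (liftFn q v) ((extChartAt (𝓡∂ 3) q).symm y) =
        secondOrderOp (fun i j => A i j * R ^ 2) (fun i => B i * R) C v y := by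
    intro v hv y hy
    rw [hP.eq_degOp hρ hg (liftFn_contMDiff hv).contMDiffOn q hy, hA, hB]
    refine secondOrderOp_congr ?_
    filter_upwards [hU.mem_nhds hy] with x hx using inChart_liftFn q v hx
  have hint : ∀ F : Mbar → ℝ, chartIntegral g (chartAt H3 q) F =
      ∫ y in chartInt q, F ((extChartAt (𝓡∂ 3) q).symm y) * w y := by
    intro F
    have e1 : (chartAt H3 q).extend (𝓡∂ 3) = extChartAt (𝓡∂ 3) q := rfl
    rw [chartIntegral, e1, image_chart]
    refine setIntegral_congr_fun hU.measurableSet fun y hy => ?_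
    simp only [sqrt_metricDet hρ hg q hy, hw, hR, hD]
  have key := first_order_of_selfAdjoint (a := fun i j => A i j * R ^ 2) (b := fun i => B i * R)
    (c := C) (w := w) hU (fun i j => (hAs i j).mul (hRs.pow 2)) (fun i => (hBs i).mul hRs) hCs hws ?_
    k hy
  · have h1 : ∀ j, pd j (w * (A k j * R ^ 2 + A j k * R ^ 2)) y =
        (R y)⁻¹ ^ 2 * twist 1 R j (D * (A k j + A j k)) y := by
      intro j
      have hF : ContDiffOn ℝ ∞ (D * (A k j + A j k)) (chartInt q) :=
        hDs.mul ((hAs k j).add (hAs j k))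
      have hd : ∀ {F : E3 → ℝ}, ContDiffOn ℝ ∞ F (chartInt q) → DifferentiableAt ℝ F y := fun hF =>
        (hF.contDiffAt (hU.mem_nhds hy)).differentiableAt (by simp)
      rw [← pd_inv_pow_mul (hd hRs) (hd hF) (hR0 y hy)]
      have : w * (A k j * R ^ 2 + A j k * R ^ 2) =ᶠ[𝓝 y]
          fun y => (R y)⁻¹ ^ 1 * (D * (A k j + A j k)) y := by
        filter_upwards [hU.mem_nhds hy] with x hx
        have := hR0 x hx
        simp only [hw, Pi.mul_apply, Pi.add_apply, Pi.pow_apply]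
        field_simp
      rw [pd, this.fderiv_eq, pd]
    replace key := key.trans (Finset.sum_congr rfl fun j _ => h1 j)
    rw [← Finset.mul_sum] at key
    simp only [Pi.mul_apply, hw] at key
    have hRy := hR0 y hy
    have h2 : (R y)⁻¹ ^ 3 * D y * (B k y * R y) = (R y)⁻¹ ^ 2 * (D y * B k y) := by
      field_simp
    rw [h2, ← mul_left_comm] at key
    exact mul_left_cancel₀ (pow_ne_zero 2 (inv_ne_zero hRy)) key
  · intro u v hu hv
    have := hS _ (IsManifold.chart_mem_maximalAtlas q) _ _ (liftFn_contMDiff hu)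
      (liftFn_contMDiff hv) (liftFn_hasCompactSupport hu) (liftFn_hasCompactSupport hv)
      (liftFn_tsupport_subset hu) (liftFn_tsupport_subset hv)
    rw [hint, hint] at this
    convert this using 1
    · refine setIntegral_congr_fun hU.measurableSet fun y hy => ?_
      simp only [hdeg v hv y hy]
      rw [← inChart_liftFn q u hy]; rfl
    · refine setIntegral_congr_fun hU.measurableSet fun y hy => ?_
      simp only [hdeg u hu y hy]
      rw [← inChart_liftFn q v hy]; rfl

end ChartOperator

/-! ### Coefficients of the operator near a boundary point. -/

section ChartCoeffs

variable {Mbar : Type*} [TopologicalSpace Mbar] [ChartedSpace H3 Mbar]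
  [IsManifold (𝓡∂ 3) ∞ Mbar] [T2Space Mbar] {ρ : Mbar → ℝ} {g : BilinField Mbar}
  {gbar : Bundle.ContMDiffRiemannianMetric (𝓡∂ 3) ∞ E3 (fun x : Mbar => TangentSpace (𝓡∂ 3) x)}

lemma smoothGerm_barComp {q : Mbar} (hq : q ∈ Bdry Mbar) (i j : Fin 3) :
    SmoothGerm (extChartAt (𝓡∂ 3) q q) (barComp gbar.inner q i j) :=
  SmoothGerm.of_contDiffOn (chart_self_zero hq) (isOpen_chartOpen q) (chart_self_mem q).2
    (contDiffOn_barComp gbar q i j)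

lemma eventually_le_det_barComp (q : Mbar) :
    ∃ c > 0, ∀ᶠ y in L (extChartAt (𝓡∂ 3) q q),
      c ≤ (Matrix.of fun i j => barComp gbar.inner q i j y).det := by
  have h := tendsto_of_contDiffOn (isOpen_chartOpen q) (chart_self_mem q)
    (contDiffOn_det (contDiffOn_barComp gbar q))
  have hp := det_barComp_pos gbar q (mem_extChartAt_target q)
  exact ⟨_, half_pos hp, (h.eventually (lt_mem_nhds (half_lt_self hp))).mono fun _ h => h.le⟩

/-- Near a boundary point, a formally self-adjoint geometric operator is a uniformly degenerate
operator with smooth coefficients, whose first-order part is determined on the boundary by the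
principal part. -/
theorem exists_chartCoeffs (hρ : IsDefiningFunction ρ)
    (hg : ∀ x ∈ IntM Mbar, ∀ v w : TangentSpace (𝓡∂ 3) x,
      gbar.inner x v w = ρ x ^ 2 * g x v w) {P : (Mbar → ℝ) → Mbar → ℝ} {Q : GeometricCoeffs}
    (hP : Represents g P Q) (hS : IsFormallySelfAdjoint g P) {q : Mbar} (hq : q ∈ Bdry Mbar) :
    ∃ (A : Fin 3 → Fin 3 → E3 → ℝ) (B : Fin 3 → E3 → ℝ) (C : E3 → ℝ),
      (∀ i j, SmoothGerm (extChartAt (𝓡∂ 3) q q) (A i j)) ∧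
      (∀ i, SmoothGerm (extChartAt (𝓡∂ 3) q q) (B i)) ∧
      SmoothGerm (extChartAt (𝓡∂ 3) q q) C ∧
      (∀ i, BO (extChartAt (𝓡∂ 3) q q) 1 (B i + ∑ j, A i j * pd j (inChart q ρ))) ∧
      ∀ u : Mbar → ℝ, ContMDiffOn (𝓡∂ 3) 𝓘(ℝ, ℝ) ∞ u (IntM Mbar) → ∀ y ∈ chartInt q,
        P u ((extChartAt (𝓡∂ 3) q).symm y) = degOp A B C (inChart q ρ) (inChart q u) y := by
  set z := extChartAt (𝓡∂ 3) q q with hz'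
  have hz : z 0 = 0 := chart_self_zero hq
  set R := inChart q ρ with hR
  set b := barComp gbar.inner q with hb
  have hRd := hρ.isLocalDefining hq
  have hRs : SmoothGerm z R := hRd.smooth
  have hbs : ∀ i j, SmoothGerm z (b i j) := smoothGerm_barComp hq
  obtain ⟨c, hc, hdet⟩ := eventually_le_det_barComp (gbar := gbar) q
  have hco : ∀ p, SmoothGerm z (coeffFun R b p) :=
    smoothGerm_coeffFun hz (smoothGerm_jetFun hz hRs hbs hc hdet)
  obtain ⟨A, hA⟩ : ∃ A, A = fun i j => coeffFun R b (Q.a i j) := ⟨_, rfl⟩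
  obtain ⟨B, hB⟩ : ∃ B, B = fun i => coeffFun R b (Q.b i) := ⟨_, rfl⟩
  have hAs : ∀ i j, SmoothGerm z (A i j) := fun i j => hA ▸ hco _
  have hBs : ∀ i, SmoothGerm z (B i) := fun i => hB ▸ hco _
  set D := barDensity gbar.inner q with hD
  have hDs : SmoothGerm z D := (smoothGerm_det hbs).sqrt hz hc hdet
  have hDc : ∀ᶠ y in L z, √c ≤ D y := hdet.mono fun y hy => Real.sqrt_le_sqrt hy
  have hDi : SmoothGerm z D⁻¹ :=
    hDs.inv hz (Real.sqrt_pos.2 hc) (hDc.mono fun y hy => hy.trans (le_abs_self _))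
  -- The principal part is symmetrized: second derivatives commute, and the first-order part is
  -- expressed through `A + Aᵀ`.
  refine ⟨fun i j => (1 / 2 : ℝ) • (A i j + A j i), B, coeffFun R b Q.c,
    fun i j => ((hAs i j).add (hAs j i)).const_smul _, hBs, hco _, fun k => ?_, fun u hu y hy => ?_⟩
  -- Self-adjointness reads `2 D Bₖ = ρ ∑ ∂ⱼ(D (A + Aᵀ)ₖⱼ) - D ∑ (A + Aᵀ)ₖⱼ ∂ⱼρ`. Hence the
  -- expression to be bounded is `ρ` times this smooth germ.
  · have h1 : SmoothGerm z ((1 / 2 : ℝ) • (D⁻¹ * ∑ j, pd j (D * (A k j + A j k)))) :=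
      (hDi.mul (SmoothGerm.sum _ fun j _ =>
        (hDs.mul ((hAs k j).add (hAs j k))).pderiv j)).const_smul _
    refine (hRd.bo.mul_smooth h1).congr ?_
    filter_upwards [eventually_mem_target q, hDc] with y hy hDy
    have hD0 : D y ≠ 0 := ((Real.sqrt_pos.2 hc).trans_le hDy).ne'
    have e := hS.first_order hρ hg hP q hA hB k hy
    simp only [twist, Pi.sub_apply, Pi.smul_apply, Pi.mul_apply, Pi.add_apply, smul_eq_mul,
      Finset.sum_sub_distrib, ← Finset.mul_sum, ← hD, ← hR, Nat.cast_one, one_mul] at e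
    simp only [Pi.add_apply, Pi.mul_apply, Pi.smul_apply, Finset.sum_apply, Pi.inv_apply,
      smul_eq_mul]
    have e2 : ∑ j, pd j R y * (D y * (A k j y + A j k y)) =
        D y * ∑ j, (A k j y + A j k y) * pd j R y := by
      rw [Finset.mul_sum]; exact Finset.sum_congr rfl fun j _ => by ring
    have e3 : ∑ j, 1 / 2 * (A k j y + A j k y) * pd j R y =
        1 / 2 * ∑ j, (A k j y + A j k y) * pd j R y := by
      rw [Finset.mul_sum]; exact Finset.sum_congr rfl fun j _ => by ring
    rw [e2] at e
    rw [e3]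
    field_simp
    linarith
  · rw [hP.eq_degOp hρ hg hu q hy]
    have hs : ContDiffAt ℝ ∞ (inChart q u) y :=
      (contDiffOn_chart_interior hu q).contDiffAt ((isOpen_chartInt q).mem_nhds hy)
    have hcomm : ∀ i j, pd i (pd j (inChart q u)) y = pd j (pd i (inChart q u)) y :=
      pd_comm_at hs
    simp only [degOp, Pi.add_apply, Pi.mul_apply, Pi.pow_apply, Pi.smul_apply,
      smul_eq_mul, hA, hB, Fin.sum_univ_three, hcomm 1 0, hcomm 2 0, hcomm 2 1]
    ring

end ChartCoeffs

/-! ### The action on powers of `ρ` and the indicial polynomial. -/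

section Indicial

lemma BO.exists_tendsto_zero {z : E3} {t : ℝ} (ht : 0 < t) {F : E3 → ℝ} (h : BO z t F) :
    ∃ r > 0, ∀ x, dist x z < r → x 0 = 0 → Tendsto F (L x) (𝓝 0) := by
  obtain ⟨C, hC⟩ := h (t / 2) (by linarith)
  obtain ⟨r, hr, h⟩ := eventually_L_iff.1 hC
  refine ⟨r, hr, fun x hx hx0 => tendsto_zero_of_le_rpow hx0 (half_pos ht) (C := C) ?_⟩
  have h1 : ∀ᶠ y in L x, dist y z < r :=
    nhdsWithin_le_nhds (Metric.isOpen_ball.mem_nhds (show x ∈ Metric.ball z r from hx))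
  filter_upwards [h1, eventually_pos] with y hy hy0
  exact h y hy hy0

lemma eventually_mem_chartInt {Mbar : Type*} [TopologicalSpace Mbar] [ChartedSpace H3 Mbar]
    [IsManifold (𝓡∂ 3) ∞ Mbar] {q : Mbar} {x : E3} (hx : x ∈ chartOpen q) :
    ∀ᶠ y in L x, y ∈ chartInt q := by
  have h1 : ∀ᶠ y in L x, y ∈ chartOpen q := nhdsWithin_le_nhds ((isOpen_chartOpen q).mem_nhds hx)
  filter_upwards [h1, eventually_pos] with y h2 h3 using ⟨h3, h2⟩

/-- The terms of lower order in the action of a degenerate operator on powers of `ρ`. -/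
def indicialRemainder (A : Fin 3 → Fin 3 → E3 → ℝ) (B : Fin 3 → E3 → ℝ) (ρ : E3 → ℝ) : E3 → ℝ :=
  ∑ i, (B i + ∑ j, A i j * pd j ρ) * pd i ρ + ρ * ∑ i, ∑ j, A i j * pd i (pd j ρ)

variable {A : Fin 3 → Fin 3 → E3 → ℝ} {B : Fin 3 → E3 → ℝ} {C R : E3 → ℝ}

/-- The identity `ρ ∂ᵢ(ρⁿ) = n ρⁿ ∂ᵢρ` avoids the exponents `n - 1` and `n - 2`. The principal part
contributes `n (n - 1) |dρ|²`; the boundary value `-∑ Aᵢⱼ ∂ⱼρ` of `B` contributes `-n |dρ|²`, and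
the deviation from it goes into the remainder. -/
lemma degOp_pow {y : E3} (hn : ∀ᶠ x in 𝓝 y, ContDiffAt ℝ ∞ R x) (n : ℕ) :
    degOp A B C R (R ^ n) y = R y ^ n * ((n : ℝ) * (n - 2) * normSqGrad A R y + C y +
      n * indicialRemainder A B R y) := by
  have hR := hn.self_of_nhds
  have h1 : ∀ {x}, ContDiffAt ℝ ∞ R x → ∀ i, R x * pd i (R ^ n) x = n * R x ^ n * pd i R x := by
    intro x hx i
    have : fderiv ℝ (R ^ n) x = _ := ((hx.differentiableAt (by simp)).hasFDerivAt.pow n).fderiv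
    rw [pd, this, pd]
    rcases n with _ | n
    · simp
    · simp only [FunLike.coe_smul, Pi.smul_apply, smul_eq_mul, nsmul_eq_mul, Nat.add_sub_cancel]
      ring
  have hRn : ContDiffAt ℝ ∞ (R ^ n) y := hR.pow n
  have hd : ∀ {F : E3 → ℝ}, ContDiffAt ℝ ∞ F y → ∀ i, DifferentiableAt ℝ (pd i F) y := by
    intro F hF i
    exact ((hF.fderiv_right (m := 1) (by norm_cast)).clm_apply contDiffAt_const).differentiableAt
      (by simp)
  have hm : ∀ {F G : E3 → ℝ}, DifferentiableAt ℝ F y → DifferentiableAt ℝ G y → ∀ i,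
      pd i (F * G) y = pd i F y * G y + F y * pd i G y := by
    intro F G hF hG i
    rw [pd, (hF.hasFDerivAt.mul hG.hasFDerivAt).fderiv]
    simp only [FunLike.coe_add, FunLike.coe_smul, Pi.add_apply, Pi.smul_apply, smul_eq_mul, pd]
    ring
  have hRd : DifferentiableAt ℝ R y := hR.differentiableAt (by simp)
  have h2 : ∀ i j, R y ^ 2 * pd i (pd j (R ^ n)) y =
      R y ^ n * (n * (n - 1) * (pd i R y * pd j R y) + n * (R y * pd i (pd j R) y)) := by
    intro i j
    have e : R * pd j (R ^ n) =ᶠ[𝓝 y] (n : ℝ) • (R ^ n * pd j R) := by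
      filter_upwards [hn] with x hx
      have := h1 hx j
      simp only [Pi.mul_apply, Pi.smul_apply, Pi.pow_apply, smul_eq_mul, this, mul_assoc]
    have e1 : pd i (R * pd j (R ^ n)) y = pd i ((n : ℝ) • (R ^ n * pd j R)) y := by
      rw [pd, e.fderiv_eq, pd]
    have e2 : pd i ((n : ℝ) • (R ^ n * pd j R)) y = n * pd i (R ^ n * pd j R) y := by
      rw [pd, fderiv_const_smul_field]; rfl
    rw [hm hRd (hd hRn j), e2, hm (hRn.differentiableAt (by simp)) (hd hR j)] at e1
    have e3 := h1 hR i
    have e4 := h1 hR j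
    simp only [Pi.pow_apply] at e1
    linear_combination R y * e1 + n * pd j R y * e3 - pd i R y * e4
  have h3 : ∀ i j, A i j y * R y ^ 2 * pd i (pd j (R ^ n)) y =
      R y ^ n * (n * (n - 1) * (A i j y * pd i R y * pd j R y) +
        n * (R y * (A i j y * pd i (pd j R) y))) := fun i j => by
    rw [mul_assoc, h2]; ring
  have h4 : ∀ i, B i y * R y * pd i (R ^ n) y = R y ^ n * (n * (B i y * pd i R y)) := fun i => by
    rw [mul_assoc, h1 hR]; ring
  simp only [degOp, Pi.add_apply, Finset.sum_apply, Pi.mul_apply, Pi.pow_apply, h3, h4,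
    normSqGrad, indicialRemainder, Fin.sum_univ_three]
  ring

variable {Mbar : Type*} [TopologicalSpace Mbar] [ChartedSpace H3 Mbar]
  [IsManifold (𝓡∂ 3) ∞ Mbar] {ρ : Mbar → ℝ} {P : (Mbar → ℝ) → Mbar → ℝ}

/-- The indicial map is tested on `w = 1` with natural exponents. For these `ρ^s` is real and
smooth, and they are numerous enough to determine a polynomial. -/
lemma IsIndicialMap.tendsto_chart (hρ : IsDefiningFunction ρ) {q : Mbar}
    (hP : ∀ u : Mbar → ℝ, ContMDiffOn (𝓡∂ 3) 𝓘(ℝ, ℝ) ∞ u (IntM Mbar) → ∀ y ∈ chartInt q,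
        P u ((extChartAt (𝓡∂ 3) q).symm y) = degOp A B C (inChart q ρ) (inChart q u) y)
    {x : E3} (hx : x ∈ closedHalf ∩ chartOpen q) {n : ℕ} {T : ℂ →ₗ[ℂ] ℂ}
    (hT : IsIndicialMap ρ P n ((extChartAt (𝓡∂ 3) q).symm x) T) :
    Tendsto (fun y => (((n : ℝ) * (n - 2) * normSqGrad A (inChart q ρ) y + C y +
      n * indicialRemainder A B (inChart q ρ) y : ℝ) : ℂ)) (L x) (𝓝 (T 1)) := by
  have h := (hT (fun _ => 1) contMDiff_const).comp (tendsto_chart_symm hx)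
  refine h.congr' ?_
  filter_upwards [eventually_mem_chartInt hx.2] with y hy
  have hpos := hρ.pos (symm_mem_interior hy)
  have e1 : (fun y => (((ρ y : ℂ) ^ (n : ℂ)) * 1).re) = fun y => ρ y ^ n := by
    funext y; rw [Complex.cpow_natCast, mul_one, ← Complex.ofReal_pow, Complex.ofReal_re]
  have e2 : (fun y => (((ρ y : ℂ) ^ (n : ℂ)) * 1).im) = fun _ => (0 : ℝ) := by
    funext y; rw [Complex.cpow_natCast, mul_one, ← Complex.ofReal_pow, Complex.ofReal_im]
  have hR : ∀ᶠ y in 𝓝 y, ContDiffAt ℝ ∞ (inChart q ρ) y := by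
    filter_upwards [(isOpen_chartInt q).mem_nhds hy] with x hx
    exact ((contDiffOn_chart hρ.smooth q).mono (chartInt_subset q)).contDiffAt
      ((isOpen_chartInt q).mem_nhds hx)
  have e3 : P (fun _ => (0 : ℝ)) ((extChartAt (𝓡∂ 3) q).symm y) = 0 := by
    rw [hP _ contMDiffOn_const y hy]
    exact congrFun (secondOrderOp_zero (a := fun i j => A i j * (inChart q ρ) ^ 2)
      (b := fun i => B i * inChart q ρ) (c := C)) y
  have e4 : P (fun y => ρ y ^ n) ((extChartAt (𝓡∂ 3) q).symm y) =
      ρ ((extChartAt (𝓡∂ 3) q).symm y) ^ n * ((n : ℝ) * (n - 2) * normSqGrad A (inChart q ρ) y + C y +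
        n * indicialRemainder A B (inChart q ρ) y) := by
    rw [hP _ (hρ.smooth.pow n).contMDiffOn y hy]
    exact degOp_pow hR n
  simp only [Function.comp_apply, complexify, e1, e2, e3, e4]
  rw [Complex.cpow_neg, Complex.cpow_natCast, ← Complex.ofReal_pow]
  set t := ρ ((extChartAt (𝓡∂ 3) q).symm y) ^ n with ht
  have ht0 : (t : ℂ) ≠ 0 := by exact_mod_cast (pow_pos hpos n).ne'
  rw [Complex.ofReal_mul, Complex.ofReal_zero, zero_mul, add_zero, ← mul_assoc,
    inv_mul_cancel₀ ht0, one_mul]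

lemma neBot_nhdsWithin_interior {q : Mbar} (hq : q ∈ Bdry Mbar) : (𝓝[IntM Mbar] q).NeBot := by
  have : (L (extChartAt (𝓡∂ 3) q q)).NeBot := L_neBot (chart_self_zero hq).ge
  exact (this.map _).mono (tendsto_chart_symm_self q)

lemma IsIndicialMap.apply_one_unique {q : Mbar} (hq : q ∈ Bdry Mbar) {s : ℂ} {T T' : ℂ →ₗ[ℂ] ℂ}
    (h : IsIndicialMap ρ P s q T) (h' : IsIndicialMap ρ P s q T') : T 1 = T' 1 :=
  have := neBot_nhdsWithin_interior hq
  tendsto_nhds_unique (h (fun _ => 1) contMDiff_const) (h' (fun _ => 1) contMDiff_const)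

lemma not_nodup_roots_of_sq {p : Polynomial ℂ} {c : ℂ} (hp : p ≠ 0)
    (h : p = Polynomial.C c * (Polynomial.X - Polynomial.C 1) ^ 2) : ¬ p.roots.Nodup := by
  intro hn
  have h1 := Multiset.nodup_iff_count_le_one.1 hn 1
  rw [Polynomial.count_roots] at h1
  have h2 : 2 ≤ p.rootMultiplicity 1 :=
    (Polynomial.le_rootMultiplicity_iff hp).2 (h ▸ dvd_mul_left _ _)
  omega

/-- The indicial polynomial of a formally self-adjoint operator is quadratic, with roots symmetric
about `1`, and the largest root is an integer at least two. -/
lemma indicial_polynomial {p : Polynomial ℂ} {c d : ℂ} (hp : p ≠ 0)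
    (hpn : ∀ n : ℕ, p.eval (n : ℂ) = (n * (n - 2)) * c + d) (hnd : p.roots.Nodup)
    (hint : ∀ s ∈ p.roots, ∃ n : ℤ, s = (n : ℂ)) {μ : ℝ} (hμ : p.eval (μ : ℂ) = 0)
    (hmax : ∀ s : ℂ, p.eval s = 0 → s.re ≤ μ) :
    c ≠ 0 ∧ ∃ m : ℕ, 2 ≤ m ∧ μ = m := by
  have hP : p = Polynomial.C c * (Polynomial.X * (Polynomial.X - Polynomial.C 2)) +
      Polynomial.C d := by
    refine Polynomial.eq_of_infinite_eval_eq _ _ (Set.Infinite.mono (s := range ((↑) : ℕ → ℂ)) ?_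
      (Set.infinite_range_of_injective Nat.cast_injective))
    rintro _ ⟨n, rfl⟩
    simp only [mem_ofPred_eq, hpn, Polynomial.eval_add, Polynomial.eval_mul, Polynomial.eval_C,
      Polynomial.eval_X, Polynomial.eval_sub]
    ring
  have hev : ∀ s, p.eval s = c * (s * (s - 2)) + d := fun s => by
    rw [hP]; simp
  have hc : c ≠ 0 := by
    rintro rfl
    rw [hev, zero_mul, zero_add] at hμ
    exact hp (by rw [hP, hμ]; simp)
  refine ⟨hc, ?_⟩
  obtain ⟨k, hk⟩ := hint (μ : ℂ) ((Polynomial.mem_roots hp).2 hμ)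
  have hμk : μ = k := by exact_mod_cast hk
  -- By the symmetry about `1`, `2 - μ` is a root too, hence at most `μ`. The value `μ = 1` would be
  -- a double root.
  have h1 : 1 ≤ μ := by
    have := hmax ((2 - μ : ℝ) : ℂ) (by rw [hev] at hμ ⊢; push_cast; linear_combination hμ)
    rw [Complex.ofReal_re] at this
    linarith
  have hne : μ ≠ 1 := by
    rintro rfl
    refine not_nodup_roots_of_sq (c := c) hp ?_ hnd
    have hd : d = c := by
      rw [hev] at hμ; push_cast at hμ; linear_combination hμ
    rw [hP, hd]
    simp only [Polynomial.C_ofNat, Polynomial.C_1]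
    ring
  have hk2 : 2 ≤ k := by
    rw [hμk] at h1 hne
    have h3 : (1 : ℤ) ≤ k := by exact_mod_cast h1
    have h4 : k ≠ 1 := by exact_mod_cast hne
    omega
  lift k to ℕ using by omega
  exact ⟨k, by exact_mod_cast hk2, by simpa using hμk⟩

end Indicial

/-! ### The largest characteristic exponent and the adapted form of the coefficients. -/

section Exponent

variable {Mbar : Type*} [TopologicalSpace Mbar] [ChartedSpace H3 Mbar]
  [IsManifold (𝓡∂ 3) ∞ Mbar] {ρ : Mbar → ℝ} {P : (Mbar → ℝ) → Mbar → ℝ}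
  {A : Fin 3 → Fin 3 → E3 → ℝ} {B : Fin 3 → E3 → ℝ} {C : E3 → ℝ}

lemma BO.indicialRemainder {z : E3} {R : E3 → ℝ} (hA : ∀ i j, SmoothGerm z (A i j))
    (hR : SmoothGerm z R) (hb : BO z 1 R) (hB : ∀ i, BO z 1 (B i + ∑ j, A i j * pd j R)) :
    BO z 1 (indicialRemainder A B R) :=
  (BO.sum _ fun i _ => (hB i).mul_smooth (hR.pderiv i)).add (hb.mul_smooth
    (SmoothGerm.sum _ fun i _ => SmoothGerm.sum _ fun j _ => (hA i j).mul ((hR.pderiv j).pderiv i)))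

/-- Since `n (n - 2)` is `0` at `n = 0` and `-1` at `n = 1`, these two exponents give the limits of
`C` and of `|dρ|²`, and all others are determined. The limits are needed at all boundary points near
`q`, because `SmoothGerm.bo_one` asks for boundary values on a neighbourhood. -/
lemma indicial_limits (hρ : IsDefiningFunction ρ) {q : Mbar} (hq : q ∈ Bdry Mbar)
    (hA : ∀ i j, SmoothGerm (extChartAt (𝓡∂ 3) q q) (A i j))
    (hB : ∀ i, BO (extChartAt (𝓡∂ 3) q q) 1 (B i + ∑ j, A i j * pd j (inChart q ρ)))
    (hP : ∀ u : Mbar → ℝ, ContMDiffOn (𝓡∂ 3) 𝓘(ℝ, ℝ) ∞ u (IntM Mbar) → ∀ y ∈ chartInt q,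
        P u ((extChartAt (𝓡∂ 3) q).symm y) = degOp A B C (inChart q ρ) (inChart q u) y)
    {p : Polynomial ℂ} {Φ : Mbar → (ℂ ≃ₗ[ℂ] ℂ)}
    (hI : ∀ q ∈ Bdry Mbar, ∀ s : ℂ, IsIndicialMap ρ P s q (p.eval s • (Φ q : ℂ →ₗ[ℂ] ℂ))) :
    ∃ r > 0, ∀ x, dist x (extChartAt (𝓡∂ 3) q q) < r → x 0 = 0 → ∃ φ : ℂ, φ ≠ 0 ∧
      Tendsto (fun y => (normSqGrad A (inChart q ρ) y : ℂ)) (L x)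
        (𝓝 ((p.eval 0 - p.eval 1) * φ)) ∧
      Tendsto (fun y => (C y : ℂ)) (L x) (𝓝 (p.eval 0 * φ)) ∧
      ∀ n : ℕ, p.eval (n : ℂ) = (n * (n - 2)) * (p.eval 0 - p.eval 1) + p.eval 0 := by
  have hloc := hρ.isLocalDefining hq
  obtain ⟨r₁, hr₁, h₁⟩ :=
    (BO.indicialRemainder hA hloc.smooth hloc.bo hB).exists_tendsto_zero one_pos
  obtain ⟨r₂, hr₂, h₂⟩ := Metric.isOpen_iff.1 (isOpen_chartOpen q) _ (chart_self_mem q).2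
  refine ⟨min r₁ r₂, lt_min hr₁ hr₂, fun x hx hx0 => ?_⟩
  have hG := h₁ x (hx.trans_le (min_le_left _ _)) hx0
  have hxU : x ∈ closedHalf ∩ chartOpen q := ⟨hx0.ge, h₂ (hx.trans_le (min_le_right _ _))⟩
  have hxB := (symm_mem_Bdry hxU).2 hx0
  set φ : ℂ := Φ ((extChartAt (𝓡∂ 3) q).symm x) 1 with hφ
  have hφ0 : φ ≠ 0 := by
    rw [hφ, Ne, LinearEquiv.map_eq_zero_iff]; exact one_ne_zero
  have key : ∀ n : ℕ, Tendsto (fun y => (n : ℂ) * (n - 2) * (normSqGrad A (inChart q ρ) y : ℂ) +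
      (C y : ℂ)) (L x) (𝓝 (p.eval (n : ℂ) * φ)) := by
    intro n
    have h := (hI _ hxB n).tendsto_chart hρ hP hxU
    have hG' := ((Complex.continuous_ofReal.tendsto 0).comp hG).const_mul (n : ℂ)
    rw [Complex.ofReal_zero, mul_zero] at hG'
    have h' := h.sub hG'
    rw [sub_zero, LinearMap.smul_apply, smul_eq_mul] at h'
    refine h'.congr fun y => ?_
    simp only [Function.comp_apply]
    push_cast
    ring
  have h0 := key 0
  have h1 := key 1
  simp only [Nat.cast_zero, zero_mul, zero_add] at h0
  have hα : Tendsto (fun y => (normSqGrad A (inChart q ρ) y : ℂ)) (L x)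
      (𝓝 ((p.eval 0 - p.eval 1) * φ)) := by
    have := h0.sub h1
    rw [Nat.cast_one, ← sub_mul] at this
    refine this.congr fun y => ?_
    ring
  refine ⟨φ, hφ0, hα, h0, fun n => ?_⟩
  have := L_neBot (z := x) hx0.ge
  have e := tendsto_nhds_unique (key n) ((hα.const_mul ((n : ℂ) * (n - 2))).add h0)
  exact mul_right_cancel₀ hφ0 (e.trans (by ring))

lemma exists_exponent (hρ : IsDefiningFunction ρ)
    (hP : ∀ q ∈ Bdry Mbar, ∃ (A : Fin 3 → Fin 3 → E3 → ℝ) (B : Fin 3 → E3 → ℝ) (C : E3 → ℝ),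
      (∀ i j, SmoothGerm (extChartAt (𝓡∂ 3) q q) (A i j)) ∧
      (∀ i, SmoothGerm (extChartAt (𝓡∂ 3) q q) (B i)) ∧
      SmoothGerm (extChartAt (𝓡∂ 3) q q) C ∧
      (∀ i, BO (extChartAt (𝓡∂ 3) q q) 1 (B i + ∑ j, A i j * pd j (inChart q ρ))) ∧
      ∀ u : Mbar → ℝ, ContMDiffOn (𝓡∂ 3) 𝓘(ℝ, ℝ) ∞ u (IntM Mbar) → ∀ y ∈ chartInt q,
        P u ((extChartAt (𝓡∂ 3) q).symm y) = degOp A B C (inChart q ρ) (inChart q u) y)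
    (hI : HasSimpleIntegerIndicialRoots ρ P) {μ : ℝ} (hμ : IsLargestCharExponent ρ P μ) :
    ∃ m : ℕ, μ = m ∧ ∀ q ∈ Bdry Mbar,
      ∃ (A : Fin 3 → Fin 3 → E3 → ℝ) (B : Fin 3 → E3 → ℝ) (C : E3 → ℝ),
        AdaptedCoeffs (extChartAt (𝓡∂ 3) q q) A B C (inChart q ρ) m ∧
        ∀ u : Mbar → ℝ, ContMDiffOn (𝓡∂ 3) 𝓘(ℝ, ℝ) ∞ u (IntM Mbar) → ∀ y ∈ chartInt q,
          P u ((extChartAt (𝓡∂ 3) q).symm y) = degOp A B C (inChart q ρ) (inChart q u) y := by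
  obtain ⟨p, Φ, hp, hnd, hint, hI⟩ := hI
  obtain ⟨⟨q₀, hq₀, T, hT, hker⟩, hmax⟩ := hμ
  have hroot : p.eval (μ : ℂ) = 0 := by
    obtain ⟨v, hv, hv0⟩ := Submodule.exists_mem_ne_zero_of_ne_bot hker
    have h1 : T 1 = 0 := by
      have : T (v⁻¹ • v) = 0 := by rw [map_smul, LinearMap.mem_ker.1 hv, smul_zero]
      rwa [smul_eq_mul, inv_mul_cancel₀ hv0] at this
    have h2 := hT.apply_one_unique hq₀ (hI q₀ hq₀ μ)
    rw [h1, LinearMap.smul_apply, smul_eq_mul] at h2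
    refine (mul_eq_zero.1 h2.symm).resolve_right fun h => one_ne_zero (α := ℂ) ?_
    exact (LinearEquiv.map_eq_zero_iff (Φ q₀)).1 h
  have hmax' : ∀ s : ℂ, p.eval s = 0 → s.re ≤ μ := fun s hs => by
    refine hmax s ⟨q₀, hq₀, _, hI q₀ hq₀ s, ?_⟩
    rw [hs, zero_smul, LinearMap.ker_zero]
    exact top_ne_bot
  obtain ⟨A₀, B₀, C₀, hA₀, -, -, hB₀, hP₀⟩ := hP q₀ hq₀
  obtain ⟨r₀, hr₀, h₀⟩ := indicial_limits hρ hq₀ hA₀ hB₀ hP₀ hI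
  obtain ⟨-, -, -, -, hpn⟩ := h₀ _ (by rwa [dist_self]) (chart_self_zero hq₀)
  obtain ⟨hc, m, hm, rfl⟩ := indicial_polynomial hp hpn hnd hint hroot hmax'
  refine ⟨m, rfl, fun q hq => ?_⟩
  obtain ⟨A, B, C, hA, hB, hC, hAB, hPq⟩ := hP q hq
  have hloc := hρ.isLocalDefining hq
  obtain ⟨r, hr, hlim⟩ := indicial_limits hρ hq hA hAB hPq hI
  have hα := smoothGerm_normSqGrad hA hloc.smooth
  refine ⟨A, B, C, ⟨hloc.hz, hm, hA, hB, hC, hloc.smooth, hloc.bo, hAB, ?_, ?_⟩, hPq⟩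
  -- That `m` is a root of `p` means that `C + m (m - 2) |dρ|²` tends to zero at every nearby
  -- boundary point.
  · refine (hC.add (hα.const_smul _)).bo_one hloc.hz hr fun x hx hx0 => ?_
    obtain ⟨φ, hφ, h1, h2, -⟩ := hlim x hx hx0
    have h3 := h2.add (h1.const_mul ((m : ℂ) * (m - 2)))
    have h4 : p.eval 0 * φ + (m : ℂ) * (m - 2) * ((p.eval 0 - p.eval 1) * φ) = 0 := by
      have := hpn m
      rw [Complex.ofReal_natCast] at hroot
      rw [hroot] at this
      linear_combination -φ * this
    rw [h4] at h3
    have h5 := (Complex.continuous_re.tendsto 0).comp h3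
    rw [Complex.zero_re] at h5
    refine h5.congr fun y => ?_
    have : (C y : ℂ) + (m : ℂ) * (m - 2) * (normSqGrad A (inChart q ρ) y : ℂ) =
        ((C y + (m : ℝ) * (m - 2) * normSqGrad A (inChart q ρ) y : ℝ) : ℂ) := by push_cast; ring
    rw [Function.comp_apply, this, Complex.ofReal_re]
    rfl
  · obtain ⟨φ, hφ, h1, -, -⟩ := hlim _ (by rwa [dist_self]) hloc.hz
    have h2 := h1.norm
    have h3 : 0 < ‖(p.eval 0 - p.eval 1) * φ‖ := norm_pos_iff.2 (mul_ne_zero hc hφ)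
    refine ⟨_, half_pos h3, (h2.eventually (lt_mem_nhds (half_lt_self h3))).mono fun y hy => ?_⟩
    rw [Complex.norm_real] at hy
    exact hy.le

end Exponent

/-! ### From weighted and polyhomogeneous classes to conormal germs. -/

section Weighted

variable {z : E3} {R : E3 → ℝ}

lemma IsLocalDefining.rpow_le (H : IsLocalDefining z R) (a : ℝ) :
    ∃ K > 0, ∀ᶠ y in L z, R y ^ a ≤ K * y 0 ^ a := by
  rcases le_total 0 a with ha | ha
  · obtain ⟨K, hK⟩ := (H.smooth.inv_coord_mul H.hz H.bo).bounded H.hz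
    refine ⟨(|K| + 1) ^ a, by positivity, ?_⟩
    filter_upwards [hK, H.pos, eventually_pos] with y h1 h2 h3
    rw [← Real.mul_rpow (by positivity) h3.le]
    refine Real.rpow_le_rpow h2.le ?_ ha
    rw [Pi.mul_apply, abs_mul, abs_of_pos (inv_pos.2 h3), abs_of_pos h2, inv_mul_eq_div,
      div_le_iff₀ h3] at h1
    exact h1.trans (mul_le_mul_of_nonneg_right ((le_abs_self K).trans (by linarith)) h3.le)
  · obtain ⟨c, hc, h⟩ := H.lower
    refine ⟨c ^ a, by positivity, ?_⟩
    filter_upwards [h, eventually_pos] with y h1 h3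
    rw [← Real.mul_rpow hc.le h3.le]
    exact Real.rpow_le_rpow_of_nonpos (by positivity) h1 ha

variable {Mbar : Type*} [TopologicalSpace Mbar] [ChartedSpace H3 Mbar]
  [IsManifold (𝓡∂ 3) ∞ Mbar] {ρ : Mbar → ℝ} {q : Mbar}
  {V : Type*} [NormedAddCommGroup V] [NormedSpace ℝ V] {u : Mbar → V}

lemma MemWeightedCk.chart_bound {k : ℕ} {t : ℝ} (h : MemWeightedCk ρ k t u) (q : Mbar) :
    ∃ C : ℝ, ∀ᶠ y in L (extChartAt (𝓡∂ 3) q q), ∀ j ≤ k,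
      ‖iteratedFDeriv ℝ j (inChart q u) y‖ ≤ C * inChart q ρ y ^ (t - j) := by
  obtain ⟨C, hC⟩ := h.2 q
  refine ⟨C, ?_⟩
  filter_upwards [(tendsto_chart_symm_self q).eventually hC, eventually_mem_target q] with y h1 h2
  rwa [(extChartAt (𝓡∂ 3) q).right_inv (chartInt_subset_target q h2)] at h1

lemma MemB.contMDiffOn {δ : ℝ} (h : MemB ρ δ u) : ContMDiffOn (𝓡∂ 3) 𝓘(ℝ, V) ∞ u (IntM Mbar) :=
  contMDiffOn_infty.2 fun k => (h k (δ - 1) (by linarith)).1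

lemma MemB.bo (hρ : IsDefiningFunction ρ) {δ : ℝ} (h : MemB ρ δ u) (hq : q ∈ Bdry Mbar) :
    BO (extChartAt (𝓡∂ 3) q q) δ (inChart q u) := by
  intro s hs
  have H := hρ.isLocalDefining hq
  obtain ⟨C, hC⟩ := (h 0 s hs).chart_bound q
  obtain ⟨K, hK0, hK⟩ := H.rpow_le s
  refine ⟨|C| * K, ?_⟩
  filter_upwards [hC, hK, H.pos] with y h1 h2 h3
  have h4 := h1 0 le_rfl
  rw [norm_iteratedFDeriv_zero, Nat.cast_zero, sub_zero] at h4
  rw [mul_assoc]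
  have h5 : (0 : ℝ) ≤ inChart q ρ y ^ s := Real.rpow_nonneg (le_of_lt h3) s
  exact h4.trans ((mul_le_mul_of_nonneg_right (le_abs_self C) h5).trans
    (mul_le_mul_of_nonneg_left h2 (abs_nonneg C)))

/-- `MemB` charges one power of `ρ` for every derivative, also a tangential one. A remainder of
weight `n` pays for `n` derivatives. -/
lemma MemB.con (hρ : IsDefiningFunction ρ) {n : ℕ} (h : MemB ρ ((n + 1 : ℕ) : ℝ) u)
    (hq : q ∈ Bdry Mbar) : Con (extChartAt (𝓡∂ 3) q q) n 0 (inChart q u) := by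
  have H := hρ.isLocalDefining hq
  obtain ⟨C, hC⟩ := (h n n (by push_cast; linarith)).chart_bound q
  refine Con.of_iteratedFDeriv (smoothNear_chart h.contMDiffOn q) fun j hj => ?_
  refine BO.of_bounded H.hz (C := |C|) ?_
  filter_upwards [hC, H.pos, H.lt_one] with y h1 h2 h3
  refine (h1 j hj).trans ?_
  have h4 : (0 : ℝ) ≤ n - j := sub_nonneg.2 (by exact_mod_cast hj)
  have h5 : inChart q ρ y ^ ((n : ℝ) - j) ≤ 1 := Real.rpow_le_one (le_of_lt h2) h3 h4
  have h6 : (0 : ℝ) ≤ inChart q ρ y ^ ((n : ℝ) - j) := Real.rpow_nonneg (le_of_lt h2) _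
  calc C * inChart q ρ y ^ ((n : ℝ) - j) ≤ |C| * inChart q ρ y ^ ((n : ℝ) - j) :=
        mul_le_mul_of_nonneg_right (le_abs_self C) h6
    _ ≤ |C| * 1 := mul_le_mul_of_nonneg_left h5 (abs_nonneg C)
    _ = |C| := mul_one _

lemma Conormal.pow_zero_weight {A : Type*} [NormedCommRing A] [NormedAlgebra ℝ A] [NormOneClass A]
    (hz : z 0 = 0) {F : E3 → A} (hF : Conormal z 0 F) (m : ℕ) : Conormal z 0 (F ^ m) := by
  induction m with
  | zero => rw [pow_zero]; exact Conormal.const hz 1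
  | succ m ih => rw [pow_succ]; simpa using ih.mul hF

/-- Each term of the expansion is conormal, with a weight bounded below through the first exponent.
The number of terms grows with the number `n` of derivatives, but the weight does not depend on `n`.
-/
lemma IsPolyhomogeneous.conormal (hρ : IsDefiningFunction ρ) {u : Mbar → ℂ}
    (h : IsPolyhomogeneous ρ u) (hq : q ∈ Bdry Mbar) :
    ∃ σ : ℝ, Conormal (extChartAt (𝓡∂ 3) q q) σ (inChart q u) := by
  obtain ⟨-, s, p, w, hmono, -, hw, hexp⟩ := h
  have H := hρ.isLocalDefining hq
  refine ⟨min (s 0).re 0, fun n => ?_⟩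
  obtain ⟨N, hN⟩ := hexp (n + 1)
  set S : E3 → ℂ := ∑ i ∈ Finset.range (N + 1), ∑ m ∈ Finset.range (p i + 1),
    (fun y => ((inChart q ρ y : ℝ) : ℂ) ^ (s i)) *
      (fun y => Complex.ofRealCLM (Real.log (inChart q ρ y))) ^ m * inChart q (w i m) with hS
  have hSc : Conormal (extChartAt (𝓡∂ 3) q q) (min (s 0).re 0) S := by
    refine Conormal.sum _ fun i _ => Conormal.sum _ fun m _ => ?_
    have h1 := ((H.cpow (s i)).mul ((H.log.clm Complex.ofRealCLM).pow_zero_weight H.hz m)).mul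
      (smoothGerm_chart (hw i m) hq).conormal
    refine h1.mono ?_
    rw [add_zero, add_zero]
    exact min_le_min_right _ (hmono (Nat.zero_le i))
  have e := ((hN.con hρ hq).mono (min_le_right (s 0).re 0)).add (hSc n)
  convert e using 1
  funext y
  simp only [hS, Pi.add_apply, Function.comp_apply, Finset.sum_apply, Pi.mul_apply, Pi.pow_apply,
    Complex.ofRealCLM_apply, sub_add_cancel]

/-- The expansion yields some weight `σ`; the decay contained in `MemB` improves it to `δ` by
interpolation. -/
lemma MemBphg.conormal (hρ : IsDefiningFunction ρ) {u : Mbar → ℝ} {δ : ℝ} (h : MemBphg ρ δ u)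
    (hq : q ∈ Bdry Mbar) : Conormal (extChartAt (𝓡∂ 3) q q) δ (inChart q u) := by
  obtain ⟨σ, hσ⟩ := h.1.conormal hρ hq
  have h1 : Conormal (extChartAt (𝓡∂ 3) q q) σ (inChart q u) :=
    hσ.clm Complex.reCLM
  exact h1.of_bo (chart_self_zero hq) (h.2.bo hρ hq)

end Weighted

/-! ### Taylor expansion of the nonlinearity along a decaying function. -/

section PowerSeries

lemma BO.pow {z : E3} {F : E3 → ℝ} {t : ℝ} (hz : z 0 = 0) (hF : BO z t F) (m : ℕ) :
    BO z (m * t) (F ^ m) := by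
  induction m with
  | zero =>
    rw [pow_zero, Nat.cast_zero, zero_mul]
    exact (Conormal.const hz 1).bo
  | succ m ih =>
    rw [pow_succ]
    exact (ih.mul hF).mono (by push_cast; linarith)

/-- The coefficients of a uniformly convergent power series are uniformly bounded. -/
lemma exists_coeff_bound {X : Type*} {S : Set X} {a : ℕ → X → ℝ} {f : X → ℝ → ℝ} {r r' : ℝ}
    (hr' : 0 < r') (hr : r' < r)
    (h : TendstoUniformlyOn (fun (n : ℕ) (z : X × ℝ) => ∑ l ∈ Finset.range n, a l z.1 * z.2 ^ l)
        (fun z => f z.1 z.2) atTop (S ×ˢ Ioo (-r) r)) :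
    ∃ N₀ : ℕ, ∀ l ≥ N₀, ∀ x ∈ S, |a l x| * r' ^ l ≤ 2 := by
  obtain ⟨N₀, hN₀⟩ := eventually_atTop.1 (Metric.tendstoUniformlyOn_iff.1 h 1 one_pos)
  refine ⟨N₀, fun l hl x hx => ?_⟩
  have hm : (x, r') ∈ S ×ˢ Ioo (-r) r := ⟨hx, by simp only [mem_Ioo]; constructor <;> linarith⟩
  have h1 := hN₀ l hl _ hm
  have h2 := hN₀ (l + 1) (by omega) _ hm
  rw [Real.dist_eq] at h1 h2
  -- Two consecutive partial sums are within `1` of the limit; their difference is the `l`-th term.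
  rw [Finset.sum_range_succ] at h2
  rw [← abs_of_pos (pow_pos hr' l), ← abs_mul]
  rw [abs_lt] at h1 h2
  rw [abs_le]
  simp only at h1 h2
  constructor <;> linarith [h1.1, h1.2, h2.1, h2.2]

/-- The tail is dominated by a geometric series of ratio at most `1/2`, which accounts for the
factor `2`. -/
lemma abs_sub_sum_le {c : ℕ → ℝ} {v r K S : ℝ} (hr : 0 < r) (hv : |v| ≤ r / 2)
    (hc : ∀ l, |c l| * r ^ l ≤ K) (hS : HasSum (fun l => c l * v ^ l) S) (N : ℕ) :
    |S - ∑ l ∈ Finset.range N, c l * v ^ l| ≤ 2 * K / r ^ N * |v| ^ N := by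
  have hK : 0 ≤ K := (mul_nonneg (abs_nonneg _) (pow_nonneg hr.le 0)).trans (hc 0)
  have hθ : |v| / r ≤ 1 / 2 := by rw [div_le_iff₀ hr]; linarith
  have hb : ∀ l, ‖c l * v ^ l‖ ≤ K * (|v| / r) ^ l := fun l => by
    rw [Real.norm_eq_abs, abs_mul, abs_pow, div_pow, mul_div_assoc', le_div_iff₀ (pow_pos hr l)]
    calc |c l| * |v| ^ l * r ^ l = |c l| * r ^ l * |v| ^ l := by ring
      _ ≤ K * |v| ^ l := mul_le_mul_of_nonneg_right (hc l) (by positivity)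
  have h := norm_sub_le_of_geometric_bound_of_hasSum (by linarith) hb hS N
  rw [norm_sub_rev, Real.norm_eq_abs] at h
  refine h.trans ?_
  rw [div_le_iff₀ (by linarith)]
  have h1 : K * (|v| / r) ^ N = K / r ^ N * |v| ^ N := by rw [div_pow]; ring
  rw [h1, show 2 * K / r ^ N * |v| ^ N * (1 - |v| / r) =
    K / r ^ N * |v| ^ N * (2 * (1 - |v| / r)) by ring]
  exact le_mul_of_one_le_right (by positivity) (by linarith)

variable {Mbar : Type*} [TopologicalSpace Mbar] [ChartedSpace H3 Mbar]
  [IsManifold (𝓡∂ 3) ∞ Mbar] {ρ : Mbar → ℝ} {q : Mbar}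

/-- The Taylor expansion of an admissible nonlinearity along a decaying function. -/
lemma IsAdmissibleNonlinearity.expansion (hρ : IsDefiningFunction ρ) {I : Set ℝ}
    {f : Mbar → ℝ → ℝ} (hf : IsAdmissibleNonlinearity ρ I f) (hq : q ∈ Bdry Mbar) {u : Mbar → ℝ}
    {t : ℝ} (ht : 0 < t) (hu : BO (extChartAt (𝓡∂ 3) q q) t (inChart q u)) :
    ∃ a : ℕ → E3 → ℝ, (∀ l, SmoothGerm (extChartAt (𝓡∂ 3) q q) (a l)) ∧
      BO (extChartAt (𝓡∂ 3) q q) 1 (a 1) ∧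
      ∀ N : ℕ, BO (extChartAt (𝓡∂ 3) q q) (N * t) (inChart q (fun x => f x (u x)) -
        ∑ l ∈ Finset.range N, a l * inChart q u ^ l) := by
  obtain ⟨-, -, -, -, a, ha, hab, r, hr, -, hsum, hunif⟩ := hf
  have H := hρ.isLocalDefining hq
  have has : ∀ l, SmoothGerm (extChartAt (𝓡∂ 3) q q) (inChart q (a l)) := fun l =>
    smoothGerm_chart (ha l) hq
  refine ⟨fun l => inChart q (a l), has, ?_, fun N => ?_⟩
  · obtain ⟨b, hb, hab⟩ := hab 1 one_lt_two
    refine (H.bo.mul_smooth (smoothGerm_chart hb hq)).congr (Eventually.of_forall fun y => ?_)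
    exact (hab _).symm
  · have hr2 : 0 < r / 2 := half_pos hr
    obtain ⟨N₀, hN₀⟩ := exists_coeff_bound hr2 (half_lt_self hr) hunif
    choose M hM using fun l => (has l).bounded H.hz
    -- Uniform convergence bounds all coefficients beyond `N₀`; the finitely many others are bounded
    -- as smooth germs.
    have hK : ∃ K, ∀ᶠ y in L (extChartAt (𝓡∂ 3) q q), ∀ l, |inChart q (a l) y| * (r / 2) ^ l ≤ K := by
      refine ⟨2 + ∑ l ∈ Finset.range N₀, |M l| * (r / 2) ^ l, ?_⟩
      have h1 : ∀ᶠ y in L (extChartAt (𝓡∂ 3) q q), ∀ l ∈ Finset.range N₀,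
          |inChart q (a l) y| ≤ M l := (Finset.eventually_all _).2 fun l _ => hM l
      filter_upwards [h1, eventually_mem_target q] with y h1 h2 l
      have h0 : ∀ l ∈ Finset.range N₀, 0 ≤ |M l| * (r / 2) ^ l := fun l _ => by positivity
      by_cases hl : l < N₀
      · have h3 := Finset.single_le_sum h0 (Finset.mem_range.2 hl)
        have h4 := (h1 l (Finset.mem_range.2 hl)).trans (le_abs_self _)
        have h5 := mul_le_mul_of_nonneg_right h4 (pow_nonneg hr2.le l)
        linarith
      · have h3 := hN₀ l (not_lt.1 hl) _ (symm_mem_interior h2)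
        have h4 := Finset.sum_nonneg h0
        exact h3.trans (by linarith)
    obtain ⟨K, hK⟩ := hK
    have hsmall : ∀ᶠ y in L (extChartAt (𝓡∂ 3) q q), |inChart q u y| < r / 2 / 2 := by
      have := (hu.tendsto_zero H.hz ht).abs
      rw [abs_zero] at this
      exact this.eventually (gt_mem_nhds (half_pos hr2))
    refine (((hu.pow H.hz N).const_smul (2 * K / (r / 2) ^ N))).of_le ?_
    filter_upwards [hK, hsmall, eventually_mem_target q] with y h1 h2 h3
    have hv : u ((extChartAt (𝓡∂ 3) q).symm y) ∈ Ioo (-r) r := by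
      have h4 : |u ((extChartAt (𝓡∂ 3) q).symm y)| < r / 2 / 2 := h2
      rw [mem_Ioo, ← abs_lt]
      linarith
    have hx := symm_mem_interior h3
    have hs : HasSum (fun l => a l ((extChartAt (𝓡∂ 3) q).symm y) *
        u ((extChartAt (𝓡∂ 3) q).symm y) ^ l)
        (f ((extChartAt (𝓡∂ 3) q).symm y) (u ((extChartAt (𝓡∂ 3) q).symm y))) :=
      ((hsum _ hx _ hv).of_abs.hasSum_iff_tendsto_nat).2
        (hunif.tendsto_at (x := (_, _)) ⟨hx, hv⟩)
    have := abs_sub_sum_le hr2 h2.le h1 hs N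
    simp only [Pi.sub_apply, Finset.sum_apply, Pi.mul_apply, Pi.pow_apply, Pi.smul_apply,
      smul_eq_mul, Real.norm_eq_abs, Function.comp_apply] at this ⊢
    refine this.trans ?_
    rw [← abs_pow]
    rw [abs_mul]
    exact mul_le_mul_of_nonneg_right (le_abs_self _) (abs_nonneg _)

end PowerSeries

/-! ### Gluing the local extensions to a smooth function on the manifold. -/

section Extension

variable {Mbar : Type*} [TopologicalSpace Mbar] [ChartedSpace H3 Mbar]
  [IsManifold (𝓡∂ 3) ∞ Mbar] {q : Mbar} {u : Mbar → ℝ}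

lemma tendsto_chart {y : E3} (hy : y ∈ closedHalf ∩ chartOpen q) :
    Tendsto (extChartAt (𝓡∂ 3) q) (𝓝[IntM Mbar] ((extChartAt (𝓡∂ 3) q).symm y)) (L y) := by
  rw [← chart_target] at hy
  have hs := (extChartAt (𝓡∂ 3) q).map_target hy
  refine tendsto_nhdsWithin_iff.2 ⟨?_, ?_⟩
  · have h := (continuousAt_extChartAt' hs).tendsto
    rw [(extChartAt (𝓡∂ 3) q).right_inv hy] at h
    exact h.mono_left nhdsWithin_le_nhds
  · filter_upwards [nhdsWithin_le_nhds ((isOpen_extChartAt_source q).mem_nhds hs),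
      self_mem_nhdsWithin] with x hx hxi
    have ht := (extChartAt (𝓡∂ 3) q).map_source hx
    rw [chart_target] at ht
    refine (symm_mem_IntM ht).1 ?_
    rwa [(extChartAt (𝓡∂ 3) q).left_inv hx]

lemma extendFrom_chart {y : E3} (hy : y ∈ closedHalf ∩ chartOpen q) {c : ℝ}
    (h : Tendsto (inChart q u) (L y) (𝓝 c)) :
    extendFrom (IntM Mbar) u ((extChartAt (𝓡∂ 3) q).symm y) = c := by
  have hne : (𝓝[IntM Mbar] ((extChartAt (𝓡∂ 3) q).symm y)).NeBot :=
    ((L_neBot hy.1).map _).mono (tendsto_chart_symm hy)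
  refine extendFrom_eq (mem_closure_iff_nhdsWithin_neBot.2 hne) ?_
  refine (h.comp (tendsto_chart hy)).congr' ?_
  have hs : (extChartAt (𝓡∂ 3) q).symm y ∈ (extChartAt (𝓡∂ 3) q).source :=
    (extChartAt (𝓡∂ 3) q).map_target (by rwa [chart_target])
  filter_upwards [nhdsWithin_le_nhds ((isOpen_extChartAt_source q).mem_nhds hs)] with x hx
  simp only [Function.comp_apply, (extChartAt (𝓡∂ 3) q).left_inv hx]

lemma extendFrom_interior (hu : ContMDiffOn (𝓡∂ 3) 𝓘(ℝ, ℝ) ∞ u (IntM Mbar)) {x : Mbar}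
    (hx : x ∈ IntM Mbar) : extendFrom (IntM Mbar) u x = u x :=
  extendFrom_eq (subset_closure hx) (hu.continuousOn x hx)

/-- A function that is smooth in the interior and has smooth germs at the boundary extends
smoothly to the boundary. -/
theorem contMDiff_extendFrom (hu : ContMDiffOn (𝓡∂ 3) 𝓘(ℝ, ℝ) ∞ u (IntM Mbar))
    (hb : ∀ q ∈ Bdry Mbar, SmoothGerm (extChartAt (𝓡∂ 3) q q) (inChart q u)) :
    ContMDiff (𝓡∂ 3) 𝓘(ℝ, ℝ) ∞ (extendFrom (IntM Mbar) u) := by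
  intro q
  by_cases hq : q ∈ IntM Mbar
  · have hn : IntM Mbar ∈ 𝓝 q :=
      ((𝓡∂ 3).isOpen_interior (n := ∞) (by simp)).mem_nhds hq
    refine (hu.contMDiffAt hn).congr_of_eventuallyEq ?_
    filter_upwards [hn] with x hx using extendFrom_interior hu hx
  · have hq' : q ∈ Bdry Mbar := by rwa [Bdry, ← ModelWithCorners.compl_interior]
    have hg := hb q hq'
    rw [contMDiffAt_iff_source, range_model, contMDiffWithinAt_iff_contDiffWithinAt]
    have hz := chart_self_mem q
    obtain ⟨r, hr, hlim⟩ := hg.exists_tendsto (chart_self_zero hq')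
    refine (hg.contDiffWithinAt_extendFrom (chart_self_zero hq')).congr_of_eventuallyEq_of_mem ?_ hz.1
    have h1 : ∀ᶠ y in 𝓝[closedHalf] (extChartAt (𝓡∂ 3) q q), y ∈ chartOpen q :=
      nhdsWithin_le_nhds ((isOpen_chartOpen q).mem_nhds hz.2)
    have h2 : ∀ᶠ y in 𝓝[closedHalf] (extChartAt (𝓡∂ 3) q q), dist y (extChartAt (𝓡∂ 3) q q) < r :=
      nhdsWithin_le_nhds (Metric.ball_mem_nhds _ hr)
    filter_upwards [h1, h2, self_mem_nhdsWithin] with y h1 h2 h3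
    exact extendFrom_chart ⟨h3, h1⟩ (hlim y h2)

end Extension

/-- Regularity up to the boundary of polyhomogeneous solutions of semilinear equations. -/
theorem smooth_extension {Mbar : Type*} [TopologicalSpace Mbar] [T2Space Mbar]
    [ChartedSpace H3 Mbar] [IsManifold (𝓡∂ 3) ∞ Mbar]
    {ρ : Mbar → ℝ} (hρ : IsDefiningFunction ρ)
    {g : BilinField Mbar} (hg : IsAsymptoticallyHyperbolic ∞ ρ g)
    {P : (Mbar → ℝ) → Mbar → ℝ} (hP : IsEllipticGeometricSelfAdjoint g P)
    (hI : HasSimpleIntegerIndicialRoots ρ P) {μ : ℝ} (hμ : IsLargestCharExponent ρ P μ)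
    {I : Set ℝ} {f : Mbar → ℝ → ℝ} (hf : IsAdmissibleNonlinearity ρ I f)
    {u : Mbar → ℝ} (hu : MemBphg ρ μ u) (hPu : ∀ x ∈ IntM Mbar, P u x = f x (u x))
    {δ : ℝ} (hδ : μ < δ) (hfu : MemB ρ δ (fun x => f x (u x))) :
    ContMDiff (𝓡∂ 3) 𝓘(ℝ, ℝ) ∞ (extendFrom (IntM Mbar) u) := by
  obtain ⟨gbar, hgbar, -⟩ := hg
  obtain ⟨⟨Q, hQ, -⟩, hS⟩ := hP
  obtain ⟨m, rfl, hcoef⟩ := exists_exponent hρ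
    (fun q hq => exists_chartCoeffs hρ hgbar hQ hS hq) hI hμ
  refine contMDiff_extendFrom hu.2.contMDiffOn fun q hq => ?_
  obtain ⟨A, B, C, H, hPq⟩ := hcoef q hq
  have hm : (0 : ℝ) < m := by
    have := H.two_le
    exact_mod_cast (by omega : 0 < m)
  have huc := hu.conormal hρ hq
  obtain ⟨a, ha, ha1, hser⟩ := hf.expansion hρ hq hm huc.bo
  refine H.smoothGerm huc ?_ hδ (hfu.bo hρ hq) ha ha1 hser
  filter_upwards [eventually_mem_target q] with y hy
  rw [← hPq u hu.2.contMDiffOn y hy, hPu _ (symm_mem_interior hy)]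
  rfl

end

end AsympHyp

theorem mainTheorem4
    {Mbar : Type*} [TopologicalSpace Mbar] [T2Space Mbar] [CompactSpace Mbar]
    [ChartedSpace AsympHyp.H3 Mbar] [IsManifold (𝓡∂ 3) ∞ Mbar]
    (ρ : Mbar → ℝ) (hρ : AsympHyp.IsDefiningFunction ρ)
    (g : AsympHyp.BilinField Mbar) (hg : AsympHyp.IsAsymptoticallyHyperbolic ∞ ρ g)
    (P : (Mbar → ℝ) → Mbar → ℝ) (hP : AsympHyp.IsEllipticGeometricSelfAdjoint g P)
    (hI : AsympHyp.HasSimpleIntegerIndicialRoots ρ P)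
    (μ : ℝ) (hμ : AsympHyp.IsLargestCharExponent ρ P μ)
    (I : Set ℝ) (f : Mbar → ℝ → ℝ) (hf : AsympHyp.IsAdmissibleNonlinearity ρ I f)
    (u : Mbar → ℝ) (hu : AsympHyp.MemBphg ρ μ u)
    (huI : ∀ x ∈ AsympHyp.IntM Mbar, u x ∈ I)
    (hPu : ∀ x ∈ AsympHyp.IntM Mbar, P u x = f x (u x))
    (δ : ℝ) (hδ : μ < δ) (hfu : AsympHyp.MemB ρ δ (fun x => f x (u x))) :
    ∃ U : Mbar → ℝ, ContMDiff (𝓡∂ 3) 𝓘(ℝ, ℝ) ∞ U ∧ ∀ x ∈ AsympHyp.IntM Mbar, U x = u x := by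
  exact ⟨extendFrom (AsympHyp.IntM Mbar) u,
    AsympHyp.smooth_extension hρ hg hP hI hμ hf hu hPu hδ hfu,
    fun x hx => AsympHyp.extendFrom_interior hu.2.contMDiffOn hx⟩
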